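/- Let $\mathbb T^1=\mathbb C/\Lambda$ be a one-dimensional complex torus, let $M=\mathbb T^1\times\mathbb{CP}^1$, and for $\epsilon\in\mathbb C$ let $\Phi_\epsilon([z],[w_1:w_2])=([z+\epsilon],[w_1:w_2])$. A horizontal (resp. vertical) flow box in $M$ is a family of disjoint holomorphic graphs (plaques) $\Gamma_\alpha=\{\eta=\alpha+f_\alpha(\zeta)\}$, $f_\alpha(0)=0$, $\alpha\in A\subset\mathbb C$, over a disk $\{|\zeta|<r\}$, read in a coordinate bidisk of $M$ that is the product of a disk on which $\mathbb C\to\mathbb T^1$ is injective and a disk in one of the two standard affine charts of $\mathbb{CP}^1$, where $\zeta$ is the torus coordinate (resp. the coordinate of $\mathbb{CP}^1$) and $\eta$ the other one, and where $(\zeta,\alpha)\mapsto(\zeta,\alpha+f_\alpha(\zeta))$ is a homeomorphism onto its image. A lamination $(X,\mathcal L)$ by Riemann surfaces embedded in $M$ is a compact set $X\subset M$ covered by horizontal or vertical flow boxes, each filling a relatively open subset of $X$, whose plaques agree locally on overlaps; its flow boxes are all the flow boxes compatible with these. Leaves are the sets obtained by following chains of plaques; a minimal set is a minimal nonempty closed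 union of leaves. The lamination is Lipschitz if every point of $X$ lies in a flow box for which there is $C>0$ with $|\alpha-\beta|/C\le|\alpha+f_\alpha(\zeta)-\beta-f_\beta(\zeta)|\le C|\alpha-\beta|$ for all $\alpha,\beta\in A$ and $|\zeta|<r$. **Theorem.** Let $(X,\mathcal L)$ be a lamination by Riemann surfaces embedded in $M=\mathbb T^1\times\mathbb{CP}^1$, without compact leaves and having exactly one minimal set. Then there exist a finite covering of $X$ by (horizontal or vertical) flow boxes of $\mathcal L$ and constants $N\in\mathbb N$, $\epsilon_0>0$ and $A>0$ such that, for all plaques $\Gamma_\alpha,\Gamma_\beta$ of the same flow box of the covering and all $\epsilon\in\mathbb C$ with $0<|\epsilon|<\epsilon_0$, the set $\Gamma_\alpha\cap\Gamma_\beta^\epsilon$, where $\Gamma_\beta^\epsilon=\Phi_\epsilon(\Gamma_\beta)$, is finite and 1. if $(X,\mathcal L)$ is Lipschitz, then $\mathrm{Card}(\Gamma_\alpha\cap\Gamma_\beta^\epsilon)<N$; 2. in general (Lipschitz or not), $\mathrm{Card}(\Gamma_\alpha\cap\Gamma_\beta^\epsilon)<A\log(1/|\epsilon|)$. -/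

import Mathlib

open Set Metric Topology

/-- The one-dimensional complex torus `𝕋¹ = ℂ / Λ`. -/
abbrev Torus (Λ : Submodule ℤ ℂ) : Type := ℂ ⧸ Λ

/-- The projection `z ↦ [z]` of `ℂ` onto the torus. -/
def torusProj (Λ : Submodule ℤ ℂ) (z : ℂ) : Torus Λ := Λ.mkQ z

/-- The complex projective line, as the one-point compactification of `ℂ`:
the point `[1 : w]` is `(w : OnePoint ℂ)`, and `[0 : 1]` is `∞`. -/
abbrev ProjLine : Type := OnePoint ℂ

/-- The complex surface `M = 𝕋¹ × ℂℙ¹`. -/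
abbrev Surface (Λ : Submodule ℤ ℂ) : Type := Torus Λ × ProjLine

/-- The two standard parametrizations of the projective line. -/
inductive ProjChart
  /-- `w ↦ [1 : w]` -/
  | affine
  /-- `w ↦ [w : 1]` -/
  | infinite

open Classical in
/-- The parametrization `ℂ → ℂℙ¹` given by a chart: `w ↦ [1 : w]` or `w ↦ [w : 1]`;
for `w ≠ 0` the latter point is `[1 : w⁻¹]`. -/
noncomputable def ProjChart.param : ProjChart → ℂ → ProjLine
  | .affine, w => (w : OnePoint ℂ)
  | .infinite, w => if w = 0 then OnePoint.infty else ((w⁻¹ : ℂ) : OnePoint ℂ)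

/-- In a horizontal flow box the plaques are graphs over the torus coordinate, in a vertical one
they are graphs over the projective coordinate. -/
inductive BoxOrientation
  | horizontal
  | vertical

/-- The parametrization `φ = (φ₁, φ₂)` of the surface near `φ(z₀, w₀)`, written with
the base coordinate `ζ` and the transverse coordinate `η` of a box of the given orientation. -/
noncomputable def boxParam (Λ : Submodule ℤ ℂ) (o : BoxOrientation) (c : ProjChart) (z₀ w₀ ζ η : ℂ) :
    Surface Λ :=
  match o with
  | .horizontal => (torusProj Λ (z₀ + ζ), c.param (w₀ + η))
  | .vertical => (torusProj Λ (z₀ + η), c.param (w₀ + ζ))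

/-- The radius of the disk in the torus coordinate, for a box with base disk of radius `r` and
transverse disk of radius `s`. -/
def torusRadius (o : BoxOrientation) (r s : ℝ) : ℝ :=
  match o with
  | .horizontal => r
  | .vertical => s

/-- A horizontal or vertical flow box in `𝕋¹ × ℂℙ¹`, centered at `φ(z₀, w₀)`. Its plaques are the
graphs `ζ ↦ α + f_α(ζ)` over the disk of radius `r`, one for each parameter `α ∈ A`, read in a
coordinate bidisk on which `φ` is injective. The map `(ζ, α) ↦ φ(ζ, α + f_α(ζ))` is holomorphic
in `ζ` and a homeomorphism of `Δ_r × A` onto its image; in particular distinct plaques are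
disjoint. -/
structure FlowBox (Λ : Submodule ℤ ℂ) where
  orientation : BoxOrientation
  chart : ProjChart
  z₀ : ℂ
  w₀ : ℂ
  /-- radius of the base disk -/
  r : ℝ
  /-- radius of the transverse disk -/
  s : ℝ
  r_pos : 0 < r
  s_pos : 0 < s
  injOn : InjOn (torusProj Λ) (ball z₀ (torusRadius orientation r s))
  /-- the transversal -/
  A : Set ℂ
  zero_mem : (0 : ℂ) ∈ A
  /-- the functions `f_α` -/
  f : ℂ → ℂ → ℂ
  f_zero : ∀ α ∈ A, f α 0 = 0
  holo : ∀ α ∈ A, DifferentiableOn ℂ (f α) (ball 0 r)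
  mem_ball : ∀ α ∈ A, ∀ ζ ∈ ball (0 : ℂ) r, α + f α ζ ∈ ball (0 : ℂ) s
  isEmbedding : IsEmbedding (fun q : ball (0 : ℂ) r × A =>
    boxParam Λ orientation chart z₀ w₀ q.1 ((q.2 : ℂ) + f q.2 q.1))

namespace FlowBox

variable {Λ : Submodule ℤ ℂ}

/-- The plaque `Γ_α` of a flow box. -/
def plaque (B : FlowBox Λ) (α : ℂ) : Set (Surface Λ) :=
  (fun ζ : ℂ => boxParam Λ B.orientation B.chart B.z₀ B.w₀ ζ (α + B.f α ζ)) '' ball (0 : ℂ) B.r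

/-- The union of the plaques of a flow box. -/
def support (B : FlowBox Λ) : Set (Surface Λ) := ⋃ α ∈ B.A, B.plaque α

/-- Two flow boxes are compatible if, near every common point, the two plaques through it
coincide. -/
def Compatible (B B' : FlowBox Λ) : Prop :=
  ∀ α ∈ B.A, ∀ β ∈ B'.A, ∀ p ∈ B.plaque α ∩ B'.plaque β,
    ∃ V ∈ 𝓝 p, B.plaque α ∩ V = B'.plaque β ∩ V

/-- The plaques of `B` fill `X ∩ U` for some open subset `U` of the surface. -/
def FillsOpen (B : FlowBox Λ) (X : Set (Surface Λ)) : Prop :=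
  ∃ U : Set (Surface Λ), IsOpen U ∧ X ∩ U = B.support

/-- The transverse distances `|α + f_α(ζ) - β - f_β(ζ)|` are comparable, uniformly in `ζ`,
to `|α - β|`. -/
def IsBiLipschitz (B : FlowBox Λ) : Prop :=
  ∃ C : ℝ, 0 < C ∧ ∀ α ∈ B.A, ∀ β ∈ B.A, ∀ ζ ∈ ball (0 : ℂ) B.r,
    ‖α - β‖ / C ≤ ‖(α + B.f α ζ) - (β + B.f β ζ)‖ ∧
      ‖(α + B.f α ζ) - (β + B.f β ζ)‖ ≤ C * ‖α - β‖

end FlowBox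

/-- A lamination by Riemann surfaces holomorphically embedded in `𝕋¹ × ℂℙ¹`: a compact subset `X`
of the surface with an atlas of pairwise compatible flow boxes. -/
structure Lamination (Λ : Submodule ℤ ℂ) where
  /-- the underlying compact set `X` -/
  carrier : Set (Surface Λ)
  isCompact_carrier : IsCompact carrier
  atlas : Set (FlowBox Λ)
  fillsOpen : ∀ B ∈ atlas, B.FillsOpen carrier
  compatible : ∀ B ∈ atlas, ∀ B' ∈ atlas, B.Compatible B'
  cover : ∀ p ∈ carrier, ∃ B ∈ atlas, p ∈ B.support

namespace Lamination

variable {Λ : Submodule ℤ ℂ}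

/-- `B` is a flow box of the lamination, that is, it belongs to the maximal atlas. -/
def IsFlowBox (L : Lamination Λ) (B : FlowBox Λ) : Prop :=
  B.FillsOpen L.carrier ∧ ∀ B' ∈ L.atlas, B.Compatible B'

/-- Two points lie on a common plaque of the atlas. -/
def SamePlaque (L : Lamination Λ) (p q : Surface Λ) : Prop :=
  ∃ B ∈ L.atlas, ∃ α ∈ B.A, p ∈ B.plaque α ∧ q ∈ B.plaque α

/-- The leaf through `p`: all points that are joined to `p` by a finite chain of plaques. -/
def leaf (L : Lamination Λ) (p : Surface Λ) : Set (Surface Λ) :=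
  {q | Relation.ReflTransGen L.SamePlaque p q}

/-- A nonempty closed subset of `X` that is a union of leaves. -/
def IsClosedSaturated (L : Lamination Λ) (Y : Set (Surface Λ)) : Prop :=
  Y.Nonempty ∧ IsClosed Y ∧ Y ⊆ L.carrier ∧ ∀ p ∈ Y, L.leaf p ⊆ Y

/-- A minimal set of the lamination: a nonempty closed union of leaves containing no smaller
one. -/
def IsMinimalSet (L : Lamination Λ) (Y : Set (Surface Λ)) : Prop :=
  L.IsClosedSaturated Y ∧ ∀ Z, L.IsClosedSaturated Z → Z ⊆ Y → Z = Y

/-- No leaf is compact. -/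
def NoCompactLeaf (L : Lamination Λ) : Prop :=
  ∀ p ∈ L.carrier, ¬ IsCompact (L.leaf p)

/-- The lamination is (transversally) Lipschitz: it is covered by flow boxes in which the plaques
depend in a bi-Lipschitz way on the transverse parameter. -/
def IsLipschitz (L : Lamination Λ) : Prop :=
  ∀ p ∈ L.carrier, ∃ B : FlowBox Λ, L.IsFlowBox B ∧ p ∈ B.support ∧ B.IsBiLipschitz

end Lamination

/-- The automorphism `Φ_ε([z], [w₁ : w₂]) = ([z + ε], [w₁ : w₂])`. -/
def torusTranslation (Λ : Submodule ℤ ℂ) (ε : ℂ) (p : Surface Λ) : Surface Λ :=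
  (p.1 + torusProj Λ ε, p.2)

/-! The proof is by contradiction. Over a base point `ζ`, the function `gap` is the difference
between `Γ_α` and the translate of `Γ_β`, so the intersections to be counted are its zeros. A
bounded holomorphic function with `N` zeros in a disk is smaller there by a factor `3⁻ᴺ` than on a
larger disk (`norm_le_of_card_zeros`). If no bound holds near a point, there are therefore plaques
tending to the plaque of that point, and `ε → 0`, with abnormally small gap. It is smaller than
every power of `|ε|` when the logarithmic bound fails. It is `o(|ε|)` when the uniform bound fails
in a Lipschitz box, where one zero already forces the gap to be `O(|ε|)`. The two regimes are
treated together through a scale of orders of smallness, `IsGauge`; the resulting property of a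
point is `ClosePlaques`.

This property is invariant along leaves. Within a box it spreads by Hadamard's three circles theorem
(`propagates_flatGauge`, `IsBiLipschitz.propagates_linearGauge`), and it does not depend on the box
(`IsFlowBox.closePlaques_transfer`). Every leaf accumulates on the minimal set, so close plaques
would appear near each point of that set.

The minimal set contains a point where the leaf is tangent to the torus direction. Otherwise the
slope of the leaves, measured with the Fubini-Study metric, would be finite and continuous and would
attain a maximum. A maximum principle makes this maximum zero, and the leaf through it would be a
compact fibre `{z} × ℂℙ¹` (`IsClosedSaturated.exists_isCompact_leaf`). The tangency is isolated on
its plaque, for otherwise the leaf would be a compact torus.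

Close plaques cannot exist near such a point (`Propagates.exists_not_closePlaques`). Smallness of
the gap gives `graph α - graph β ≈ -f' ε`, where `f'` is the derivative of the tangent plaque. The
right side vanishes at the tangency and has modulus at least `c|ε|` on a small circle around it. The
left side has no zero, since distinct plaques are disjoint, and this contradicts the minimum modulus
principle. Compactness of `X` turns the local bounds into a finite covering with common constants.
-/

section ComplexAnalysis

/-! ### Quantitative estimates for holomorphic functions of one variable -/

open Filter

theorem exists_eq_sub_mul_of_zero {g : ℂ → ℂ} {c a : ℂ} {R : ℝ} (hg : DifferentiableOn ℂ g (ball c R))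
    (ha : a ∈ ball c R) (h0 : g a = 0) :
    ∃ h : ℂ → ℂ, DifferentiableOn ℂ h (ball c R) ∧ ∀ z, g z = (z - a) * h z := by
  refine ⟨dslope g a, ?_, fun z => ?_⟩
  · exact (Complex.differentiableOn_dslope (isOpen_ball.mem_nhds ha)).2 hg
  · have := sub_smul_dslope g a z
    simp only [smul_eq_mul, h0, sub_zero] at this
    exact this.symm

/-- A holomorphic function with finitely many prescribed zeros is a multiple of the
corresponding polynomial. -/
theorem exists_eq_prod_mul {c : ℂ} {R : ℝ} (Z : Finset ℂ) :
    ∀ g : ℂ → ℂ, DifferentiableOn ℂ g (ball c R) → (∀ a ∈ Z, a ∈ ball c R ∧ g a = 0) →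
    ∃ h : ℂ → ℂ, DifferentiableOn ℂ h (ball c R) ∧ ∀ z, g z = (∏ a ∈ Z, (z - a)) * h z := by
  classical
  induction Z using Finset.induction_on with
  | empty => intro g hg _; exact ⟨g, hg, by simp⟩
  | insert a Z haZ ih =>
    intro g hg hZ
    obtain ⟨h, hh, hgh⟩ := exists_eq_sub_mul_of_zero hg (hZ a (by simp)).1 (hZ a (by simp)).2
    obtain ⟨k, hk, hhk⟩ := ih h hh (fun b hb => by
      obtain ⟨h1, h2⟩ := hZ b (by simp [hb])
      refine ⟨h1, ?_⟩
      rw [hgh, mul_eq_zero, sub_eq_zero] at h2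
      rcases h2 with rfl | h2
      · exact absurd hb haZ
      · exact h2)
    refine ⟨k, hk, fun z => ?_⟩
    rw [hgh, hhk, Finset.prod_insert haZ, mul_assoc]

/-- A bounded holomorphic function with many zeros is small. -/
theorem norm_le_of_card_zeros {g : ℂ → ℂ} {c : ℂ} {ρ M : ℝ} (hρ : 0 < ρ)
    (hg : DifferentiableOn ℂ g (ball c (8 * ρ))) (hgM : ∀ z ∈ ball c (8 * ρ), ‖g z‖ ≤ M)
    (Z : Finset ℂ) (hZ : ∀ a ∈ Z, a ∈ ball c ρ ∧ g a = 0) :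
    ∀ z ∈ ball c ρ, ‖g z‖ ≤ M * (1 / 3) ^ Z.card := by
  obtain ⟨h, hh, hgh⟩ := exists_eq_prod_mul Z g hg
    (fun a ha => ⟨ball_subset_ball (by linarith) (hZ a ha).1, (hZ a ha).2⟩)
  -- Each factor `z - a` has modulus at least `6ρ` on the circle of radius `7ρ` and at most `2ρ` on
  -- the disk of radius `ρ`. The maximum principle for the quotient `h` thus gains a factor `1/3`
  -- per zero.
  have hsph : ∀ z ∈ sphere c (7 * ρ), ‖h z‖ ≤ M / (6 * ρ) ^ Z.card := by
    intro z hz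
    rw [mem_sphere] at hz
    have h1 : (6 * ρ) ^ Z.card ≤ ‖∏ a ∈ Z, (z - a)‖ := by
      rw [norm_prod, ← Finset.prod_const]
      refine Finset.prod_le_prod (fun _ _ => by positivity) fun a ha => ?_
      have h2 := (hZ a ha).1
      rw [mem_ball] at h2
      have := dist_triangle z a c
      rw [← dist_eq_norm]; linarith
    rw [le_div_iff₀ (by positivity)]
    calc ‖h z‖ * (6 * ρ) ^ Z.card ≤ ‖h z‖ * ‖∏ a ∈ Z, (z - a)‖ := by gcongr
      _ = ‖g z‖ := by rw [hgh, norm_mul, mul_comm]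
      _ ≤ M := hgM z (by rw [mem_ball]; linarith)
  intro z hz
  have hcl : ‖h z‖ ≤ M / (6 * ρ) ^ Z.card := by
    refine Complex.norm_le_of_forall_mem_frontier_norm_le (U := ball c (7 * ρ)) isBounded_ball ?_ ?_
      (subset_closure (ball_subset_ball (by linarith) hz))
    · refine DifferentiableOn.diffContOnCl (hh.mono ?_)
      rw [closure_ball _ (by positivity)]
      exact closedBall_subset_ball (by linarith)
    · rw [frontier_ball _ (by positivity)]
      exact hsph
  have h1 : ‖∏ a ∈ Z, (z - a)‖ ≤ (2 * ρ) ^ Z.card := by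
    rw [norm_prod, ← Finset.prod_const]
    refine Finset.prod_le_prod (fun _ _ => norm_nonneg _) fun a ha => ?_
    have h2 := (hZ a ha).1
    rw [mem_ball] at h2 hz
    have := dist_triangle_right z a c
    rw [← dist_eq_norm]; linarith
  rw [hgh, norm_mul]
  calc _ ≤ (2 * ρ) ^ Z.card * (M / (6 * ρ) ^ Z.card) := by gcongr
    _ = M * (1 / 3) ^ Z.card := by
      rw [mul_div_assoc', mul_comm, mul_div_assoc, ← div_pow]
      congr 2; field_simp; norm_num

/-- Hadamard's three circles theorem, in a qualitative form. -/
theorem exists_three_circles {ρ R' R : ℝ} (hρ : 0 < ρ) (h1 : ρ < R') (h2 : R' < R) :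
    ∃ θ ∈ Ioo (0 : ℝ) 1, ∀ (c : ℂ) (g : ℂ → ℂ) (u M : ℝ), DifferentiableOn ℂ g (ball c R) →
      0 < u → u ≤ M →
      (∀ z ∈ ball c R, ‖g z‖ ≤ M) → (∀ z ∈ ball c ρ, ‖g z‖ ≤ u) →
      ∀ z ∈ ball c R', ‖g z‖ ≤ u ^ θ * M ^ (1 - θ) := by
  -- The extreme radii `ρ/2` and `(R' + R)/2` are chosen so that both circles lie inside the open
  -- disks where the bounds `u` and `M` are known.
  set l := Real.log (ρ / 2) with hl
  set m := Real.log R' with hm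
  set v := Real.log ((R' + R) / 2) with hv
  have hlm : l < m := Real.log_lt_log (by positivity) (by linarith)
  have hmv : m < v := Real.log_lt_log (by linarith) (by linarith)
  set t := (m - l) / (v - l) with ht
  have ht0 : 0 < t := div_pos (by linarith) (by linarith)
  have ht1 : t < 1 := (div_lt_one (by linarith)).2 (by linarith)
  -- The exponent is the one for the worst radius `R'`, so it depends on the three radii only.
  refine ⟨1 - t, ⟨by linarith, by linarith⟩, ?_⟩
  intro c g u M hg hu huM hM hgu z hz
  rw [sub_sub_cancel]
  have hM0 : 0 < M := hu.trans_le huM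
  by_cases hzρ : z ∈ ball c ρ
  · calc ‖g z‖ ≤ u := hgu z hzρ
      _ = u ^ (1 - t) * u ^ t := by rw [← Real.rpow_add hu]; simp
      _ ≤ _ := by gcongr
  -- The exponential turns circles around `c` into vertical lines, which reduces the claim to the
  -- three lines theorem.
  set E : ℂ → ℂ := fun w => c + Complex.exp w with hE
  have hzc : ρ ≤ ‖z - c‖ := by simpa [dist_eq_norm] using hzρ
  have hzR : ‖z - c‖ < R' := by simpa [dist_eq_norm] using hz
  have hzne : z - c ≠ 0 := by rw [← norm_pos_iff]; linarith
  have hEz : E (Complex.log (z - c)) = z := by simp [hE, Complex.exp_log hzne]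
  have hnorm : ∀ w, ‖E w - c‖ = Real.exp w.re := by intro w; simp [hE, Complex.norm_exp]
  have hexpl : Real.exp l = ρ / 2 := Real.exp_log (by positivity)
  have hexpv : Real.exp v = (R' + R) / 2 := Real.exp_log (by linarith)
  have hmaps : ∀ w, w.re ≤ v → E w ∈ ball c R := by
    intro w hw
    rw [mem_ball, dist_eq_norm, hnorm]
    have := Real.exp_le_exp.2 hw
    linarith
  have hmem : Complex.log (z - c) ∈ Complex.HadamardThreeLines.verticalClosedStrip l v := by
    constructor
    · rw [Complex.log_re]; exact Real.log_le_log (by positivity) (by linarith)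
    · rw [Complex.log_re]; exact Real.log_le_log (by linarith) (by linarith)
  have hEd : Differentiable ℂ E := by fun_prop
  have key := Complex.HadamardThreeLines.norm_le_interp_of_mem_verticalClosedStrip'
    (f := g ∘ E) (z := Complex.log (z - c)) (a := u) (b := M) (hlm.trans hmv) hmem ?_ ?_ ?_ ?_
  · simp only [Function.comp, hEz] at key
    refine key.trans ?_
    set s := ((Complex.log (z - c)).re - l) / (v - l) with hs
    have hst : s ≤ t := by
      have : (Complex.log (z - c)).re ≤ m := by
        rw [Complex.log_re]; exact Real.log_le_log (by linarith) hzR.le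
      rw [hs, ht]; gcongr; linarith
    -- In this form the interpolated bound is visibly nondecreasing in `s`, because `u / M ≤ 1`.
    have e1 : u ^ (1 - s) * M ^ s = M * (u / M) ^ (1 - s) := by
      rw [Real.div_rpow hu.le hM0.le, Real.rpow_sub hM0, Real.rpow_one]; field_simp
    have e2 : u ^ (1 - t) * M ^ t = M * (u / M) ^ (1 - t) := by
      rw [Real.div_rpow hu.le hM0.le, Real.rpow_sub hM0, Real.rpow_one]; field_simp
    rw [e1, e2]
    have := Real.rpow_le_rpow_of_exponent_ge (div_pos hu hM0) ((div_le_one hM0).2 huM)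
      (show 1 - t ≤ 1 - s by linarith)
    gcongr
  · apply DifferentiableOn.diffContOnCl
    refine hg.comp hEd.differentiableOn ?_
    intro w hw
    have : closure (Complex.HadamardThreeLines.verticalStrip l v) ⊆
        Complex.HadamardThreeLines.verticalClosedStrip l v :=
      closure_minimal (preimage_mono Ioo_subset_Icc_self)
        (isClosed_Icc.preimage Complex.continuous_re)
    exact hmaps w (this hw).2
  · refine ⟨M, ?_⟩
    rintro _ ⟨w, hw, rfl⟩
    exact hM _ (hmaps w hw.2)
  · intro w hw
    have hw' : w.re = l := hw
    refine hgu _ ?_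
    rw [mem_ball, dist_eq_norm, hnorm, hw', hexpl]; linarith
  · intro w hw
    have hw' : w.re = v := hw
    exact hM _ (hmaps w hw'.le)

theorem norm_deriv_le_of_ball {g : ℂ → ℂ} {c : ℂ} {R R' M : ℝ} (h : R' < R)
    (hg : DifferentiableOn ℂ g (ball c R)) (hM : ∀ z ∈ ball c R, ‖g z‖ ≤ M) :
    ∀ z ∈ ball c R', ‖deriv g z‖ ≤ M * (2 / (R - R')) := by
  intro z hz
  have hd : 0 < (R - R') / 2 := by linarith
  have hsub : closedBall z ((R - R') / 2) ⊆ ball c R := by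
    intro w hw
    rw [mem_ball] at *; rw [mem_closedBall] at hw
    have := dist_triangle w z c
    linarith
  have := Complex.norm_deriv_le_of_forall_mem_sphere_norm_le hd
    (DifferentiableOn.diffContOnCl (hg.mono (by rwa [closure_ball _ hd.ne'])))
    (fun w hw => hM w (hsub (sphere_subset_closedBall hw)))
  refine this.trans (le_of_eq ?_)
  field_simp

theorem norm_sub_le_of_ball {g : ℂ → ℂ} {c : ℂ} {R R' M : ℝ} (h : R' < R)
    (hg : DifferentiableOn ℂ g (ball c R)) (hM : ∀ z ∈ ball c R, ‖g z‖ ≤ M) :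
    ∀ x ∈ ball c R', ∀ y ∈ ball c R', ‖g x - g y‖ ≤ M * (2 / (R - R')) * ‖x - y‖ := by
  intro x hx y hy
  refine Convex.norm_image_sub_le_of_norm_deriv_le (s := ball c R') (fun w hw => ?_)
    (norm_deriv_le_of_ball h hg hM) (convex_ball _ _) hy hx
  exact hg.differentiableAt (isOpen_ball.mem_nhds (ball_subset_ball h.le hw))

/-- First order Taylor estimate with a constant depending only on the bound of the function. -/
theorem norm_sub_sub_deriv_mul_le {g : ℂ → ℂ} {c : ℂ} {R R' M : ℝ} (h : R' < R)
    (hg : DifferentiableOn ℂ g (ball c R)) (hM : ∀ z ∈ ball c R, ‖g z‖ ≤ M) :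
    ∀ x ∈ ball c R', ∀ y ∈ ball c R',
      ‖g x - g y - deriv g x * (x - y)‖ ≤ M * (4 / (R - R')) ^ 2 * ‖x - y‖ ^ 2 := by
  intro x hx y hy
  set R'' := (R + R') / 2 with hR''
  have hd := norm_deriv_le_of_ball (R' := R'') (by linarith) hg hM
  have hl := norm_sub_le_of_ball (R' := R') (by linarith) (hg.deriv isOpen_ball |>.mono
    (ball_subset_ball (by linarith : R'' ≤ R))) hd
  have hda : ∀ w ∈ ball c R', DifferentiableAt ℂ g w := fun w hw =>
    hg.differentiableAt (isOpen_ball.mem_nhds (ball_subset_ball h.le hw))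
  have hseg : segment ℝ x y ⊆ ball c R' := (convex_ball c R').segment_subset hx hy
  -- Mean value inequality for `w ↦ g w - g'(x) w`. Its derivative `g'(w) - g'(x)` is `O(‖x - y‖)`
  -- on the segment, by the Lipschitz bound for `g'`.
  have key := Convex.norm_image_sub_le_of_norm_deriv_le (s := segment ℝ x y)
    (f := fun w => g w - deriv g x * w) (C := M * (4 / (R - R')) ^ 2 * ‖x - y‖) (x := y) (y := x)
    (fun w hw => by
      have := hda w (hseg hw)
      fun_prop)
    (fun w hw => by
      have h1 := hda w (hseg hw)
      rw [deriv_fun_sub h1 (by fun_prop), deriv_const_mul _ (by fun_prop), deriv_id'', mul_one]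
      have h2 := hl w (hseg hw) x hx
      have h3 : ‖w - x‖ ≤ ‖x - y‖ := by
        rw [segment_eq_image_lineMap] at hw
        obtain ⟨t, ht, rfl⟩ := hw
        rw [← dist_eq_norm, dist_lineMap_left, dist_eq_norm, Real.norm_of_nonneg ht.1]
        nlinarith [norm_nonneg (x - y), ht.2]
      refine h2.trans ?_
      have hM0 : 0 ≤ M := (norm_nonneg _).trans (hM x (ball_subset_ball h.le hx))
      have e : M * (2 / (R - R'')) * (2 / (R'' - R')) = M * (4 / (R - R')) ^ 2 := by
        have : R - R' ≠ 0 := by linarith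
        rw [show R - R'' = (R - R') / 2 by rw [hR'']; ring,
          show R'' - R' = (R - R') / 2 by rw [hR'']; ring]
        field_simp; norm_num
      rw [e]
      gcongr)
    (convex_segment _ _) (right_mem_segment _ _ _) (left_mem_segment _ _ _)
  rw [sq ‖x - y‖, ← mul_assoc]
  refine le_trans (le_of_eq ?_) key
  congr 1; ring

/-- The minimum modulus principle. -/
theorem le_norm_center_of_forall_sphere {g : ℂ → ℂ} {c : ℂ} {R m : ℝ} (hR : 0 < R) (hm : 0 < m)
    (hg : ∀ z ∈ closedBall c R, DifferentiableAt ℂ g z) (h0 : ∀ z ∈ closedBall c R, g z ≠ 0)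
    (hs : ∀ z ∈ sphere c R, m ≤ ‖g z‖) : m ≤ ‖g c‖ := by
  -- The maximum principle is applied to `1 / g`, which is holomorphic because `g` has no zeros.
  have := Complex.norm_le_of_forall_mem_frontier_norm_le (f := fun z => (g z)⁻¹) (U := ball c R)
    (C := m⁻¹) (z := c) isBounded_ball ?_ ?_ (subset_closure (mem_ball_self hR))
  · rw [norm_inv] at this
    exact (inv_le_inv₀ (norm_pos_iff.2 (h0 c (mem_closedBall_self hR.le))) hm).1 this
  · apply DifferentiableOn.diffContOnCl
    rw [closure_ball _ hR.ne']
    intro z hz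
    exact ((hg z hz).inv (h0 z hz)).differentiableWithinAt
  · rw [frontier_ball _ hR.ne']
    intro z hz
    rw [norm_inv]
    exact inv_anti₀ hm (hs z hz)

end ComplexAnalysis

/-! ### Metric comparison of charts on the torus and the projective line -/

section Coordinates

open Filter

variable (Λ : Submodule ℤ ℂ)

theorem isClosed_lattice [DiscreteTopology Λ] : IsClosed (Λ : Set ℂ) :=
  haveI : DiscreteTopology Λ.toAddSubgroup := ‹DiscreteTopology Λ›
  AddSubgroup.isClosed_of_discrete (H := Λ.toAddSubgroup)

theorem t2Space_torus [DiscreteTopology Λ] : T2Space (Torus Λ) := by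
  have : IsClosed (Λ : Set ℂ) := isClosed_lattice Λ
  let _ := Submodule.Quotient.normedAddCommGroup Λ
  infer_instance

theorem t2Space_surface [DiscreteTopology Λ] : T2Space (Surface Λ) :=
  haveI := t2Space_torus Λ
  inferInstance

theorem torusProj_sub (x y : ℂ) : torusProj Λ (x - y) = torusProj Λ x - torusProj Λ y :=
  map_sub _ _ _

theorem torusProj_add (x y : ℂ) : torusProj Λ (x + y) = torusProj Λ x + torusProj Λ y :=
  map_add _ _ _

theorem norm_torusProj_le (x : ℂ) : ‖torusProj Λ x‖ ≤ ‖x‖ := Submodule.Quotient.norm_mk_le Λ x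

theorem continuous_torusProj : Continuous (torusProj Λ) := continuous_quot_mk

theorem isOpenMap_torusProj : IsOpenMap (torusProj Λ) := Submodule.isOpenMap_mkQ Λ

theorem surjective_torusProj : Function.Surjective (torusProj Λ) := Submodule.mkQ_surjective Λ

theorem connectedSpace_torus : ConnectedSpace (Torus Λ) :=
  (surjective_torusProj Λ).connectedSpace (continuous_torusProj Λ)

theorem compactSpace_torus [DiscreteTopology Λ] [IsZLattice ℝ Λ] : CompactSpace (Torus Λ) := by
  have := ZLattice.module_finite ℝ Λ
  have := ZLattice.module_free ℝ Λ
  let b := Module.Free.chooseBasis ℤ Λ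
  let b' := b.ofZLatticeBasis ℝ Λ
  have hspan : Submodule.span ℤ (Set.range b') = Λ := b.ofZLatticeBasis_span ℝ Λ
  have hcomp : IsCompact (closure (ZSpan.fundamentalDomain b')) :=
    (ZSpan.fundamentalDomain_isBounded b').isCompact_closure
  refine ⟨?_⟩
  convert hcomp.image (continuous_torusProj Λ)
  symm
  rw [eq_univ_iff_forall]
  intro t
  obtain ⟨z, rfl⟩ := surjective_torusProj Λ t
  refine ⟨ZSpan.fract b' z, subset_closure (ZSpan.fract_mem_fundamentalDomain b' z), ?_⟩
  rw [ZSpan.fract, torusProj_sub, sub_eq_self]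
  exact (Submodule.Quotient.mk_eq_zero Λ).2 (hspan.le (ZSpan.floor b' z).2)

/-- Short vectors have the same norm in the torus. -/
theorem exists_norm_torusProj_eq [DiscreteTopology Λ] :
    ∃ δ > 0, ∀ x : ℂ, ‖x‖ < δ → ‖torusProj Λ x‖ = ‖x‖ := by
  obtain ⟨r, hr, h⟩ : ∃ r > 0, ∀ v ∈ Λ, v ≠ 0 → r ≤ ‖v‖ := by
    have h0 : (({0} : Set Λ)) ∈ 𝓝 (0 : Λ) := (isOpen_discrete _).mem_nhds rfl
    obtain ⟨r, hr, h⟩ := Metric.mem_nhds_iff.1 h0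
    refine ⟨r, hr, fun v hv hv0 => ?_⟩
    by_contra! hlt
    have : (⟨v, hv⟩ : Λ) ∈ ball (0 : Λ) r := by
      rw [mem_ball, dist_zero_right]; exact hlt
    exact hv0 (congrArg Subtype.val (h this))
  -- Half the length of a shortest nonzero lattice vector suffices: the origin is then the lattice
  -- point nearest to `x`.
  refine ⟨r / 2, by positivity, fun x hx => le_antisymm (norm_torusProj_le Λ x) ?_⟩
  have : ‖torusProj Λ x‖ = infDist x (Λ : Set ℂ) :=
    QuotientAddGroup.norm_mk (S := Λ.toAddSubgroup) x
  rw [this, le_infDist ⟨0, Λ.zero_mem⟩]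
  intro v hv
  by_cases hv0 : v = 0
  · simp [hv0]
  · have h1 := h v hv hv0
    have h2 := norm_sub_norm_le v x
    rw [dist_comm, dist_eq_norm]; linarith

/-- The radius below which the torus looks like the plane. -/
noncomputable def torusScale [DiscreteTopology Λ] : ℝ := (exists_norm_torusProj_eq Λ).choose

theorem torusScale_pos [DiscreteTopology Λ] : 0 < torusScale Λ :=
  (exists_norm_torusProj_eq Λ).choose_spec.1

theorem norm_torusProj_eq [DiscreteTopology Λ] {x : ℂ} (hx : ‖x‖ < torusScale Λ) :
    ‖torusProj Λ x‖ = ‖x‖ :=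
  (exists_norm_torusProj_eq Λ).choose_spec.2 x hx

/-- The weight `√(1 + |w|²)`. -/
noncomputable def chordWeight (w : ℂ) : ℝ := √(1 + ‖w‖ ^ 2)

theorem chordWeight_pos (w : ℂ) : 0 < chordWeight w := Real.sqrt_pos.2 (by positivity)

theorem one_le_chordWeight (w : ℂ) : 1 ≤ chordWeight w :=
  Real.one_le_sqrt.2 (by nlinarith [norm_nonneg w])

theorem sq_chordWeight (w : ℂ) : chordWeight w ^ 2 = 1 + ‖w‖ ^ 2 := Real.sq_sqrt (by positivity)

theorem continuous_chordWeight : Continuous chordWeight := by unfold chordWeight; fun_prop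

theorem chordWeight_inv {w : ℂ} (hw : w ≠ 0) : chordWeight w⁻¹ = chordWeight w / ‖w‖ := by
  have h := norm_pos_iff.2 hw
  rw [chordWeight, chordWeight, ← Real.sqrt_sq h.le, ← Real.sqrt_div (by positivity),
    Real.sqrt_sq h.le]
  congr 1
  rw [norm_inv]; field_simp; ring

/-- The chordal distance on the projective line. -/
noncomputable def chordDist : ProjLine → ProjLine → ℝ
  | OnePoint.some a, OnePoint.some b => ‖a - b‖ / (chordWeight a * chordWeight b)
  | OnePoint.some a, OnePoint.infty => 1 / chordWeight a
  | OnePoint.infty, OnePoint.some b => 1 / chordWeight b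
  | OnePoint.infty, OnePoint.infty => 0

/-- The inversion `w ↦ 1/w` is an isometry of the chordal distance, so one formula serves both
charts. This makes the distance suitable for comparing boxes read in different charts. -/
theorem chordDist_param (c : ProjChart) (a b : ℂ) :
    chordDist (c.param a) (c.param b) = ‖a - b‖ / (chordWeight a * chordWeight b) := by
  cases c with
  | affine => rfl
  | infinite =>
    have hw0 : chordWeight 0 = 1 := by simp [chordWeight]
    have e : ∀ w : ℂ, w ≠ 0 → 1 / chordWeight w⁻¹ = ‖w‖ / chordWeight w := by
      intro w hw; rw [chordWeight_inv hw, one_div_div]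
    by_cases ha : a = 0 <;> by_cases hb : b = 0
    · simp [ProjChart.param, ha, hb, chordDist]
    · have : chordDist (ProjChart.infinite.param a) (ProjChart.infinite.param b)
        = 1 / chordWeight b⁻¹ := by
        simp [ProjChart.param, ha, hb]; simp [chordDist]
      rw [this, e b hb, ha, hw0]; simp
    · have : chordDist (ProjChart.infinite.param a) (ProjChart.infinite.param b)
        = 1 / chordWeight a⁻¹ := by
        simp [ProjChart.param, ha, hb]; simp [chordDist]
      rw [this, e a ha, hb, hw0]; simp
    · have : chordDist (ProjChart.infinite.param a) (ProjChart.infinite.param b)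
        = ‖a⁻¹ - b⁻¹‖ / (chordWeight a⁻¹ * chordWeight b⁻¹) := by
        simp [ProjChart.param, ha, hb]; simp [chordDist]
      rw [this, chordWeight_inv ha, chordWeight_inv hb, inv_sub_inv ha hb, norm_div, norm_mul,
        norm_sub_rev b a]
      have h1 := norm_pos_iff.2 ha
      have h2 := norm_pos_iff.2 hb
      have h3 := chordWeight_pos a
      have h4 := chordWeight_pos b
      field_simp

theorem param_injective (c : ProjChart) : Function.Injective c.param := by
  intro a b h
  have h1 := chordDist_param c a b
  rw [← h, chordDist_param c a a, sub_self, norm_zero, zero_div] at h1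
  have h3 := chordWeight_pos a
  have h4 := chordWeight_pos b
  rw [eq_comm, div_eq_zero_iff, norm_eq_zero, sub_eq_zero] at h1
  rcases h1 with h1 | h1
  · exact h1
  · exact absurd h1 (by positivity)

/-- The inversion `w ↦ 1 / w` of the projective line. -/
noncomputable def projInv (p : ProjLine) : ProjLine :=
  match p with
  | OnePoint.some w => ProjChart.infinite.param w
  | OnePoint.infty => ((0 : ℂ) : OnePoint ℂ)

theorem projInv_coe (w : ℂ) : projInv (w : OnePoint ℂ) = ProjChart.infinite.param w := rfl

theorem projInv_projInv (p : ProjLine) : projInv (projInv p) = p := by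
  induction p using OnePoint.rec with
  | infty =>
    change projInv ((0 : ℂ) : OnePoint ℂ) = _
    rw [projInv_coe]; simp [ProjChart.param]
  | coe w =>
    rw [projInv_coe]
    by_cases hw : w = 0
    · simp [ProjChart.param, hw]; rfl
    · simp [ProjChart.param, hw]
      rw [projInv_coe]; simp [ProjChart.param, hw]

theorem continuous_param_infinite : Continuous ProjChart.infinite.param := by
  rw [continuous_iff_continuousAt]
  intro w
  by_cases hw : w = 0
  · subst hw
    rw [ContinuousAt, ← nhdsNE_sup_pure, tendsto_sup]
    constructor
    · have h1 : Tendsto (fun w : ℂ => ((w⁻¹ : ℂ) : OnePoint ℂ)) (𝓝[≠] 0)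
          (𝓝 (OnePoint.infty : OnePoint ℂ)) := by
        refine (OnePoint.tendsto_coe_infty).comp ?_
        rw [coclosedCompact_eq_cocompact, ← Metric.cobounded_eq_cocompact]
        exact tendsto_inv₀_nhdsNE_zero
      have h2 : ProjChart.infinite.param 0 = OnePoint.infty := by simp [ProjChart.param]
      rw [h2]
      refine h1.congr' ?_
      filter_upwards [self_mem_nhdsWithin] with w hw
      have : w ≠ 0 := hw
      simp [ProjChart.param, this]
    · exact tendsto_pure_nhds _ _
  · have h1 : ContinuousAt (fun w : ℂ => ((w⁻¹ : ℂ) : OnePoint ℂ)) w :=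
      OnePoint.continuous_coe.continuousAt.comp (continuousAt_inv₀ hw)
    refine h1.congr ?_
    filter_upwards [isOpen_ne.mem_nhds hw] with v hv
    have : v ≠ 0 := hv
    simp [ProjChart.param, this]

theorem continuous_projInv : Continuous projInv := by
  rw [OnePoint.continuous_iff]
  refine ⟨?_, continuous_param_infinite⟩
  have h1 : Tendsto (fun w : ℂ => ((w⁻¹ : ℂ) : OnePoint ℂ)) (coclosedCompact ℂ)
      (𝓝 ((0 : ℂ) : OnePoint ℂ)) := by
    refine (OnePoint.continuous_coe.tendsto 0).comp ?_
    rw [coclosedCompact_eq_cocompact, ← Metric.cobounded_eq_cocompact]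
    exact tendsto_inv₀_cobounded
  refine h1.congr' ?_
  have : {(0 : ℂ)}ᶜ ∈ coclosedCompact ℂ := (isCompact_singleton.compl_mem_coclosedCompact_of_isClosed
    isClosed_singleton)
  filter_upwards [this] with v hv
  have : v ≠ 0 := hv
  rw [projInv_coe]
  simp [ProjChart.param, this]

theorem isOpenEmbedding_param (c : ProjChart) : IsOpenEmbedding c.param := by
  cases c with
  | affine => exact OnePoint.isOpenEmbedding_coe
  | infinite =>
    let e : ProjLine ≃ₜ ProjLine :=
      { toFun := projInv, invFun := projInv, left_inv := projInv_projInv,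
        right_inv := projInv_projInv, continuous_toFun := continuous_projInv,
        continuous_invFun := continuous_projInv }
    exact e.isOpenEmbedding.comp OnePoint.isOpenEmbedding_coe

/-- The map `(ζ, η) ↦ (z, w)` from the coordinates of a box to the coordinates of the surface:
first component. -/
def torusCoord (o : BoxOrientation) (z₀ ζ η : ℂ) : ℂ :=
  match o with
  | .horizontal => z₀ + ζ
  | .vertical => z₀ + η

/-- The projective coordinate of the point `(ζ, η)` of a box. -/
def projCoord (o : BoxOrientation) (w₀ ζ η : ℂ) : ℂ :=
  match o with
  | .horizontal => w₀ + η
  | .vertical => w₀ + ζ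

theorem boxParam_eq (o : BoxOrientation) (c : ProjChart) (z₀ w₀ ζ η : ℂ) :
    boxParam Λ o c z₀ w₀ ζ η = (torusProj Λ (torusCoord o z₀ ζ η), c.param (projCoord o w₀ ζ η)) := by
  cases o <;> rfl

theorem norm_torusCoord_sub_add (o : BoxOrientation) (z₀ w₀ ζ η ξ θ : ℂ) :
    ‖torusCoord o z₀ ζ η - torusCoord o z₀ ξ θ‖ + ‖projCoord o w₀ ζ η - projCoord o w₀ ξ θ‖
      = ‖ζ - ξ‖ + ‖η - θ‖ := by
  cases o <;> simp [torusCoord, projCoord, add_comm]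

/-- A distance on the surface, used to compare the coordinates of different boxes. -/
noncomputable def surfaceDist (p q : Surface Λ) : ℝ := ‖p.1 - q.1‖ + chordDist p.2 q.2

theorem chordDist_param_le (c : ProjChart) (a b : ℂ) :
    chordDist (c.param a) (c.param b) ≤ ‖a - b‖ := by
  rw [chordDist_param]
  refine div_le_self (norm_nonneg _) ?_
  nlinarith [one_le_chordWeight a, one_le_chordWeight b]

theorem surfaceDist_boxParam_le (o : BoxOrientation) (c : ProjChart) (z₀ w₀ ζ η ξ θ : ℂ) :
    surfaceDist Λ (boxParam Λ o c z₀ w₀ ζ η) (boxParam Λ o c z₀ w₀ ξ θ) ≤ ‖ζ - ξ‖ + ‖η - θ‖ := by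
  rw [surfaceDist, boxParam_eq, boxParam_eq, ← norm_torusCoord_sub_add o z₀ w₀, ← torusProj_sub]
  exact add_le_add (norm_torusProj_le Λ _) (chordDist_param_le c _ _)

theorem le_surfaceDist_boxParam [DiscreteTopology Λ] (o : BoxOrientation) (c : ProjChart)
    (z₀ w₀ : ℂ) (K : ℝ) : ∃ C > 0, ∀ ζ η ξ θ : ℂ, ‖ζ‖ ≤ K → ‖η‖ ≤ K → ‖ξ‖ ≤ K → ‖θ‖ ≤ K →
      ‖ζ - ξ‖ < torusScale Λ → ‖η - θ‖ < torusScale Λ →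
      ‖ζ - ξ‖ + ‖η - θ‖ ≤
        C * surfaceDist Λ (boxParam Λ o c z₀ w₀ ζ η) (boxParam Λ o c z₀ w₀ ξ θ) := by
  -- This constant bounds the square of the chordal weight at all points concerned, hence also the
  -- product of two weights.
  refine ⟨1 + (‖w₀‖ + K) ^ 2, by positivity, fun ζ η ξ θ h1 h2 h3 h4 h5 h6 => ?_⟩
  have hK : 0 ≤ K := (norm_nonneg _).trans h1
  rw [surfaceDist, boxParam_eq, boxParam_eq, ← norm_torusCoord_sub_add o z₀ w₀, ← torusProj_sub]
  have ht : ‖torusCoord o z₀ ζ η - torusCoord o z₀ ξ θ‖ < torusScale Λ := by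
    cases o <;> simpa [torusCoord]
  have hp : ∀ a b : ℂ, ‖a‖ ≤ K → ‖b‖ ≤ K → chordWeight (projCoord o w₀ a b) ^ 2 ≤
      1 + (‖w₀‖ + K) ^ 2 := by
    intro a b ha hb
    rw [sq_chordWeight]
    have : ‖projCoord o w₀ a b‖ ≤ ‖w₀‖ + K := by
      cases o
      · exact (norm_add_le _ _).trans (by gcongr)
      · exact (norm_add_le _ _).trans (by gcongr)
    gcongr
  simp only
  rw [norm_torusProj_eq Λ ht, chordDist_param, mul_add]
  have hw1 := chordWeight_pos (projCoord o w₀ ζ η)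
  have hw2 := chordWeight_pos (projCoord o w₀ ξ θ)
  gcongr
  · exact le_mul_of_one_le_left (norm_nonneg _) (by nlinarith [sq_nonneg (‖w₀‖ + K)])
  · rw [mul_div_assoc', le_div_iff₀ (by positivity), mul_comm]
    gcongr
    nlinarith [hp ζ η h1 h2, hp ξ θ h3 h4, sq_nonneg (chordWeight (projCoord o w₀ ζ η) -
      chordWeight (projCoord o w₀ ξ θ))]

end Coordinates

/-! ### Box parametrizations are continuous and open -/

section BoxCoordinates

variable (Λ : Submodule ℤ ℂ)

theorem continuous_boxParam (o : BoxOrientation) (c : ProjChart) (z₀ w₀ : ℂ) :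
    Continuous fun q : ℂ × ℂ => boxParam Λ o c z₀ w₀ q.1 q.2 := by
  have h1 := continuous_torusProj Λ
  have h2 := (isOpenEmbedding_param c).continuous
  cases o <;> simp only [boxParam] <;> fun_prop

theorem isOpenMap_boxParam (o : BoxOrientation) (c : ProjChart) (z₀ w₀ : ℂ) :
    IsOpenMap fun q : ℂ × ℂ => boxParam Λ o c z₀ w₀ q.1 q.2 := by
  have h := (isOpenMap_torusProj Λ).prodMap (isOpenEmbedding_param c).isOpenMap
  have ht := ((Homeomorph.addLeft z₀).prodCongr (Homeomorph.addLeft w₀)).isOpenMap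
  cases o
  · exact h.comp ht
  · exact h.comp (ht.comp (Homeomorph.prodComm ℂ ℂ).isOpenMap)

end BoxCoordinates

/-! ### Plaques as holomorphic graphs, and their dependence on the transverse parameter -/

namespace FlowBox

open Filter

variable {Λ : Submodule ℤ ℂ} (B : FlowBox Λ)

/-- The function `ζ ↦ α + f_α(ζ)` whose graph is a plaque. -/
def graph (α ζ : ℂ) : ℂ := α + B.f α ζ

/-- The point with the coordinates `(ζ, η)`. -/
noncomputable def param (ζ η : ℂ) : Surface Λ := boxParam Λ B.orientation B.chart B.z₀ B.w₀ ζ η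

/-- The point of the plaque `Γ_α` over `ζ`. -/
noncomputable def pt (α ζ : ℂ) : Surface Λ := B.param ζ (B.graph α ζ)

theorem plaque_eq (α : ℂ) : B.plaque α = B.pt α '' ball 0 B.r := rfl

variable {B}

theorem pt_mem_plaque {α ζ : ℂ} (hζ : ζ ∈ ball (0 : ℂ) B.r) : B.pt α ζ ∈ B.plaque α :=
  ⟨ζ, hζ, rfl⟩

theorem mem_support {x : Surface Λ} :
    x ∈ B.support ↔ ∃ α ∈ B.A, ∃ ζ ∈ ball (0 : ℂ) B.r, B.pt α ζ = x := by
  simp [support, plaque_eq]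

theorem plaque_subset_support {α : ℂ} (hα : α ∈ B.A) : B.plaque α ⊆ B.support :=
  subset_biUnion_of_mem (u := fun α => B.plaque α) hα

theorem continuous_param : Continuous fun q : ℂ × ℂ => B.param q.1 q.2 :=
  continuous_boxParam _ _ _ _ _

theorem isOpenMap_param : IsOpenMap fun q : ℂ × ℂ => B.param q.1 q.2 :=
  isOpenMap_boxParam _ _ _ _ _

theorem torusCoord_mem {ζ η : ℂ} (hζ : ζ ∈ ball (0 : ℂ) B.r) (hη : η ∈ ball (0 : ℂ) B.s) :
    torusCoord B.orientation B.z₀ ζ η ∈ ball B.z₀ (torusRadius B.orientation B.r B.s) := by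
  rw [mem_ball_zero_iff] at hζ hη
  cases h : B.orientation <;> simpa [torusCoord, torusRadius]

theorem param_inj {ζ η ξ θ : ℂ} (hζ : ζ ∈ ball (0 : ℂ) B.r) (hη : η ∈ ball (0 : ℂ) B.s)
    (hξ : ξ ∈ ball (0 : ℂ) B.r) (hθ : θ ∈ ball (0 : ℂ) B.s) (h : B.param ζ η = B.param ξ θ) :
    ζ = ξ ∧ η = θ := by
  rw [param, param, boxParam_eq, boxParam_eq, Prod.mk.injEq] at h
  have h1 := B.injOn (torusCoord_mem hζ hη) (torusCoord_mem hξ hθ) h.1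
  have h2 := param_injective _ h.2
  cases ho : B.orientation <;> simp_all [torusCoord, projCoord]

theorem graph_mem {α ζ : ℂ} (hα : α ∈ B.A) (hζ : ζ ∈ ball (0 : ℂ) B.r) :
    B.graph α ζ ∈ ball (0 : ℂ) B.s := B.mem_ball α hα ζ hζ

theorem norm_graph_le {α ζ : ℂ} (hα : α ∈ B.A) (hζ : ζ ∈ ball (0 : ℂ) B.r) :
    ‖B.graph α ζ‖ ≤ B.s := (mem_ball_zero_iff.1 (graph_mem hα hζ)).le

theorem differentiableOn_graph {α : ℂ} (hα : α ∈ B.A) :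
    DifferentiableOn ℂ (B.graph α) (ball 0 B.r) :=
  (differentiableOn_const α).add (B.holo α hα)

theorem differentiableAt_graph {α ζ : ℂ} (hα : α ∈ B.A) (hζ : ζ ∈ ball (0 : ℂ) B.r) :
    DifferentiableAt ℂ (B.graph α) ζ :=
  (differentiableOn_graph hα).differentiableAt (isOpen_ball.mem_nhds hζ)

theorem pt_inj {α β ζ ξ : ℂ} (hα : α ∈ B.A) (hβ : β ∈ B.A) (hζ : ζ ∈ ball (0 : ℂ) B.r)
    (hξ : ξ ∈ ball (0 : ℂ) B.r) (h : B.pt α ζ = B.pt β ξ) : α = β ∧ ζ = ξ := by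
  have := B.isEmbedding.injective (a₁ := (⟨ζ, hζ⟩, ⟨α, hα⟩)) (a₂ := (⟨ξ, hξ⟩, ⟨β, hβ⟩)) h
  simp only [Prod.mk.injEq, Subtype.mk.injEq] at this
  exact ⟨this.2, this.1⟩

theorem graph_inj {α β ζ : ℂ} (hα : α ∈ B.A) (hβ : β ∈ B.A) (hζ : ζ ∈ ball (0 : ℂ) B.r)
    (h : B.graph α ζ = B.graph β ζ) : α = β :=
  (pt_inj hα hβ hζ hζ (by rw [pt, pt, h])).1

/-- The open set of the points with coordinates in `U × Δ_s`. -/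
theorem isOpen_param_image {U : Set ℂ} (hU : IsOpen U) :
    IsOpen ((fun q : ℂ × ℂ => B.param q.1 q.2) '' (U ×ˢ ball 0 B.s)) :=
  isOpenMap_param _ (hU.prod isOpen_ball)

/-- On the coordinate bidisk the parametrization of the surface is an open embedding. The embedding
condition of the box can therefore be read in `ℂ × ℂ`. -/
theorem isEmbedding_graph :
    IsEmbedding fun q : ball (0 : ℂ) B.r × B.A => ((q.1 : ℂ), B.graph q.2 q.1) := by
  let U : Set (ℂ × ℂ) := ball 0 B.r ×ˢ ball 0 B.s
  have hU : IsOpen U := isOpen_ball.prod isOpen_ball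
  have he : IsOpenEmbedding (fun q : U => B.param q.1.1 q.1.2) := by
    refine .of_continuous_injective_isOpenMap
      (continuous_param.comp continuous_subtype_val) ?_
      (isOpenMap_param.comp hU.isOpenMap_subtype_val)
    rintro ⟨a, ha⟩ ⟨b, hb⟩ h
    obtain ⟨h1, h2⟩ := param_inj ha.1 ha.2 hb.1 hb.2 h
    exact Subtype.ext (Prod.ext h1 h2)
  let g : ball (0 : ℂ) B.r × B.A → U := fun q =>
    ⟨((q.1 : ℂ), B.graph q.2 q.1), q.1.2, graph_mem q.2.2 q.1.2⟩
  have hg : IsEmbedding ((fun q : U => B.param q.1.1 q.1.2) ∘ g) := B.isEmbedding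
  have hgc : Continuous g := he.isEmbedding.continuous_iff.2 hg.continuous
  exact IsEmbedding.subtypeVal.comp (IsEmbedding.of_comp hgc he.continuous hg)

theorem continuous_graph :
    Continuous fun q : ball (0 : ℂ) B.r × B.A => B.graph q.2 q.1 :=
  continuous_snd.comp isEmbedding_graph.continuous

theorem isEmbedding_graph_at {ζ : ℂ} (hζ : ζ ∈ ball (0 : ℂ) B.r) :
    IsEmbedding fun α : B.A => B.graph α ζ := by
  have h1 : IsEmbedding fun α : B.A => ((⟨ζ, hζ⟩ : ball (0 : ℂ) B.r), α) :=
    isEmbedding_prodMkRight _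
  have h2 := isEmbedding_graph.comp h1
  have h3 : IsEmbedding fun η : ℂ => (ζ, η) := isEmbedding_prodMkRight _
  refine IsEmbedding.of_comp ?_ h3.continuous h2
  exact continuous_snd.comp h2.continuous

/-- The plaques depend continuously on the transverse parameter, uniformly on compact disks. -/
theorem exists_forall_norm_graph_sub_lt {α₀ : ℂ} (hα₀ : α₀ ∈ B.A) {R e : ℝ} (hR : R < B.r)
    (he : 0 < e) : ∃ δ > 0, ∀ α ∈ B.A, dist α α₀ < δ → ∀ ζ ∈ closedBall (0 : ℂ) R,
      ‖B.graph α ζ - B.graph α₀ ζ‖ < e := by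
  have hK : IsCompact (Subtype.val ⁻¹' closedBall (0 : ℂ) R : Set (ball (0 : ℂ) B.r)) := by
    rw [Subtype.isCompact_iff, Subtype.image_preimage_coe, inter_eq_right.2
      (closedBall_subset_ball hR)]
    exact isCompact_closedBall _ _
  have key := hK.eventually_forall_of_forall_eventually (x₀ := (⟨α₀, hα₀⟩ : B.A))
    (P := fun α ζ => ‖B.graph α ζ - B.graph α₀ ζ‖ < e) ?_
  · obtain ⟨δ, hδ, h⟩ := Metric.eventually_nhds_iff.1 key
    exact ⟨δ, hδ, fun α hα hd ζ hζ =>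
      h (y := ⟨α, hα⟩) hd ⟨ζ, closedBall_subset_ball hR hζ⟩ hζ⟩
  · intro ζ _
    have h1 : Continuous fun q : B.A × ball (0 : ℂ) B.r =>
        ‖B.graph q.1 q.2 - B.graph α₀ q.2‖ := by
      have h2 := (continuous_graph (B := B)).comp (continuous_swap (X := B.A))
      have h3 : Continuous fun q : B.A × ball (0 : ℂ) B.r => B.graph α₀ q.2 :=
        (continuous_graph (B := B)).comp
          (continuous_snd.prodMk (continuous_const (y := (⟨α₀, hα₀⟩ : B.A))))
      exact (h2.sub h3).norm
    refine (h1.tendsto (⟨α₀, hα₀⟩, ζ)).eventually_lt_const ?_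
    simpa using he

/-- A relatively open set of parameters and base points gives a relatively open subset of `X`. -/
theorem FillsOpen.exists_inter_eq_image {X : Set (Surface Λ)} (hB : B.FillsOpen X)
    {O : Set (ball (0 : ℂ) B.r × B.A)} (hO : IsOpen O) :
    ∃ U, IsOpen U ∧ X ∩ U = (fun q : ball (0 : ℂ) B.r × B.A => B.pt q.2 q.1) '' O := by
  obtain ⟨U, hU, hXU⟩ := hB
  obtain ⟨V, hV, rfl⟩ := B.isEmbedding.isOpen_iff.1 hO
  refine ⟨U ∩ V, hU.inter hV, ?_⟩
  rw [← inter_assoc, hXU]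
  ext x
  constructor
  · rintro ⟨hx, hxV⟩
    obtain ⟨α, hα, ζ, hζ, rfl⟩ := mem_support.1 hx
    exact ⟨(⟨ζ, hζ⟩, ⟨α, hα⟩), hxV, rfl⟩
  · rintro ⟨q, hq, rfl⟩
    exact ⟨mem_support.2 ⟨q.2, q.2.2, q.1, q.1.2, rfl⟩, hq⟩

theorem FillsOpen.support_subset {X : Set (Surface Λ)} (hB : B.FillsOpen X) : B.support ⊆ X := by
  obtain ⟨U, _, h⟩ := hB
  rw [← h]; exact inter_subset_left

/-- Near a point of the box, `X` consists of plaques of the box only, and the box coordinates are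
continuous on it. Accumulation in `X` thereby becomes accumulation of plaques. -/
theorem FillsOpen.eventually_eq_pt {X : Set (Surface Λ)} (hB : B.FillsOpen X) {κ : ℝ}
    {α₀ ζ₀ : ℂ} (hα₀ : α₀ ∈ B.A) (hζ₀ : ζ₀ ∈ ball (0 : ℂ) B.r) (hκ : 0 < κ) :
    ∀ᶠ x in 𝓝 (B.pt α₀ ζ₀), x ∈ X → ∃ α ∈ B.A, α ∈ ball α₀ κ ∧
      ∃ ζ ∈ ball (0 : ℂ) B.r, ζ ∈ ball ζ₀ κ ∧ B.pt α ζ = x := by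
  obtain ⟨U, hU, hXU⟩ := hB.exists_inter_eq_image
    (O := (Subtype.val ⁻¹' ball ζ₀ κ) ×ˢ (Subtype.val ⁻¹' ball α₀ κ))
    ((isOpen_ball.preimage continuous_subtype_val).prod
      (isOpen_ball.preimage continuous_subtype_val))
  have hmem : B.pt α₀ ζ₀ ∈ X ∩ U := by
    rw [hXU]
    exact ⟨(⟨ζ₀, hζ₀⟩, ⟨α₀, hα₀⟩), ⟨mem_ball_self hκ, mem_ball_self hκ⟩, rfl⟩
  filter_upwards [hU.mem_nhds hmem.2] with x hxU hxX
  have : x ∈ X ∩ U := ⟨hxX, hxU⟩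
  rw [hXU] at this
  obtain ⟨q, hq, rfl⟩ := this
  exact ⟨q.2, q.2.2, hq.2, q.1, q.1.2, hq.1, rfl⟩

theorem nhdsWithin_plaque {α ζ : ℂ} (hα : α ∈ B.A) (hζ : ζ ∈ ball (0 : ℂ) B.r) :
    𝓝[B.plaque α] (B.pt α ζ) = map (B.pt α) (𝓝 ζ) := by
  have h1 : IsEmbedding fun ζ : ball (0 : ℂ) B.r => (ζ, (⟨α, hα⟩ : B.A)) :=
    isEmbedding_prodMkLeft _
  have h2 : IsEmbedding fun ζ : ball (0 : ℂ) B.r => B.pt α ζ := B.isEmbedding.comp h1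
  have h3 := h2.isInducing.map_nhds_eq ⟨ζ, hζ⟩
  have h4 : range (fun ζ : ball (0 : ℂ) B.r => B.pt α ζ) = B.plaque α := by
    rw [plaque_eq, image_eq_range]
  rw [h4] at h3
  rw [← h3, ← map_nhds_subtype_coe_eq_nhds hζ (isOpen_ball.mem_nhds hζ), map_map]
  rfl

/-- Phrased with filters, compatibility is an equality of germs, which can be chained and rewritten.
-/
theorem compatible_iff {B' : FlowBox Λ} : B.Compatible B' ↔ ∀ α ∈ B.A, ∀ β ∈ B'.A,
    ∀ p ∈ B.plaque α ∩ B'.plaque β, 𝓝[B.plaque α] p = 𝓝[B'.plaque β] p := by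
  refine forall₂_congr fun α _ => forall₂_congr fun β _ => forall₂_congr fun p _ => ?_
  rw [nhdsWithin_eq_iff_eventuallyEq, eventuallyEq_set, eventually_iff_exists_mem]
  refine exists_congr fun V => and_congr_right fun _ => ?_
  simp only [Set.ext_iff, mem_inter_iff, and_congr_left_iff]

theorem continuousAt_pt {α ζ : ℂ} (hα : α ∈ B.A) (hζ : ζ ∈ ball (0 : ℂ) B.r) :
    ContinuousAt (B.pt α) ζ :=
  continuous_param.continuousAt.comp
    (continuousAt_id.prodMk (differentiableAt_graph hα hζ).continuousAt)

theorem isPreconnected_plaque {α : ℂ} (hα : α ∈ B.A) : IsPreconnected (B.plaque α) := by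
  rw [plaque_eq]
  exact (convex_ball _ _).isPreconnected.image _
    fun ζ hζ => (continuousAt_pt hα hζ).continuousWithinAt

theorem continuous_pt :
    Continuous fun q : ball (0 : ℂ) B.r × B.A => B.pt q.2 q.1 := B.isEmbedding.continuous

/-- Nearby plaques have nearby points. -/
theorem exists_forall_pt_mem {α₀ ζ₀ : ℂ} (hα₀ : α₀ ∈ B.A) (hζ₀ : ζ₀ ∈ ball (0 : ℂ) B.r)
    {V : Set (Surface Λ)} (hV : V ∈ 𝓝 (B.pt α₀ ζ₀)) :
    ∃ δ > 0, ball ζ₀ δ ⊆ ball 0 B.r ∧ ∀ α ∈ B.A, dist α α₀ < δ → ∀ ζ ∈ ball ζ₀ δ, B.pt α ζ ∈ V := by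
  have h := (continuous_pt (B := B)).continuousAt (x := (⟨ζ₀, hζ₀⟩, ⟨α₀, hα₀⟩)) hV
  obtain ⟨δ, hδ, h⟩ := Metric.mem_nhds_iff.1 h
  obtain ⟨δ', hδ', h'⟩ := Metric.isOpen_ball.mem_nhds hζ₀ |> Metric.mem_nhds_iff.1
  refine ⟨min δ δ', lt_min hδ hδ', (ball_subset_ball (min_le_right _ _)).trans h', ?_⟩
  intro α hα hd ζ hζ
  have hζr : ζ ∈ ball (0 : ℂ) B.r := h' (ball_subset_ball (min_le_right _ _) hζ)
  refine h (a := (⟨ζ, hζr⟩, ⟨α, hα⟩)) ?_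
  rw [Metric.mem_ball, Prod.dist_eq, max_lt_iff]
  exact ⟨lt_of_lt_of_le hζ (min_le_left _ _), lt_of_lt_of_le hd (min_le_left _ _)⟩

end FlowBox

/-! ### The leaf topology, closures of leaves and minimal sets -/

namespace Lamination

open Filter FlowBox

variable {Λ : Submodule ℤ ℂ} (L : Lamination Λ)

/-- The neighbourhood filter of a point in the topology of the leaves. -/
noncomputable def leafNhds (x : Surface Λ) : Filter (Surface Λ) :=
  ⨆ B ∈ L.atlas, ⨆ α ∈ B.A, ⨆ (_ : x ∈ B.plaque α), 𝓝[B.plaque α] x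

variable {L}

theorem isFlowBox_of_mem_atlas {B : FlowBox Λ} (hB : B ∈ L.atlas) : L.IsFlowBox B :=
  ⟨L.fillsOpen B hB, fun B' hB' => L.compatible B hB B' hB'⟩

namespace IsFlowBox

theorem support_subset {B : FlowBox Λ} (hB : L.IsFlowBox B) : B.support ⊆ L.carrier :=
  hB.1.support_subset

theorem pt_mem {B : FlowBox Λ} (hB : L.IsFlowBox B) {α ζ : ℂ} (hα : α ∈ B.A)
    (hζ : ζ ∈ ball (0 : ℂ) B.r) : B.pt α ζ ∈ L.carrier :=
  hB.support_subset (mem_support.2 ⟨α, hα, ζ, hζ, rfl⟩)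

end IsFlowBox

theorem exists_atlas_pt {x : Surface Λ} (hx : x ∈ L.carrier) :
    ∃ B ∈ L.atlas, ∃ α ∈ B.A, ∃ ζ ∈ ball (0 : ℂ) B.r, B.pt α ζ = x := by
  obtain ⟨B, hB, hxB⟩ := L.cover x hx
  exact ⟨B, hB, mem_support.1 hxB⟩

/-- By compatibility, all filters in the supremum defining `leafNhds` coincide with the germ of the
given plaque. Any box of the maximal atlas can thus compute the leaf topology. -/
theorem IsFlowBox.leafNhds_eq {B : FlowBox Λ} (hB : L.IsFlowBox B) {α : ℂ} (hα : α ∈ B.A)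
    {x : Surface Λ} (hx : x ∈ B.plaque α) : L.leafNhds x = 𝓝[B.plaque α] x := by
  have hcomp : ∀ B' ∈ L.atlas, ∀ β ∈ B'.A, x ∈ B'.plaque β → 𝓝[B.plaque α] x = 𝓝[B'.plaque β] x :=
    fun B' hB' β hβ hxβ => compatible_iff.1 (hB.2 B' hB') α hα β hβ x ⟨hx, hxβ⟩
  apply le_antisymm
  · refine iSup₂_le fun B' hB' => iSup₂_le fun β hβ => iSup_le fun hxβ => ?_
    exact (hcomp B' hB' β hβ hxβ).ge
  · obtain ⟨B', hB', β, hβ, ζ, hζ, rfl⟩ :=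
      exists_atlas_pt (hB.support_subset (plaque_subset_support hα hx))
    rw [hcomp B' hB' β hβ (pt_mem_plaque hζ)]
    refine le_trans ?_ (le_iSup₂ (f := fun (B : FlowBox Λ) (_ : B ∈ L.atlas) =>
      ⨆ α ∈ B.A, ⨆ (_ : B'.pt β ζ ∈ B.plaque α), 𝓝[B.plaque α] (B'.pt β ζ)) B' hB')
    refine le_trans ?_ (le_iSup₂ (f := fun (α : ℂ) (_ : α ∈ B'.A) =>
      ⨆ (_ : B'.pt β ζ ∈ B'.plaque α), 𝓝[B'.plaque α] (B'.pt β ζ)) β hβ)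
    exact le_iSup (fun _ : B'.pt β ζ ∈ B'.plaque β => 𝓝[B'.plaque β] (B'.pt β ζ))
      (pt_mem_plaque hζ)

theorem IsFlowBox.leafNhds_pt {B : FlowBox Λ} (hB : L.IsFlowBox B) {α ζ : ℂ} (hα : α ∈ B.A)
    (hζ : ζ ∈ ball (0 : ℂ) B.r) : L.leafNhds (B.pt α ζ) = map (B.pt α) (𝓝 ζ) := by
  rw [hB.leafNhds_eq hα (pt_mem_plaque hζ), nhdsWithin_plaque hα hζ]

/-- A locally constant property on the leaves is constant on every plaque. -/
theorem IsFlowBox.iff_of_eventually {P : Surface Λ → Prop}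
    (hP : ∀ x ∈ L.carrier, ∀ᶠ y in L.leafNhds x, (P y ↔ P x)) {B : FlowBox Λ} (hB : L.IsFlowBox B)
    {α : ℂ} (hα : α ∈ B.A) {x y : Surface Λ} (hx : x ∈ B.plaque α) (hy : y ∈ B.plaque α) :
    P x ↔ P y := by
  refine (isPreconnected_plaque hα).induction₂ (fun x y => P x ↔ P y) ?_ ?_ ?_ hx hy
  · intro x hx
    rw [← hB.leafNhds_eq hα hx]
    exact (hP x (hB.support_subset (plaque_subset_support hα hx))).mono fun y hy => hy.symm
  · exact fun x y z _ _ _ h1 h2 => h1.trans h2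
  · exact fun x y _ _ h => h.symm

theorem SamePlaque.symm {x y : Surface Λ} (h : L.SamePlaque x y) : L.SamePlaque y x := by
  obtain ⟨B, hB, α, hα, hx, hy⟩ := h
  exact ⟨B, hB, α, hα, hy, hx⟩

theorem iff_of_mem_leaf {P : Surface Λ → Prop}
    (hP : ∀ x ∈ L.carrier, ∀ᶠ y in L.leafNhds x, (P y ↔ P x)) {x y : Surface Λ}
    (hy : y ∈ L.leaf x) : P x ↔ P y := by
  induction hy with
  | refl => rfl
  | tail _ h ih =>
    obtain ⟨B, hB, α, hα, hx, hy⟩ := h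
    exact ih.trans ((isFlowBox_of_mem_atlas hB).iff_of_eventually hP hα hx hy)

theorem mem_leaf_self (x : Surface Λ) : x ∈ L.leaf x := Relation.ReflTransGen.refl

theorem mem_leaf_trans {x y z : Surface Λ} (h1 : y ∈ L.leaf x) (h2 : z ∈ L.leaf y) :
    z ∈ L.leaf x := Relation.ReflTransGen.trans h1 h2

theorem leaf_subset {x : Surface Λ} (hx : x ∈ L.carrier) : L.leaf x ⊆ L.carrier := by
  intro y hy
  induction hy with
  | refl => exact hx
  | tail _ h _ =>
    obtain ⟨B, hB, α, hα, _, hy⟩ := h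
    exact (isFlowBox_of_mem_atlas hB).support_subset (plaque_subset_support hα hy)

/-- Chains defining leaves use plaques of the atlas only. For a box of the maximal atlas one uses
that lying on a given leaf is a locally constant property, hence constant on a connected plaque. -/
theorem IsFlowBox.mem_leaf {B : FlowBox Λ} (hB : L.IsFlowBox B)
    {α : ℂ} (hα : α ∈ B.A) {x y : Surface Λ} (hx : x ∈ B.plaque α) (hy : y ∈ B.plaque α) :
    y ∈ L.leaf x := by
  refine (hB.iff_of_eventually (P := fun z => z ∈ L.leaf x) ?_ hα hx hy).1 (mem_leaf_self x)
  intro z hz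
  obtain ⟨B', hB', β, hβ, ζ, hζ, rfl⟩ := exists_atlas_pt hz
  rw [(isFlowBox_of_mem_atlas hB').leafNhds_eq hβ (pt_mem_plaque hζ)]
  filter_upwards [self_mem_nhdsWithin] with v hv
  have h1 : L.SamePlaque (B'.pt β ζ) v := ⟨B', hB', β, hβ, pt_mem_plaque hζ, hv⟩
  exact ⟨fun h => mem_leaf_trans h (.single h1.symm), fun h => mem_leaf_trans h (.single h1)⟩

theorem isClosed_carrier [DiscreteTopology Λ] : IsClosed L.carrier :=
  haveI := t2Space_surface Λ
  L.isCompact_carrier.isClosed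

/-- If a leaf accumulates at one point of a plaque, it contains nearby plaques of the same box. By
continuity in the transverse parameter these accumulate at every other point of the plaque. -/
theorem closure_leaf_isClosedSaturated [DiscreteTopology Λ] {x : Surface Λ} (hx : x ∈ L.carrier) :
    L.IsClosedSaturated (closure (L.leaf x)) := by
  have hsub : closure (L.leaf x) ⊆ L.carrier := closure_minimal (leaf_subset hx) isClosed_carrier
  refine ⟨⟨x, subset_closure (mem_leaf_self x)⟩, isClosed_closure, hsub, ?_⟩
  intro p hp q hq
  induction hq with
  | refl => exact hp
  | tail _ h ih =>
    obtain ⟨B, hB, α, hα, ⟨ζ, hζ, rfl⟩, ⟨ξ, hξ, rfl⟩⟩ := h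
    have hBf := isFlowBox_of_mem_atlas hB
    change B.pt α ζ ∈ _ at ih
    change B.pt α ξ ∈ _
    rw [mem_closure_iff_nhds]
    intro V hV
    obtain ⟨δ, hδ, -, h⟩ := exists_forall_pt_mem hα hξ hV
    obtain ⟨y, hy, hyx⟩ := mem_closure_iff_nhds.1 ih _ (hBf.1.eventually_eq_pt hα hζ hδ)
    obtain ⟨β, hβ, hβα, ζ', hζ', -, rfl⟩ := hy (leaf_subset hx hyx)
    exact ⟨B.pt β ξ, h β hβ hβα ξ (mem_ball_self hδ),
      mem_leaf_trans hyx (hBf.mem_leaf hβ (pt_mem_plaque hζ') (pt_mem_plaque hξ))⟩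

/-- Zorn's lemma: compactness of `X` keeps the intersection of a chain nonempty. -/
theorem IsClosedSaturated.exists_isMinimalSet {Z : Set (Surface Λ)} (hZ : L.IsClosedSaturated Z) :
    ∃ Y ⊆ Z, L.IsMinimalSet Y := by
  obtain ⟨Y, hYZ, hY⟩ := zorn_superset_nonempty {Y | L.IsClosedSaturated Y} (fun c hc hchain hne => by
    refine ⟨⋂₀ c, ⟨?_, ?_, ?_, ?_⟩, fun s hs => sInter_subset_of_mem hs⟩
    · have : Nonempty c := hne.to_subtype
      rw [sInter_eq_iInter]
      refine IsCompact.nonempty_iInter_of_directed_nonempty_isCompact_isClosed _ ?_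
        (fun i => (hc i.2).1) (fun i => ?_) (fun i => (hc i.2).2.1)
      · intro a b
        rcases hchain.total a.2 b.2 with h | h
        · exact ⟨a, subset_rfl, h⟩
        · exact ⟨b, h, subset_rfl⟩
      · exact L.isCompact_carrier.of_isClosed_subset (hc i.2).2.1 (hc i.2).2.2.1
    · exact isClosed_sInter fun s hs => (hc hs).2.1
    · obtain ⟨s, hs⟩ := hne
      exact (sInter_subset_of_mem hs).trans (hc hs).2.2.1
    · intro p hp q hq s hs
      exact (hc hs).2.2.2 p (hp s hs) hq) Z hZ
  exact ⟨Y, hYZ, hY.prop, fun W hW hWY => subset_antisymm hWY (hY.le_of_le hW hWY)⟩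

/-- When the minimal set is unique, every leaf accumulates on all of it. -/
theorem subset_closure_leaf [DiscreteTopology Λ] (hmin : ∃! Y, L.IsMinimalSet Y)
    {Y : Set (Surface Λ)} (hY : L.IsMinimalSet Y) {x : Surface Λ} (hx : x ∈ L.carrier) :
    Y ⊆ closure (L.leaf x) := by
  obtain ⟨Z, hZ, hZmin⟩ := (closure_leaf_isClosedSaturated hx).exists_isMinimalSet
  rwa [hmin.unique hY hZmin]

/-- If the germ of a leaf lies in a compact connected set `K` which is, in all flow boxes, given
by fixing one of the coordinates, then the leaf is compact. -/
theorem isCompact_leaf_of_eventually_mem [DiscreteTopology Λ] {K : Set (Surface Λ)}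
    (hKc : IsCompact K) (hKp : IsPreconnected K)
    (hK : ∀ B : FlowBox Λ,
      (∃ κ, ∀ ζ ∈ ball (0 : ℂ) B.r, ∀ η ∈ ball (0 : ℂ) B.s, B.param ζ η ∈ K ↔ η = κ) ∨
      (∃ κ, ∀ ζ ∈ ball (0 : ℂ) B.r, ∀ η ∈ ball (0 : ℂ) B.s, B.param ζ η ∈ K ↔ ζ = κ))
    {q : Surface Λ} (hq : q ∈ L.carrier) (hqK : ∀ᶠ y in L.leafNhds q, y ∈ K) :
    IsCompact (L.leaf q) := by
  -- By the identity theorem, a plaque with a germ in `K` lies entirely in `K`. The alternative `ζ =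
  -- κ` is impossible, since a plaque is a graph over an open set of `ζ`.
  have key : ∀ B : FlowBox Λ, L.IsFlowBox B → ∀ α ∈ B.A, ∀ ζ ∈ ball (0 : ℂ) B.r,
      (∀ᶠ y in L.leafNhds (B.pt α ζ), y ∈ K) →
      ∃ κ, (∀ ζ ∈ ball (0 : ℂ) B.r, ∀ η ∈ ball (0 : ℂ) B.s, B.param ζ η ∈ K ↔ η = κ) ∧
        ∀ ξ ∈ ball (0 : ℂ) B.r, B.graph α ξ = κ := by
    intro B hB α hα ζ hζ h
    rw [hB.leafNhds_pt hα hζ, eventually_map] at h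
    have hball := isOpen_ball.mem_nhds hζ
    rcases hK B with ⟨κ, hκ⟩ | ⟨κ, hκ⟩
    · refine ⟨κ, hκ, ?_⟩
      have h2 : B.graph α =ᶠ[𝓝 ζ] fun _ => κ := by
        filter_upwards [h, hball] with ξ h1 hξ
        exact (hκ ξ hξ _ (graph_mem hα hξ)).1 h1
      have h3 := ((differentiableOn_graph hα).analyticOnNhd isOpen_ball).eqOn_of_preconnected_of_eventuallyEq
        (analyticOnNhd_const (v := κ)) (convex_ball _ _).isPreconnected hζ h2
      exact fun ξ hξ => h3 hξ
    · exfalso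
      have h2 : ∀ᶠ ξ in 𝓝 ζ, ξ = κ := by
        filter_upwards [h, hball] with ξ h1 hξ
        exact (hκ ξ hξ _ (graph_mem hα hξ)).1 h1
      have h3 : ζ = κ := h2.self_of_nhds
      have h4 : ∀ᶠ ξ in 𝓝[≠] ζ, False := by
        filter_upwards [h2.filter_mono nhdsWithin_le_nhds, self_mem_nhdsWithin] with ξ h5 h6
        exact h6 (h5.trans h3.symm)
      exact h4.exists.choose_spec
  have hconv : ∀ B : FlowBox Λ, L.IsFlowBox B → ∀ α ∈ B.A, ∀ ζ ∈ ball (0 : ℂ) B.r, ∀ κ,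
      (∀ ζ ∈ ball (0 : ℂ) B.r, ∀ η ∈ ball (0 : ℂ) B.s, B.param ζ η ∈ K ↔ η = κ) →
      (∀ ξ ∈ ball (0 : ℂ) B.r, B.graph α ξ = κ) → ∀ᶠ y in L.leafNhds (B.pt α ζ), y ∈ K := by
    intro B hB α hα ζ hζ κ h1 h2
    rw [hB.leafNhds_pt hα hζ, eventually_map]
    filter_upwards [isOpen_ball.mem_nhds hζ] with ξ hξ
    exact (h1 ξ hξ _ (graph_mem hα hξ)).2 (h2 ξ hξ)
  have hleaf : ∀ x ∈ L.leaf q, ∀ᶠ y in L.leafNhds x, y ∈ K := by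
    intro x hx
    refine (iff_of_mem_leaf (P := fun x => ∀ᶠ y in L.leafNhds x, y ∈ K) ?_ hx).1 hqK
    intro x hx
    obtain ⟨B, hB, α, hα, ζ, hζ, rfl⟩ := exists_atlas_pt hx
    have hB' := isFlowBox_of_mem_atlas hB
    rw [hB'.leafNhds_eq hα (pt_mem_plaque hζ)]
    filter_upwards [self_mem_nhdsWithin] with y hy
    obtain ⟨ξ, hξ, rfl⟩ := hy
    rw [← hB'.leafNhds_eq hα (pt_mem_plaque hζ)]
    constructor
    · intro h
      obtain ⟨κ, h1, h2⟩ := key B hB' α hα ξ hξ h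
      exact hconv B hB' α hα ζ hζ κ h1 h2
    · intro h
      obtain ⟨κ, h1, h2⟩ := key B hB' α hα ζ hζ h
      exact hconv B hB' α hα ξ hξ κ h1 h2
  have hsub : L.leaf q ⊆ K := by
    intro x hx
    obtain ⟨B, hB, α, hα, ζ, hζ, rfl⟩ := exists_atlas_pt (leaf_subset hq hx)
    have h := hleaf _ hx
    rw [(isFlowBox_of_mem_atlas hB).leafNhds_pt hα hζ, eventually_map] at h
    exact h.self_of_nhds
  -- The leaf is a subset of the connected set `K` that is both open and closed in it, since near
  -- each point of `K` membership in the leaf is constant along `K`.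
  suffices h : L.leaf q = K by rwa [h]
  refine subset_antisymm hsub fun y hy => ?_
  refine ((hKp.induction₂ (fun x y => x ∈ L.leaf q ↔ y ∈ L.leaf q) ?_
    (fun x y z _ _ _ h1 h2 => h1.trans h2) (fun x y _ _ h => h.symm)
    (hsub (mem_leaf_self q)) hy)).1 (mem_leaf_self q)
  intro x hxK
  by_cases hx : x ∈ L.carrier
  · obtain ⟨B, hB, α, hα, ζ, hζ, rfl⟩ := exists_atlas_pt hx
    have hB' := isFlowBox_of_mem_atlas hB
    have ho := (B.isOpen_param_image (U := ball 0 B.r) isOpen_ball).mem_nhds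
      (x := B.pt α ζ) ⟨(ζ, B.graph α ζ), ⟨hζ, graph_mem hα hζ⟩, rfl⟩
    have hf := hB'.1.eventually_eq_pt hα hζ one_pos
    filter_upwards [nhdsWithin_le_nhds ho, nhdsWithin_le_nhds hf, self_mem_nhdsWithin]
      with y hyo hyf hyK
    constructor
    · intro h
      obtain ⟨κ, h1, h2⟩ := key B hB' α hα ζ hζ (hleaf _ h)
      obtain ⟨⟨ξ, η⟩, ⟨hξ, hη⟩, rfl⟩ := hyo
      have h3 := (h1 ξ hξ η hη).1 hyK
      have h4 : B.param ξ η = B.pt α ξ := by rw [pt, h2 ξ hξ, h3]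
      simp only [h4]
      exact mem_leaf_trans h (hB'.mem_leaf hα (pt_mem_plaque hζ) (pt_mem_plaque hξ))
    · intro h
      obtain ⟨β, hβ, -, ξ, hξ, -, rfl⟩ := hyf (leaf_subset hq h)
      obtain ⟨κ, h1, h2⟩ := key B hB' β hβ ξ hξ (hleaf _ h)
      have h3 := (h1 ζ hζ _ (graph_mem hα hζ)).1 hxK
      have h4 : α = β := graph_inj hα hβ hζ (by rw [h3, h2 ζ hζ])
      subst h4
      exact mem_leaf_trans h (hB'.mem_leaf hα (pt_mem_plaque hξ) (pt_mem_plaque hζ))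
  · have := nhdsWithin_le_nhds (s := K) (isClosed_carrier.isOpen_compl.mem_nhds hx)
    filter_upwards [this] with y hy
    exact ⟨fun h => absurd (leaf_subset hq h) hx, fun h => absurd (leaf_subset hq h) hy⟩

end Lamination

/-! ### Slopes of curves: infinitesimal computations -/

section Curves

open Filter Asymptotics

/-- A curve with velocity `(a, b)`, `b ≠ 0`, at a point where the weight has the limit `k`. -/
theorem isLittleO_slope_of_hasDerivAt {Z W : ℂ → ℂ} {a b ζ : ℂ} {ω : ℂ → ℝ}
    (hZ : HasDerivAt Z a ζ) (hW : HasDerivAt W b ζ) (hb : b ≠ 0) (hω : ContinuousAt ω ζ)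
    (hpos : ∀ ξ, 0 < ω ξ) :
    (fun ξ => ‖Z ξ - Z ζ‖ - ‖a‖ * ω ζ / ‖b‖ * (‖W ξ - W ζ‖ / ω ξ)) =o[𝓝 ζ]
      fun ξ => ‖W ξ - W ζ‖ / ω ξ := by
  have h1 := (hasDerivAt_iff_tendsto_slope.1 hZ).norm
  have h2 := (hasDerivAt_iff_tendsto_slope.1 hW).norm
  have h3 : Tendsto (fun ξ => ‖slope Z ζ ξ‖ * ω ξ / ‖slope W ζ ξ‖) (𝓝[≠] ζ)
      (𝓝 (‖a‖ * ω ζ / ‖b‖)) :=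
    (h1.mul (hω.tendsto.mono_left nhdsWithin_le_nhds)).div h2 (norm_ne_zero_iff.2 hb)
  have h4 : ∀ᶠ ξ in 𝓝[≠] ζ, ‖slope W ζ ξ‖ ≠ 0 := h2.eventually_ne (norm_ne_zero_iff.2 hb)
  rw [isLittleO_iff]
  intro c hc
  have h5 := h3.eventually (Metric.ball_mem_nhds _ hc)
  have h6 := eventually_nhdsWithin_iff.1 (h4.and h5)
  filter_upwards [h6] with ξ h
  by_cases hξ : ξ = ζ
  · simp [hξ]
  obtain ⟨h7, h8⟩ := h hξ
  rw [Real.dist_eq] at h8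
  have hξ0 : ‖ξ - ζ‖ ≠ 0 := norm_ne_zero_iff.2 (sub_ne_zero.2 hξ)
  rw [slope_def_field, slope_def_field, norm_div, norm_div] at h8
  rw [slope_def_field, norm_div, div_ne_zero_iff] at h7
  have hw : 0 < ‖W ξ - W ζ‖ := lt_of_le_of_ne (norm_nonneg _) h7.1.symm
  have hχ : 0 < ‖W ξ - W ζ‖ / ω ξ := div_pos hw (hpos ξ)
  have e : ‖Z ξ - Z ζ‖ / ‖ξ - ζ‖ * ω ξ / (‖W ξ - W ζ‖ / ‖ξ - ζ‖) =
      ‖Z ξ - Z ζ‖ / (‖W ξ - W ζ‖ / ω ξ) := by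
    have := (hpos ξ).ne'
    field_simp
  rw [e] at h8
  rw [Real.norm_eq_abs, Real.norm_of_nonneg hχ.le]
  have e2 : ‖Z ξ - Z ζ‖ - ‖a‖ * ω ζ / ‖b‖ * (‖W ξ - W ζ‖ / ω ξ) =
      (‖Z ξ - Z ζ‖ / (‖W ξ - W ζ‖ / ω ξ) - ‖a‖ * ω ζ / ‖b‖) * (‖W ξ - W ζ‖ / ω ξ) := by
    rw [sub_mul, div_mul_cancel₀ _ hχ.ne']
  rw [e2, abs_mul, abs_of_pos hχ]
  gcongr

/-- A finite slope bounds `|Z'|` by a multiple of `|W'|`, so `b = 0` would force `a = 0` as well. -/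
theorem hasDerivAt_ne_zero_of_isLittleO {Z W : ℂ → ℂ} {a b ζ : ℂ} {ω : ℂ → ℝ} {σ : ℝ}
    (hZ : HasDerivAt Z a ζ) (hW : HasDerivAt W b ζ) (hab : a ≠ 0 ∨ b ≠ 0) (hω : ∀ ξ, 1 ≤ ω ξ)
    (h : (fun ξ => ‖Z ξ - Z ζ‖ - σ * (‖W ξ - W ζ‖ / ω ξ)) =o[𝓝 ζ]
      fun ξ => ‖W ξ - W ζ‖ / ω ξ) : b ≠ 0 := by
  rintro rfl
  have ha : a ≠ 0 := hab.resolve_right (by simp)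
  have h1 := (hasDerivAt_iff_tendsto_slope.1 hZ).norm
  have h2 := (hasDerivAt_iff_tendsto_slope.1 hW).norm
  rw [isLittleO_iff] at h
  have h3 := (h one_pos).filter_mono (nhdsWithin_le_nhds (s := {ζ}ᶜ))
  have h4 : ∀ᶠ ξ in 𝓝[≠] ζ, ‖slope Z ζ ξ‖ ≤ (|σ| + 1) * ‖slope W ζ ξ‖ := by
    filter_upwards [h3, self_mem_nhdsWithin] with ξ h5 hξ
    have hξ0 : 0 < ‖ξ - ζ‖ := norm_pos_iff.2 (sub_ne_zero.2 hξ)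
    have hχ : ‖W ξ - W ζ‖ / ω ξ ≤ ‖W ξ - W ζ‖ := div_le_self (norm_nonneg _) (hω ξ)
    have hχ0 : 0 ≤ ‖W ξ - W ζ‖ / ω ξ := div_nonneg (norm_nonneg _) (by linarith [hω ξ])
    rw [one_mul, Real.norm_eq_abs, Real.norm_of_nonneg hχ0] at h5
    have h6 := (abs_le.1 h5).2
    rw [slope_def_field, slope_def_field, norm_div, norm_div, mul_div_assoc']
    gcongr
    nlinarith [le_abs_self σ, abs_nonneg σ]
  have h5 := le_of_tendsto_of_tendsto h1 (h2.const_mul (|σ| + 1)) h4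
  simp [ha] at h5

/-- The identity compares the Fubini-Study weight with the square modulus of a function holomorphic
in `b`, with error `‖a - b‖ ^ 2` of a definite sign. It is the source of the maximum principle for
slopes. -/
theorem normSq_one_add_conj_mul (a b : ℂ) :
    ‖1 + (starRingEnd ℂ) a * b‖ ^ 2 + ‖a - b‖ ^ 2 = (1 + ‖a‖ ^ 2) * (1 + ‖b‖ ^ 2) := by
  simp only [← Complex.normSq_eq_norm_sq, Complex.normSq_apply]
  simp
  ring

end Curves

/-! ### Velocities and slopes of plaques in a box -/

namespace FlowBox

open Filter Asymptotics

variable {Λ : Submodule ℤ ℂ} {B : FlowBox Λ}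

variable (B) in
/-- The torus coordinate along a plaque. -/
def torusCurve (α ζ : ℂ) : ℂ := torusCoord B.orientation B.z₀ ζ (B.graph α ζ)

variable (B) in
/-- The projective coordinate along a plaque. -/
def projCurve (α ζ : ℂ) : ℂ := projCoord B.orientation B.w₀ ζ (B.graph α ζ)

variable (B) in
/-- The velocity of the torus coordinate along a plaque. -/
noncomputable def torusVelocity (α ζ : ℂ) : ℂ :=
  match B.orientation with
  | .horizontal => 1
  | .vertical => deriv (B.graph α) ζ

variable (B) in
/-- The velocity of the projective coordinate along a plaque. -/
noncomputable def projVelocity (α ζ : ℂ) : ℂ :=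
  match B.orientation with
  | .horizontal => deriv (B.graph α) ζ
  | .vertical => 1

variable (B) in
/-- The slope of a plaque with respect to the Fubini-Study metric. -/
noncomputable def slopeAt (α ζ : ℂ) : ℝ :=
  ‖B.torusVelocity α ζ‖ * (1 + ‖B.projCurve α ζ‖ ^ 2) / ‖B.projVelocity α ζ‖

theorem pt_eq (α ζ : ℂ) : B.pt α ζ = (torusProj Λ (B.torusCurve α ζ),
    B.chart.param (B.projCurve α ζ)) := boxParam_eq _ _ _ _ _ _ _

theorem hasDerivAt_torusCurve {α ζ : ℂ} (hα : α ∈ B.A) (hζ : ζ ∈ ball (0 : ℂ) B.r) :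
    HasDerivAt (B.torusCurve α) (B.torusVelocity α ζ) ζ := by
  have h := (differentiableAt_graph hα hζ).hasDerivAt
  unfold torusCurve torusVelocity
  cases B.orientation
  · exact (hasDerivAt_id ζ).const_add _
  · exact h.const_add _

theorem hasDerivAt_projCurve {α ζ : ℂ} (hα : α ∈ B.A) (hζ : ζ ∈ ball (0 : ℂ) B.r) :
    HasDerivAt (B.projCurve α) (B.projVelocity α ζ) ζ := by
  have h := (differentiableAt_graph hα hζ).hasDerivAt
  unfold projCurve projVelocity
  cases B.orientation
  · exact h.const_add _
  · exact (hasDerivAt_id ζ).const_add _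

theorem differentiableOn_deriv_graph {α : ℂ} (hα : α ∈ B.A) :
    DifferentiableOn ℂ (deriv (B.graph α)) (ball 0 B.r) :=
  (differentiableOn_graph hα).deriv isOpen_ball

theorem differentiableOn_torusVelocity {α : ℂ} (hα : α ∈ B.A) :
    DifferentiableOn ℂ (B.torusVelocity α) (ball 0 B.r) := by
  unfold torusVelocity
  cases B.orientation
  · exact differentiableOn_const 1
  · exact differentiableOn_deriv_graph hα

theorem differentiableOn_projVelocity {α : ℂ} (hα : α ∈ B.A) :
    DifferentiableOn ℂ (B.projVelocity α) (ball 0 B.r) := by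
  unfold projVelocity
  cases B.orientation
  · exact differentiableOn_deriv_graph hα
  · exact differentiableOn_const 1

theorem velocity_ne_zero (α ζ : ℂ) : B.torusVelocity α ζ ≠ 0 ∨ B.projVelocity α ζ ≠ 0 := by
  unfold torusVelocity projVelocity
  cases B.orientation <;> simp

/-- The graph and its derivative depend continuously on the plaque and the base point. -/
theorem tendsto_graph_deriv {α₀ ζ₀ : ℂ} (hα₀ : α₀ ∈ B.A) (hζ₀ : ζ₀ ∈ ball (0 : ℂ) B.r) :
    Tendsto (fun q : ℂ × ℂ => (B.graph q.1 q.2, deriv (B.graph q.1) q.2)) (𝓝[B.A] α₀ ×ˢ 𝓝 ζ₀)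
      (𝓝 (B.graph α₀ ζ₀) ×ˢ 𝓝 (deriv (B.graph α₀) ζ₀)) := by
  obtain ⟨R, hR1, hR⟩ := exists_between (mem_ball_zero_iff.1 hζ₀)
  have hunif : ∀ e > 0, ∀ᶠ α in 𝓝[B.A] α₀, α ∈ B.A ∧ ∀ ζ ∈ ball (0 : ℂ) R,
      ‖B.graph α ζ - B.graph α₀ ζ‖ ≤ e := by
    intro e he
    obtain ⟨δ, hδ, h⟩ := exists_forall_norm_graph_sub_lt hα₀ hR he
    filter_upwards [self_mem_nhdsWithin, nhdsWithin_le_nhds (ball_mem_nhds α₀ hδ)] with α h1 h2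
    exact ⟨h1, fun ζ hζ => (h α h1 h2 ζ (ball_subset_closedBall hζ)).le⟩
  obtain ⟨R', hR'1, hR'⟩ := exists_between hR1
  have hmem : ∀ᶠ ζ in 𝓝 ζ₀, ζ ∈ ball (0 : ℂ) R' :=
    isOpen_ball.mem_nhds (mem_ball_zero_iff.2 hR'1)
  refine Tendsto.prodMk ?_ ?_
  · rw [Metric.tendsto_nhds]
    intro e he
    have h2 := (differentiableAt_graph hα₀ hζ₀).continuousAt.eventually
      (ball_mem_nhds _ (half_pos he))
    filter_upwards [(hunif (e / 3) (by positivity)).prod_mk (h2.and hmem)] with q hq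
    obtain ⟨⟨-, h3⟩, h4, h5⟩ := hq
    have h6 := h3 q.2 (ball_subset_ball hR'.le h5)
    rw [← dist_eq_norm] at h6
    have := dist_triangle (B.graph q.1 q.2) (B.graph α₀ q.2) (B.graph α₀ ζ₀)
    linarith
  · rw [Metric.tendsto_nhds]
    intro e he
    have h2 := ((differentiableOn_deriv_graph hα₀).differentiableAt
      (isOpen_ball.mem_nhds hζ₀)).continuousAt.eventually (ball_mem_nhds _ (half_pos he))
    have hRR : 0 < R - R' := by linarith
    filter_upwards [(hunif (e / 3 * ((R - R') / 2)) (by positivity)).prod_mk (h2.and hmem)] with q hq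
    obtain ⟨⟨h1, h3⟩, h4, h5⟩ := hq
    have hsub : ball (0 : ℂ) R ⊆ ball 0 B.r := ball_subset_ball hR.le
    have h6 := norm_deriv_le_of_ball (g := fun ζ => B.graph q.1 ζ - B.graph α₀ ζ) hR'
      (((differentiableOn_graph h1).sub (differentiableOn_graph hα₀)).mono hsub) h3 q.2 h5
    have h5' : q.2 ∈ ball (0 : ℂ) B.r := hsub (ball_subset_ball hR'.le h5)
    rw [deriv_fun_sub (differentiableAt_graph h1 h5') (differentiableAt_graph hα₀ h5'),
      ← dist_eq_norm] at h6
    have e1 : e / 3 * ((R - R') / 2) * (2 / (R - R')) = e / 3 := by field_simp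
    rw [e1] at h6
    have := dist_triangle (deriv (B.graph q.1) q.2) (deriv (B.graph α₀) q.2)
      (deriv (B.graph α₀) ζ₀)
    linarith

theorem tendsto_slopeAt {α₀ ζ₀ : ℂ} (hα₀ : α₀ ∈ B.A) (hζ₀ : ζ₀ ∈ ball (0 : ℂ) B.r)
    (h0 : B.projVelocity α₀ ζ₀ ≠ 0) :
    Tendsto (fun q : ℂ × ℂ => B.slopeAt q.1 q.2) (𝓝[B.A] α₀ ×ˢ 𝓝 ζ₀)
      (𝓝 (B.slopeAt α₀ ζ₀)) := by
  have h := tendsto_graph_deriv hα₀ hζ₀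
  rw [← nhds_prod_eq] at h
  have h1 := (continuous_fst.tendsto _).comp h
  have h2 := (continuous_snd.tendsto _).comp h
  have h3 : Tendsto (fun q : ℂ × ℂ => q.2) (𝓝[B.A] α₀ ×ˢ 𝓝 ζ₀) (𝓝 ζ₀) := tendsto_snd
  simp only [Function.comp_def] at h1 h2
  unfold slopeAt projCurve torusVelocity projVelocity at *
  cases ho : B.orientation <;> simp only [ho] at h0
  · exact Tendsto.div (tendsto_const_nhds.mul
      (((h1.const_add _).norm.pow 2).const_add _)) h2.norm (norm_ne_zero_iff.2 h0)
  · exact Tendsto.div (h2.norm.mul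
      (((h3.const_add _).norm.pow 2).const_add _)) tendsto_const_nhds (by simp)

theorem exists_forall_slopeAt_near {α₀ ζ₀ : ℂ} {e : ℝ} (hα₀ : α₀ ∈ B.A)
    (hζ₀ : ζ₀ ∈ ball (0 : ℂ) B.r) (h0 : B.projVelocity α₀ ζ₀ ≠ 0) (he : 0 < e) :
    ∃ δ > 0, ∀ α ∈ B.A, α ∈ ball α₀ δ → ∀ ζ ∈ ball ζ₀ δ,
      dist (B.slopeAt α ζ) (B.slopeAt α₀ ζ₀) < e := by
  have h := (tendsto_slopeAt hα₀ hζ₀ h0).eventually (ball_mem_nhds _ he)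
  obtain ⟨⟨δ, δ'⟩, ⟨h1, h2⟩, h3⟩ :=
    ((Metric.nhdsWithin_basis_ball (s := B.A)).prod Metric.nhds_basis_ball).eventually_iff.1 h
  refine ⟨min δ δ', lt_min h1 h2, fun α hα hαδ ζ hζ => ?_⟩
  exact h3 (x := (α, ζ)) ⟨⟨ball_subset_ball (min_le_left _ _) hαδ, hα⟩,
    ball_subset_ball (min_le_right _ _) hζ⟩

/-- Injectivity of the projection on the disk leaves at most one point of the fibre; this and
`exists_proj_fiber` supply the local equations required of a compact leaf candidate. -/
theorem exists_torus_fiber (t : Torus Λ) : ∃ κ : ℂ, ∀ ζ ∈ ball (0 : ℂ)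
    (torusRadius B.orientation B.r B.s), torusProj Λ (B.z₀ + ζ) = t ↔ ζ = κ := by
  set R := torusRadius B.orientation B.r B.s
  by_cases h : ∃ κ ∈ ball (0 : ℂ) R, torusProj Λ (B.z₀ + κ) = t
  · obtain ⟨κ, hκ, rfl⟩ := h
    refine ⟨κ, fun ζ hζ => ⟨fun h => ?_, fun h => by rw [h]⟩⟩
    have := B.injOn (show B.z₀ + ζ ∈ _ by simpa using hζ) (show B.z₀ + κ ∈ _ by simpa using hκ) h
    exact add_left_cancel this
  · push Not at h
    -- When the fibre misses the disk, `κ` is any point outside the open disk, so that both sides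
    -- are false.
    refine ⟨(R : ℂ), fun ζ hζ => ⟨fun h' => absurd h' (h ζ hζ), ?_⟩⟩
    rintro rfl
    rw [mem_ball_zero_iff, Complex.norm_real] at hζ
    exact absurd hζ (not_lt.2 (le_abs_self R))

theorem exists_proj_fiber (t : ProjLine) : ∃ κ : ℂ, ∀ ζ ∈ ball (0 : ℂ) (B.r + B.s),
    B.chart.param (B.w₀ + ζ) = t ↔ ζ = κ := by
  set R := B.r + B.s
  by_cases h : ∃ κ ∈ ball (0 : ℂ) R, B.chart.param (B.w₀ + κ) = t
  · obtain ⟨κ, hκ, rfl⟩ := h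
    refine ⟨κ, fun ζ hζ => ⟨fun h => ?_, fun h => by rw [h]⟩⟩
    exact add_left_cancel (param_injective _ h)
  · push Not at h
    refine ⟨(R : ℂ), fun ζ hζ => ⟨fun h' => absurd h' (h ζ hζ), ?_⟩⟩
    rintro rfl
    rw [mem_ball_zero_iff, Complex.norm_real] at hζ
    exact absurd hζ (not_lt.2 (le_abs_self R))

end FlowBox

/-! ### The slope function and the existence of tangencies -/

namespace Lamination

open Filter FlowBox Asymptotics

variable {Λ : Submodule ℤ ℂ} {L : Lamination Λ}

variable (L) in
/-- The leaf through `p` has the slope `σ` at `p`: it is the limit of the quotients of the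
distances of the torus and of the projective components. -/
def IsSlope (p : Surface Λ) (σ : ℝ) : Prop :=
  (fun x => ‖x.1 - p.1‖ - σ * chordDist x.2 p.2) =o[L.leafNhds p] fun x => chordDist x.2 p.2

theorem IsFlowBox.isSlope_pt_iff' [DiscreteTopology Λ] {B : FlowBox Λ} (hB : L.IsFlowBox B)
    {α ζ : ℂ} (hα : α ∈ B.A) (hζ : ζ ∈ ball (0 : ℂ) B.r) (σ : ℝ) :
    L.IsSlope (B.pt α ζ) σ ↔
    (fun ξ => ‖B.torusCurve α ξ - B.torusCurve α ζ‖ - σ * (‖B.projCurve α ξ - B.projCurve α ζ‖ /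
      (chordWeight (B.projCurve α ξ) * chordWeight (B.projCurve α ζ)))) =o[𝓝 ζ]
      fun ξ => ‖B.projCurve α ξ - B.projCurve α ζ‖ /
        (chordWeight (B.projCurve α ξ) * chordWeight (B.projCurve α ζ)) := by
  rw [IsSlope, hB.leafNhds_pt hα hζ, isLittleO_map]
  have hc := (hasDerivAt_torusCurve hα hζ).continuousAt
  have hd : ∀ᶠ ξ in 𝓝 ζ, ‖B.torusCurve α ξ - B.torusCurve α ζ‖ < torusScale Λ := by
    have := hc.eventually (ball_mem_nhds _ (torusScale_pos Λ))
    filter_upwards [this] with ξ hξ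
    rwa [← dist_eq_norm]
  refine isLittleO_congr ?_ (Eventually.of_forall fun ξ => ?_)
  · filter_upwards [hd] with ξ hξ
    simp only [Function.comp, pt_eq]
    rw [← torusProj_sub, norm_torusProj_eq Λ hξ, chordDist_param]
  · simp only [Function.comp, pt_eq]
    rw [chordDist_param]

/-- The slope computed in a flow box. -/
theorem IsFlowBox.isSlope_pt_iff [DiscreteTopology Λ] {B : FlowBox Λ} (hB : L.IsFlowBox B)
    {α ζ : ℂ} (hα : α ∈ B.A) (hζ : ζ ∈ ball (0 : ℂ) B.r) (σ : ℝ) :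
    L.IsSlope (B.pt α ζ) σ ↔ B.projVelocity α ζ ≠ 0 ∧ σ = B.slopeAt α ζ := by
  have hZ := hasDerivAt_torusCurve hα hζ
  have hW := hasDerivAt_projCurve hα hζ
  set ω : ℂ → ℝ := fun ξ => chordWeight (B.projCurve α ξ) * chordWeight (B.projCurve α ζ) with hω
  have hω1 : ∀ ξ, 1 ≤ ω ξ := fun ξ => by
    have h1 := one_le_chordWeight (B.projCurve α ξ)
    have h2 := one_le_chordWeight (B.projCurve α ζ)
    simp only [hω]; nlinarith
  have hωc : ContinuousAt ω ζ :=
    (continuous_chordWeight.continuousAt.comp hW.continuousAt).mul continuousAt_const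
  have hωζ : ω ζ = 1 + ‖B.projCurve α ζ‖ ^ 2 := by simp only [hω]; rw [← sq, sq_chordWeight]
  have hmain : B.projVelocity α ζ ≠ 0 → L.IsSlope (B.pt α ζ) (B.slopeAt α ζ) := by
    intro h
    rw [hB.isSlope_pt_iff' hα hζ]
    have := isLittleO_slope_of_hasDerivAt hZ hW h hωc (fun ξ => by linarith [hω1 ξ])
    rwa [hωζ] at this
  constructor
  · intro h
    have h1 : B.projVelocity α ζ ≠ 0 := hasDerivAt_ne_zero_of_isLittleO hZ hW
      (velocity_ne_zero α ζ) hω1 ((hB.isSlope_pt_iff' hα hζ σ).1 h)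
    refine ⟨h1, ?_⟩
    have h2 := (hB.isSlope_pt_iff' hα hζ _).1 (hmain h1)
    -- Uniqueness: two different slopes would make the chordal distance negligible with respect to
    -- itself, although it is nonzero near the point.
    have h3 := h2.sub ((hB.isSlope_pt_iff' hα hζ σ).1 h)
    by_contra hne
    have h4 : (fun ξ => (σ - B.slopeAt α ζ) * (‖B.projCurve α ξ - B.projCurve α ζ‖ / ω ξ)) =o[𝓝 ζ]
        fun ξ => ‖B.projCurve α ξ - B.projCurve α ζ‖ / ω ξ := by
      refine h3.congr_left fun ξ => ?_
      simp only [hω]; ring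
    rw [isLittleO_const_mul_left_iff (sub_ne_zero.2 hne)] at h4
    refine isLittleO_irrefl ?_ h4
    have h5 := hW.eventually_ne (c := B.projCurve α ζ) h1
    refine (h5.frequently.filter_mono nhdsWithin_le_nhds).mono fun ξ hξ => ?_
    have := (hω1 ξ)
    exact div_ne_zero (norm_ne_zero_iff.2 (sub_ne_zero.2 hξ)) (by linarith)
  · rintro ⟨h, rfl⟩
    exact hmain h

/-- If all leaves of a closed saturated set have slopes, then one of these leaves is compact. -/
theorem IsClosedSaturated.exists_isCompact_leaf [DiscreteTopology Λ] {Y : Set (Surface Λ)}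
    (hY : L.IsClosedSaturated Y) (h : ∀ p ∈ Y, ∃ σ, L.IsSlope p σ) :
    ∃ p ∈ L.carrier, IsCompact (L.leaf p) := by
  classical
  choose! m hm using h
  have hYX := hY.2.2.1
  have hYc : IsCompact Y := L.isCompact_carrier.of_isClosed_subset hY.2.1 hYX
  have hbox : ∀ B, L.IsFlowBox B → ∀ α ∈ B.A, ∀ ζ ∈ ball (0 : ℂ) B.r, B.pt α ζ ∈ Y →
      B.projVelocity α ζ ≠ 0 ∧ m (B.pt α ζ) = B.slopeAt α ζ :=
    fun B hB α hα ζ hζ hp => (hB.isSlope_pt_iff hα hζ _).1 (hm _ hp)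
  -- The slope is intrinsic, so continuity may be checked in any box, where it follows from
  -- convergence of the graphs and their derivatives.
  have hcont : ContinuousOn m Y := by
    intro p hp
    obtain ⟨B, hB, α, hα, ζ, hζ, rfl⟩ := exists_atlas_pt (hYX hp)
    have hB' := isFlowBox_of_mem_atlas hB
    rw [ContinuousWithinAt, Metric.tendsto_nhds]
    intro e he
    obtain ⟨h1, h2⟩ := hbox B hB' α hα ζ hζ hp
    obtain ⟨δ, hδ, h3⟩ := exists_forall_slopeAt_near hα hζ h1 he
    filter_upwards [nhdsWithin_le_nhds (hB'.1.eventually_eq_pt hα hζ hδ), self_mem_nhdsWithin]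
      with x hx hxY
    obtain ⟨β, hβ, hβδ, ξ, hξ, hξδ, rfl⟩ := hx (hYX hxY)
    rw [h2, (hbox B hB' β hβ ξ hξ hxY).2]
    exact h3 β hβ hβδ ξ hξδ
  obtain ⟨p, hpY, hpmax⟩ := hYc.exists_isMaxOn hY.1 hcont
  refine ⟨p, hYX hpY, ?_⟩
  obtain ⟨B, hB, α, hα, ζ, hζ, rfl⟩ := exists_atlas_pt (hYX hpY)
  have hB' := isFlowBox_of_mem_atlas hB
  have hplaque : ∀ ξ ∈ ball (0 : ℂ) B.r, B.pt α ξ ∈ Y := fun ξ hξ =>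
    hY.2.2.2 _ hpY (hB'.mem_leaf hα (pt_mem_plaque hζ) (pt_mem_plaque hξ))
  have hmax : ∀ ξ ∈ ball (0 : ℂ) B.r, B.slopeAt α ξ ≤ B.slopeAt α ζ := fun ξ hξ => by
    rw [← (hbox B hB' α hα ξ hξ (hplaque ξ hξ)).2, ← (hbox B hB' α hα ζ hζ hpY).2]
    exact hpmax (hplaque ξ hξ)
  have hW0 : ∀ ξ ∈ ball (0 : ℂ) B.r, B.projVelocity α ξ ≠ 0 := fun ξ hξ =>
    (hbox B hB' α hα ξ hξ (hplaque ξ hξ)).1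
  have hslope0 : B.slopeAt α ζ = 0 := by
    by_contra hne
    set W := B.projCurve α with hW
    -- This holomorphic function satisfies `|g ξ| = slope(ξ) (1 + |W ζ|²) - |z'/w'| |W ζ - W ξ|²`,
    -- with equality to `slope(ζ) (1 + |W ζ|²)` at `ξ = ζ`. A maximum of the slope at `ζ` is thus a
    -- local maximum of `|g|`.
    set g : ℂ → ℂ := fun ξ => B.torusVelocity α ξ / B.projVelocity α ξ *
      (1 + (starRingEnd ℂ) (W ζ) * W ξ) ^ 2 with hg
    have hgn : ∀ ξ, ‖g ξ‖ = ‖B.torusVelocity α ξ‖ / ‖B.projVelocity α ξ‖ *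
      ((1 + ‖W ζ‖ ^ 2) * (1 + ‖W ξ‖ ^ 2) - ‖W ζ - W ξ‖ ^ 2) := fun ξ => by
      rw [← normSq_one_add_conj_mul]; simp [hg]
    have hs : ∀ ξ, B.slopeAt α ξ = ‖B.torusVelocity α ξ‖ / ‖B.projVelocity α ξ‖ * (1 + ‖W ξ‖ ^ 2) :=
      fun ξ => by rw [slopeAt]; ring
    have hgζ : ‖g ζ‖ = B.slopeAt α ζ * (1 + ‖W ζ‖ ^ 2) := by
      rw [hgn, hs]; simp; ring
    have hgξ : ∀ ξ, ‖g ξ‖ = B.slopeAt α ξ * (1 + ‖W ζ‖ ^ 2) -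
        ‖B.torusVelocity α ξ‖ / ‖B.projVelocity α ξ‖ * ‖W ζ - W ξ‖ ^ 2 := fun ξ => by
      rw [hgn, hs]; ring
    have hnear := isOpen_ball.mem_nhds hζ
    have hconst := Complex.norm_eventually_eq_of_isLocalMax (f := g) (c := ζ) ?_ ?_
    · have hpos : ∀ᶠ ξ in 𝓝 ζ, g ξ ≠ 0 := by
        filter_upwards [hconst] with ξ hξ
        rw [← norm_ne_zero_iff, hξ, hgζ]
        exact mul_ne_zero hne (by positivity)
      -- Constancy of `|g|` leaves no room for the subtracted square, so `W` is locally constant.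
      -- This contradicts the nonvanishing of its derivative.
      have hWc : ∀ᶠ ξ in 𝓝 ζ, W ξ = W ζ := by
        filter_upwards [hconst, hpos, hnear] with ξ h1 h2 h3
        by_contra hne'
        have h4 : B.torusVelocity α ξ ≠ 0 := fun h0 => h2 (by simp [hg, h0])
        have h5 : 0 < ‖B.torusVelocity α ξ‖ / ‖B.projVelocity α ξ‖ * ‖W ζ - W ξ‖ ^ 2 := by
          have := norm_pos_iff.2 h4
          have := norm_pos_iff.2 (hW0 ξ h3)
          have := norm_pos_iff.2 (sub_ne_zero.2 (Ne.symm hne'))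
          positivity
        rw [hgξ, hgζ] at h1
        nlinarith [hmax ξ h3, norm_nonneg (W ζ)]
      have h1 := hasDerivAt_projCurve hα hζ
      have h2 := h1.congr_of_eventuallyEq (EventuallyEq.symm hWc)
      exact hW0 ζ hζ (h2.unique (hasDerivAt_const ζ (W ζ)))
    · filter_upwards [hnear] with ξ hξ
      have hn := isOpen_ball.mem_nhds hξ
      have h1 := (differentiableOn_torusVelocity hα).differentiableAt hn
      have h2 := (differentiableOn_projVelocity hα).differentiableAt hn
      have h3 := (hasDerivAt_projCurve hα hξ).differentiableAt
      exact (h1.div h2 (hW0 ξ hξ)).mul (((h3.const_mul _).const_add _).pow 2)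
    · filter_upwards [hnear] with ξ hξ
      simp only [Function.comp]
      rw [hgξ, hgζ]
      have : 0 ≤ ‖B.torusVelocity α ξ‖ / ‖B.projVelocity α ξ‖ * ‖W ζ - W ξ‖ ^ 2 := by positivity
      nlinarith [hmax ξ hξ, norm_nonneg (W ζ)]
  have hvel : ∀ ξ ∈ ball (0 : ℂ) B.r, B.torusVelocity α ξ = 0 := by
    intro ξ hξ
    have h1 := hmax ξ hξ
    rw [hslope0, slopeAt] at h1
    have h2 := norm_pos_iff.2 (hW0 ξ hξ)
    by_contra h3
    have h4 := norm_pos_iff.2 h3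
    have : 0 < ‖B.torusVelocity α ξ‖ * (1 + ‖B.projCurve α ξ‖ ^ 2) / ‖B.projVelocity α ξ‖ := by
      positivity
    linarith
  have htorus : ∀ ξ ∈ ball (0 : ℂ) B.r, B.torusCurve α ξ = B.torusCurve α ζ := by
    intro ξ hξ
    refine (convex_ball (0 : ℂ) B.r).is_const_of_fderivWithin_eq_zero (𝕜 := ℂ)
      (fun x hx => (hasDerivAt_torusCurve hα hx).differentiableAt.differentiableWithinAt)
      (fun x hx => ?_) hξ hζ
    rw [fderivWithin_of_isOpen isOpen_ball hx]
    have h1 := hasDerivAt_torusCurve hα hx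
    rw [hvel x hx] at h1
    ext
    simp [h1.deriv]
  -- Slope zero on the whole plaque means that the torus coordinate is constant there, so the leaf
  -- is a fibre `{z} × ℂℙ¹`.
  refine isCompact_leaf_of_eventually_mem (K := {(B.pt α ζ).1} ×ˢ univ)
    (isCompact_singleton.prod isCompact_univ) (isPreconnected_singleton.prod isPreconnected_univ)
    (fun B' => ?_) (hYX hpY) ?_
  · obtain ⟨κ, hκ⟩ := exists_torus_fiber (B := B') (B.pt α ζ).1
    cases ho : B'.orientation with
    | horizontal =>
      rw [ho] at hκ
      exact Or.inr ⟨κ, fun ξ hξ η hη => by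
        rw [← hκ ξ hξ, param, ho]; simp [boxParam]⟩
    | vertical =>
      rw [ho] at hκ
      exact Or.inl ⟨κ, fun ξ hξ η hη => by
        rw [← hκ η hη, param, ho]; simp [boxParam]⟩
  · rw [hB'.leafNhds_pt hα hζ, eventually_map]
    filter_upwards [isOpen_ball.mem_nhds hζ] with ξ hξ
    simp [pt_eq, htorus ξ hξ]

/-- A point without slope: all flow boxes around it are horizontal, and its plaque is tangent to
the torus direction there, but it does not contain a piece of a torus. -/
theorem IsFlowBox.tangency [DiscreteTopology Λ] [IsZLattice ℝ Λ] (hleaf : L.NoCompactLeaf)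
    {B : FlowBox Λ} (hB : L.IsFlowBox B) {α ζ : ℂ} (hα : α ∈ B.A) (hζ : ζ ∈ ball (0 : ℂ) B.r)
    (h : ∀ σ, ¬ L.IsSlope (B.pt α ζ) σ) :
    B.orientation = .horizontal ∧ deriv (B.graph α) ζ = 0 ∧
      ∀ᶠ ξ in 𝓝[≠] ζ, deriv (B.graph α) ξ ≠ 0 := by
  have h1 : B.projVelocity α ζ = 0 := by
    by_contra h1
    exact h _ ((hB.isSlope_pt_iff hα hζ _).2 ⟨h1, rfl⟩)
  have ho : B.orientation = .horizontal := by
    cases ho : B.orientation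
    · rfl
    · simp [projVelocity, ho] at h1
  refine ⟨ho, by simpa [projVelocity, ho] using h1, ?_⟩
  -- A nonisolated zero of the derivative would make the graph locally constant, and the leaf would
  -- be a compact torus `𝕋¹ × {w}`.
  have han := ((differentiableOn_deriv_graph hα).analyticOnNhd isOpen_ball) ζ hζ
  refine han.eventually_eq_zero_or_eventually_ne_zero.resolve_left fun h0 => ?_
  obtain ⟨δ, hδ, hball⟩ := Metric.mem_nhds_iff.1 (h0.and (isOpen_ball.mem_nhds hζ))
  have hconst : ∀ ξ ∈ ball ζ δ, B.graph α ξ = B.graph α ζ := by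
    intro ξ hξ
    refine (convex_ball ζ δ).is_const_of_fderivWithin_eq_zero (𝕜 := ℂ)
      (fun x hx => (differentiableAt_graph hα (hball hx).2).differentiableWithinAt)
      (fun x hx => ?_) hξ (mem_ball_self hδ)
    rw [fderivWithin_of_isOpen isOpen_ball hx]
    ext
    simp [(hball hx).1]
  have := compactSpace_torus Λ
  have := connectedSpace_torus Λ
  refine hleaf _ (hB.pt_mem hα hζ) (isCompact_leaf_of_eventually_mem
    (K := univ ×ˢ {(B.pt α ζ).2}) (isCompact_univ.prod isCompact_singleton)
    (isPreconnected_univ.prod isPreconnected_singleton) (fun B' => ?_) (hB.pt_mem hα hζ) ?_)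
  · obtain ⟨κ, hκ⟩ := exists_proj_fiber (B := B') (B.pt α ζ).2
    have hr := B'.r_pos
    have hs := B'.s_pos
    cases ho : B'.orientation with
    | horizontal =>
      exact Or.inl ⟨κ, fun ξ hξ η hη => by
        rw [← hκ η (ball_subset_ball (by linarith) hη), param, ho]; simp [boxParam]⟩
    | vertical =>
      exact Or.inr ⟨κ, fun ξ hξ η hη => by
        rw [← hκ ξ (ball_subset_ball (by linarith) hξ), param, ho]; simp [boxParam]⟩
  · rw [hB.leafNhds_pt hα hζ, eventually_map]
    filter_upwards [ball_mem_nhds ζ hδ] with ξ hξ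
    simp [pt, param, ho, boxParam, hconst ξ hξ]

end Lamination

/-! ### The gap between a plaque and a translated plaque -/

namespace FlowBox

open Filter

variable {Λ : Submodule ℤ ℂ} {B : FlowBox Λ}

variable (B) in
/-- The effect of the translation by `ε` on the base coordinate. -/
def baseShift (ε : ℂ) : ℂ :=
  match B.orientation with
  | .horizontal => ε
  | .vertical => 0

variable (B) in
/-- The effect of the translation by `ε` on the transverse coordinate. -/
def fiberShift (ε : ℂ) : ℂ :=
  match B.orientation with
  | .horizontal => 0
  | .vertical => ε

variable (B) in
/-- The difference, over the base point `ζ`, between the plaque `Γ_α` and the translate of the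
plaque `Γ_β`. -/
def gap (α β ε ζ : ℂ) : ℂ := B.graph α ζ - B.graph β (ζ - B.baseShift ε) - B.fiberShift ε

theorem norm_baseShift_le (ε : ℂ) : ‖B.baseShift ε‖ ≤ ‖ε‖ := by
  unfold baseShift; cases B.orientation <;> simp

theorem norm_fiberShift_le (ε : ℂ) : ‖B.fiberShift ε‖ ≤ ‖ε‖ := by
  unfold fiberShift; cases B.orientation <;> simp

theorem torusTranslation_param (ε ζ η : ℂ) : torusTranslation Λ ε (B.param ζ η) =
    B.param (ζ + B.baseShift ε) (η + B.fiberShift ε) := by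
  unfold torusTranslation param baseShift fiberShift
  cases B.orientation <;> simp [boxParam, torusProj_add, add_assoc]

theorem sub_baseShift_mem {ε ζ : ℂ} {R R' : ℝ} (hζ : ζ ∈ ball (0 : ℂ) R) (hε : ‖ε‖ ≤ R' - R) :
    ζ - B.baseShift ε ∈ ball (0 : ℂ) R' := by
  rw [mem_ball_zero_iff] at *
  have := norm_sub_le ζ (B.baseShift ε)
  have := norm_baseShift_le (B := B) ε
  linarith

theorem exists_forall_graph_near {α₀ ζ₀ : ℂ} {e : ℝ} (hα₀ : α₀ ∈ B.A)
    (hζ₀ : ζ₀ ∈ ball (0 : ℂ) B.r) (he : 0 < e) :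
    ∃ δ > 0, ∀ α ∈ B.A, dist α α₀ < δ → ∀ ζ ∈ ball ζ₀ δ,
      dist (B.graph α ζ) (B.graph α₀ ζ₀) < e ∧
      dist (deriv (B.graph α) ζ) (deriv (B.graph α₀) ζ₀) < e := by
  have h := (tendsto_graph_deriv hα₀ hζ₀).eventually
    ((eventually_of_mem (ball_mem_nhds _ he) fun _ h => h).prod_mk
      (eventually_of_mem (ball_mem_nhds _ he) fun _ h => h))
  obtain ⟨⟨δ, δ'⟩, ⟨h1, h2⟩, h3⟩ :=
    ((Metric.nhdsWithin_basis_ball (s := B.A)).prod Metric.nhds_basis_ball).eventually_iff.1 h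
  refine ⟨min δ δ', lt_min h1 h2, fun α hα hαδ ζ hζ => ?_⟩
  exact h3 (x := (α, ζ)) ⟨⟨ball_subset_ball (min_le_left _ _) hαδ, hα⟩,
    ball_subset_ball (min_le_right _ _) hζ⟩

theorem norm_graph_sub_le {R R' : ℝ} (h : R < R') (h' : R' ≤ B.r) {α : ℂ} (hα : α ∈ B.A) :
    ∀ x ∈ ball (0 : ℂ) R, ∀ y ∈ ball (0 : ℂ) R,
      ‖B.graph α x - B.graph α y‖ ≤ B.s * (2 / (R' - R)) * ‖x - y‖ :=
  norm_sub_le_of_ball h ((differentiableOn_graph hα).mono (ball_subset_ball h'))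
    fun _ hz => norm_graph_le hα (ball_subset_ball h' hz)

theorem differentiableAt_gap {α β ε ζ : ℂ} (hα : α ∈ B.A) (hβ : β ∈ B.A)
    (hζ : ζ ∈ ball (0 : ℂ) B.r) (hζ' : ζ - B.baseShift ε ∈ ball (0 : ℂ) B.r) :
    DifferentiableAt ℂ (B.gap α β ε) ζ := by
  have h1 := differentiableAt_graph hα hζ
  have h2 : DifferentiableAt ℂ (fun z => B.graph β (z - B.baseShift ε)) ζ :=
    DifferentiableAt.comp ζ (f := fun z => z - B.baseShift ε)
      (differentiableAt_graph hβ hζ') (by fun_prop)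
  exact (h1.sub h2).sub_const _

theorem norm_gap_le {α β ε ζ : ℂ} (hα : α ∈ B.A) (hβ : β ∈ B.A)
    (hζ : ζ ∈ ball (0 : ℂ) B.r) (hζ' : ζ - B.baseShift ε ∈ ball (0 : ℂ) B.r) :
    ‖B.gap α β ε ζ‖ ≤ 2 * B.s + ‖ε‖ := by
  have h1 := norm_graph_le hα hζ
  have h2 := norm_graph_le hβ hζ'
  have h3 := norm_fiberShift_le (B := B) ε
  have h4 := norm_sub_le (B.graph α ζ - B.graph β (ζ - B.baseShift ε)) (B.fiberShift ε)
  have h5 := norm_sub_le (B.graph α ζ) (B.graph β (ζ - B.baseShift ε))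
  rw [gap]; linarith

/-- A family of admissible orders of smallness, decreasing in a broad sense. -/
structure IsGauge (G : ℕ → ℝ → ℝ) : Prop where
  mul_le : ∀ (C : ℝ) (k : ℕ), ∃ k', ∀ᶠ t in 𝓝[>] (0 : ℝ), C * G k' t ≤ G k t
  le_mul : ∀ c > 0, ∃ k, ∀ᶠ t in 𝓝[>] (0 : ℝ), G k t ≤ c * t

/-- The plaques `Γ_{α n}` and the translates of the plaques `Γ_{β n}` by `ε n` are close to each
other on a disk, to all orders of the gauge. -/
def CloseOn (B : FlowBox Λ) (G : ℕ → ℝ → ℝ) (α β ε : ℕ → ℂ) (ζ₀ : ℂ) (ρ : ℝ) : Prop :=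
  ∀ k, ∀ᶠ n in atTop, ∀ ζ ∈ ball ζ₀ ρ, ‖B.gap (α n) (β n) (ε n) ζ‖ ≤ G k ‖ε n‖

/-- There are sequences of plaques, converging to the plaque through a point, which are close
near this point to translates of each other. -/
def ClosePlaques (B : FlowBox Λ) (G : ℕ → ℝ → ℝ) (α₀ ζ₀ : ℂ) : Prop :=
  ∃ α β ε : ℕ → ℂ, (∀ n, α n ∈ B.A) ∧ (∀ n, β n ∈ B.A) ∧ (∀ n, ε n ≠ 0) ∧
    Tendsto α atTop (𝓝 α₀) ∧ Tendsto β atTop (𝓝 α₀) ∧ Tendsto ε atTop (𝓝 0) ∧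
    ∃ ρ > 0, B.CloseOn G α β ε ζ₀ ρ

theorem tendsto_norm_nhdsGT {ε : ℕ → ℂ} (h0 : ∀ n, ε n ≠ 0) (h : Tendsto ε atTop (𝓝 0)) :
    Tendsto (fun n => ‖ε n‖) atTop (𝓝[>] 0) := by
  refine tendsto_nhdsWithin_iff.2 ⟨by simpa using h.norm, Eventually.of_forall fun n => ?_⟩
  exact norm_pos_iff.2 (h0 n)

end FlowBox

/-! ### Independence of close plaques from the flow box -/

namespace Lamination

open Filter FlowBox

variable {Λ : Submodule ℤ ℂ} {L : Lamination Λ}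

/-- Plaques of a flow box are, near a point, contained in plaques of any other flow box. -/
theorem IsFlowBox.exists_transfer {B B' : FlowBox Λ} (hB : L.IsFlowBox B) (hB' : L.IsFlowBox B')
    {α₀ ζ₀ α₀' ζ₀' : ℂ} (hα₀ : α₀ ∈ B.A) (hζ₀ : ζ₀ ∈ ball (0 : ℂ) B.r) (hα₀' : α₀' ∈ B'.A)
    (hζ₀' : ζ₀' ∈ ball (0 : ℂ) B'.r) (h : B.pt α₀ ζ₀ = B'.pt α₀' ζ₀') {κ : ℝ} (hκ : 0 < κ) :
    ∃ δ > 0, ball ζ₀ δ ⊆ ball 0 B.r ∧ ∀ α ∈ B.A, dist α α₀ < δ → ∃ α' ∈ B'.A, dist α' α₀' < κ ∧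
      ∀ ζ ∈ ball ζ₀ δ, ∃ ζ' ∈ ball (0 : ℂ) B'.r, dist ζ' ζ₀' < κ ∧ B'.pt α' ζ' = B.pt α ζ := by
  have hV := hB'.1.eventually_eq_pt hα₀' hζ₀' hκ
  rw [← h] at hV
  obtain ⟨δ, hδ, hsub, hδV⟩ := exists_forall_pt_mem hα₀ hζ₀ hV
  refine ⟨δ, hδ, hsub, fun α hα hαδ => ?_⟩
  have hpt : ∀ ζ ∈ ball ζ₀ δ, ∃ α' ∈ B'.A, α' ∈ ball α₀' κ ∧
      ∃ ζ' ∈ ball (0 : ℂ) B'.r, ζ' ∈ ball ζ₀' κ ∧ B'.pt α' ζ' = B.pt α ζ := fun ζ hζ =>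
    hδV α hα hαδ ζ hζ (hB.pt_mem hα (hsub hζ))
  obtain ⟨α', hα', hα'κ, ξ, hξ, -, hξeq⟩ := hpt ζ₀ (mem_ball_self hδ)
  refine ⟨α', hα', hα'κ, fun ζ hζ => ?_⟩
  have huniq : ∀ x ∈ ball ζ₀ δ, ∀ β ∈ B'.A, ∀ β' ∈ B'.A, B.pt α x ∈ B'.plaque β →
      B.pt α x ∈ B'.plaque β' → β = β' := by
    rintro x hx β hβ β' hβ' ⟨y, hy, hyx⟩ ⟨y', hy', hyx'⟩
    exact (pt_inj hβ hβ' hy hy' (hyx.trans hyx'.symm)).1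
  -- The plaque of `B'` that contains `B.pt α x` is locally constant in `x`, by equality of the leaf
  -- germs, hence constant on the disk.
  have hconst := (convex_ball ζ₀ δ).isPreconnected.induction₂
    (fun x y => ∀ β ∈ B'.A, B.pt α x ∈ B'.plaque β ↔ B.pt α y ∈ B'.plaque β) ?_
    (fun x y z _ _ _ h1 h2 β hβ => (h1 β hβ).trans (h2 β hβ))
    (fun x y _ _ h1 β hβ => (h1 β hβ).symm) (mem_ball_self hδ) hζ
  · have h1 := (hconst α' hα').1 ⟨ξ, hξ, hξeq⟩
    obtain ⟨β, hβ, -, ζ', hζ', hζ'κ, heq⟩ := hpt ζ hζ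
    have h2 : β = α' := huniq ζ hζ β hβ α' hα' ⟨ζ', hζ', heq⟩ h1
    subst h2
    exact ⟨ζ', hζ', hζ'κ, heq⟩
  · intro x hx
    obtain ⟨β₀, hβ₀, -, y, hy, -, hyx⟩ := hpt x hx
    have h1 : B.pt α x ∈ B'.plaque β₀ := ⟨y, hy, hyx⟩
    have h2 := hB'.leafNhds_eq hβ₀ h1
    rw [hB.leafNhds_pt hα (hsub hx)] at h2
    have h3 : ∀ᶠ z in 𝓝 x, B.pt α z ∈ B'.plaque β₀ := by
      rw [← eventually_map (m := B.pt α), h2]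
      exact self_mem_nhdsWithin
    filter_upwards [nhdsWithin_le_nhds h3, self_mem_nhdsWithin] with z hz hzb β hβ
    constructor
    · intro h4
      rwa [huniq x hx β hβ β₀ hβ₀ h4 h1]
    · intro h4
      rwa [huniq z hzb β hβ β₀ hβ₀ h4 hz]

/-- The transfer of plaques as a map between the transversals. -/
theorem IsFlowBox.exists_transfer_map {B B' : FlowBox Λ} (hB : L.IsFlowBox B)
    (hB' : L.IsFlowBox B')
    {α₀ ζ₀ α₀' ζ₀' : ℂ} (hα₀ : α₀ ∈ B.A) (hζ₀ : ζ₀ ∈ ball (0 : ℂ) B.r) (hα₀' : α₀' ∈ B'.A)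
    (hζ₀' : ζ₀' ∈ ball (0 : ℂ) B'.r) (h : B.pt α₀ ζ₀ = B'.pt α₀' ζ₀') :
    ∃ T : ℂ → ℂ, (∀ α, T α ∈ B'.A) ∧ ∀ κ > 0,
      ∃ δ > 0, ball ζ₀ δ ⊆ ball 0 B.r ∧ ∀ α ∈ B.A, dist α α₀ < δ → dist (T α) α₀' < κ ∧
      ∀ ζ ∈ ball ζ₀ δ, ∃ ζ' ∈ ball (0 : ℂ) B'.r, dist ζ' ζ₀' < κ ∧ B'.pt (T α) ζ' = B.pt α ζ := by
  classical
  -- The value `α₀'` when no plaque is met is arbitrary within the transversal; it makes `T` total,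
  -- and only parameters near `α₀` matter.
  let T : ℂ → ℂ := fun α =>
    if h : ∃ α' ∈ B'.A, B.pt α ζ₀ ∈ B'.plaque α' then h.choose else α₀'
  have hT : ∀ α, ∀ α' ∈ B'.A, B.pt α ζ₀ ∈ B'.plaque α' → T α = α' := by
    intro α α' hα' hx
    have hex : ∃ α' ∈ B'.A, B.pt α ζ₀ ∈ B'.plaque α' := ⟨α', hα', hx⟩
    have hTe : T α = hex.choose := dif_pos hex
    obtain ⟨h1, y, hy, hyx⟩ := hex.choose_spec
    obtain ⟨y', hy', hyx'⟩ := hx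
    rw [hTe]
    exact (pt_inj h1 hα' hy hy' (hyx.trans hyx'.symm)).1
  refine ⟨T, fun α => ?_, fun κ hκ => ?_⟩
  · by_cases hex : ∃ α' ∈ B'.A, B.pt α ζ₀ ∈ B'.plaque α'
    · have hTe : T α = hex.choose := dif_pos hex
      rw [hTe]; exact hex.choose_spec.1
    · have hTe : T α = α₀' := dif_neg hex
      rwa [hTe]
  · obtain ⟨δ, hδ, hsub, hδT⟩ := hB.exists_transfer hB' hα₀ hζ₀ hα₀' hζ₀' h hκ
    refine ⟨δ, hδ, hsub, fun α hα hαδ => ?_⟩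
    obtain ⟨α', hα', hα'κ, h1⟩ := hδT α hα hαδ
    obtain ⟨y, hy, -, hyx⟩ := h1 ζ₀ (mem_ball_self hδ)
    rw [hT α α' hα' ⟨y, hy, hyx⟩]
    exact ⟨hα'κ, h1⟩

/-- The existence of close plaques near a point does not depend on the flow box. -/
theorem IsFlowBox.closePlaques_transfer [DiscreteTopology Λ] {G : ℕ → ℝ → ℝ} (hG : IsGauge G)
    {B B' : FlowBox Λ} (hB : L.IsFlowBox B) (hB' : L.IsFlowBox B')
    {α₀ ζ₀ α₀' ζ₀' : ℂ} (hα₀ : α₀ ∈ B.A) (hζ₀ : ζ₀ ∈ ball (0 : ℂ) B.r) (hα₀' : α₀' ∈ B'.A)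
    (hζ₀' : ζ₀' ∈ ball (0 : ℂ) B'.r) (h : B.pt α₀ ζ₀ = B'.pt α₀' ζ₀')
    (hc : B.ClosePlaques G α₀ ζ₀) : B'.ClosePlaques G α₀' ζ₀' := by
  obtain ⟨α, β, ε, hα, hβ, hε, hαt, hβt, hεt, ρ, hρ, hclose⟩ := hc
  obtain ⟨T, hTA, hT⟩ := hB.exists_transfer_map hB' hα₀ hζ₀ hα₀' hζ₀' h
  obtain ⟨T', hTA', hT'⟩ := hB'.exists_transfer_map hB hα₀' hζ₀' hα₀ hζ₀ h.symm
  have hτ := torusScale_pos Λ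
  have hTt : ∀ γ : ℕ → ℂ, (∀ n, γ n ∈ B.A) → Tendsto γ atTop (𝓝 α₀) →
      Tendsto (fun n => T (γ n)) atTop (𝓝 α₀') := by
    intro γ hγ hγt
    rw [Metric.tendsto_nhds]
    intro κ hκ
    obtain ⟨δ, hδ, -, h1⟩ := hT κ hκ
    filter_upwards [Metric.tendsto_nhds.1 hγt δ hδ] with n hn
    exact (h1 _ (hγ n) hn).1
  obtain ⟨R, hR1, hR⟩ := exists_between (mem_ball_zero_iff.1 hζ₀')
  obtain ⟨C, hC, hcoord⟩ := le_surfaceDist_boxParam Λ B'.orientation B'.chart B'.z₀ B'.w₀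
    (B'.r + B'.s + 1)
  obtain ⟨δ₀, hδ₀, hgraph⟩ := exists_forall_graph_near hα₀' hζ₀'
    (show 0 < torusScale Λ / 4 by positivity)
  set κ := min δ₀ (min (torusScale Λ / 4) ((R - ‖ζ₀'‖) / 2)) with hκdef
  have hκ : 0 < κ := lt_min hδ₀ (lt_min (by positivity) (by linarith))
  have hκ1 : κ ≤ δ₀ := min_le_left _ _
  have hκ2 : κ ≤ torusScale Λ / 4 := (min_le_right _ _).trans (min_le_left _ _)
  have hκ3 : κ ≤ (R - ‖ζ₀'‖) / 2 := (min_le_right _ _).trans (min_le_right _ _)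
  -- The radii are chosen backwards. Points near `ζ₀'` must return to points `ζ` where the gap is
  -- controlled, and `ζ` moved by the base shift must still be sent to `B'`; the half of `δ₁` leaves
  -- room for this shift.
  obtain ⟨δ₁, hδ₁, -, hT₁⟩ := hT κ hκ
  obtain ⟨δ₂, hδ₂, -, hT₂⟩ := hT' (min ρ (δ₁ / 2)) (lt_min hρ (by positivity))
  obtain ⟨δ₃, hδ₃, -, hT₃⟩ := hT δ₂ hδ₂
  refine ⟨fun n => T (α n), fun n => T (β n), ε, fun n => hTA _, fun n => hTA _, hε,
    hTt α hα hαt, hTt β hβ hβt, hεt, min δ₂ κ, lt_min hδ₂ hκ, fun k => ?_⟩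
  set Lip := B'.s * (2 / (B'.r - R)) with hLip
  have hLip0 : 0 ≤ Lip := by
    have := B'.s_pos
    have : 0 < B'.r - R := by linarith
    positivity
  obtain ⟨k', hk'⟩ := hG.mul_le (C * (1 + Lip)) k
  have hε1 : ∀ᶠ n in atTop, ‖ε n‖ < min (δ₁ / 2) (min κ 1) := by
    have := hεt.norm
    rw [norm_zero] at this
    exact this.eventually_lt_const (lt_min (by positivity) (lt_min hκ one_pos))
  filter_upwards [hclose k', tendsto_norm_nhdsGT hε hεt hk', hε1,
    Metric.tendsto_nhds.1 hαt δ₁ hδ₁, Metric.tendsto_nhds.1 hαt δ₃ hδ₃,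
    Metric.tendsto_nhds.1 hβt δ₁ hδ₁, Metric.tendsto_nhds.1 (hTt α hα hαt) δ₂ hδ₂,
    Metric.tendsto_nhds.1 (hTt α hα hαt) κ hκ, Metric.tendsto_nhds.1 (hTt β hβ hβt) κ hκ]
    with n hn1 hn2 hn3 hn4 hn5 hn6 hn7 hn8 hn9 ζ' hζ'
  have he1 : ‖ε n‖ < δ₁ / 2 := hn3.trans_le (min_le_left _ _)
  have he2 : ‖ε n‖ < κ := hn3.trans_le ((min_le_right _ _).trans (min_le_left _ _))
  have he3 : ‖ε n‖ < 1 := hn3.trans_le ((min_le_right _ _).trans (min_le_right _ _))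
  have hbs := norm_baseShift_le (B := B) (ε n)
  have hbs' := norm_baseShift_le (B := B') (ε n)
  have hfs' := norm_fiberShift_le (B := B') (ε n)
  have hζ'2 : ζ' ∈ ball ζ₀' δ₂ := ball_subset_ball (min_le_left _ _) hζ'
  have hζ'κ : dist ζ' ζ₀' < κ := ball_subset_ball (min_le_right _ _) hζ'
  -- the corresponding point of the first box
  have hTT : T' (T (α n)) = α n := by
    obtain ⟨ξ, hξ, hξd, hξe⟩ := (hT₃ _ (hα n) hn5).2 ζ₀ (mem_ball_self hδ₃)
    obtain ⟨y, hy, -, hye⟩ := (hT₂ _ (hTA _) hn7).2 ξ hξd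
    exact (pt_inj (hTA' _) (hα n) hy hζ₀ (hye.trans hξe)).1
  obtain ⟨ζ, hζ, hζd, hζe⟩ := (hT₂ _ (hTA _) hn7).2 ζ' hζ'2
  rw [hTT] at hζe
  have hζρ : ζ ∈ ball ζ₀ ρ := hζd.trans_le (min_le_left _ _)
  have hζδ : ζ - B.baseShift (ε n) ∈ ball ζ₀ δ₁ := by
    have h1 : dist ζ ζ₀ < δ₁ / 2 := hζd.trans_le (min_le_right _ _)
    rw [dist_eq_norm] at h1
    rw [Metric.mem_ball, dist_eq_norm, sub_right_comm]
    have := norm_sub_le (ζ - ζ₀) (B.baseShift (ε n))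
    linarith
  obtain ⟨ξ, hξ, hξd, hξe⟩ := (hT₁ _ (hβ n) hn6).2 _ hζδ
  have hgap := hn1 ζ hζρ
  -- the two points to be compared
  have hx : B'.param ζ' (B'.graph (T (α n)) ζ') = B.param ζ (B.graph (α n) ζ) := hζe.symm
  have hy : B'.param (ξ + B'.baseShift (ε n)) (B'.graph (T (β n)) ξ + B'.fiberShift (ε n)) =
      B.param ζ (B.graph (β n) (ζ - B.baseShift (ε n)) + B.fiberShift (ε n)) := by
    rw [← torusTranslation_param]
    change torusTranslation Λ (ε n) (B'.pt (T (β n)) ξ) = _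
    rw [hξe, pt, torusTranslation_param, sub_add_cancel]
  -- In the first box both points lie over the same base point `ζ`, so their distance is at most the
  -- gap there. In the second box their base points may differ, which the Lipschitz bound on the
  -- graph compensates below.
  have hdist : surfaceDist Λ (B'.param ζ' (B'.graph (T (α n)) ζ'))
      (B'.param (ξ + B'.baseShift (ε n)) (B'.graph (T (β n)) ξ + B'.fiberShift (ε n))) ≤
      ‖B.gap (α n) (β n) (ε n) ζ‖ := by
    rw [hx, hy]
    refine (surfaceDist_boxParam_le Λ _ _ _ _ _ _ _ _).trans (le_of_eq ?_)
    rw [sub_self, norm_zero, zero_add, gap]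
    congr 1; ring
  have hζ'r : ‖ζ'‖ < R := by
    have := norm_le_norm_add_norm_sub' ζ' ζ₀'
    rw [dist_eq_norm] at hζ'κ
    linarith
  have hg1 := (hgraph _ (hTA (α n)) (hn8.trans_le hκ1) ζ' (hζ'κ.trans_le hκ1)).1
  have hg2 := (hgraph _ (hTA (β n)) (hn9.trans_le hκ1) ξ (hξd.trans_le hκ1)).1
  have hζ'in : ζ' ∈ ball (0 : ℂ) B'.r := mem_ball_zero_iff.2 (hζ'r.trans hR)
  have hm1 := norm_graph_le (hTA (α n)) hζ'in
  have hm2 := norm_graph_le (hTA (β n)) hξ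
  have hrp := B'.r_pos
  have hsp := B'.s_pos
  have hξr := mem_ball_zero_iff.1 hξ
  have hkey := hcoord ζ' (B'.graph (T (α n)) ζ') (ξ + B'.baseShift (ε n))
    (B'.graph (T (β n)) ξ + B'.fiberShift (ε n)) (by linarith) (by linarith)
    ((norm_add_le _ _).trans (by linarith)) ((norm_add_le _ _).trans (by linarith))
    (by
      have h1 := dist_triangle_right ζ' ξ ζ₀'
      rw [dist_eq_norm ζ' ξ] at h1
      have h2 := norm_sub_le (ζ' - ξ) (B'.baseShift (ε n))
      rw [← sub_sub]; linarith)
    (by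
      have h1 := dist_triangle_right (B'.graph (T (α n)) ζ') (B'.graph (T (β n)) ξ)
        (B'.graph α₀' ζ₀')
      rw [dist_eq_norm (B'.graph (T (α n)) ζ')] at h1
      have h2 := norm_sub_le (B'.graph (T (α n)) ζ' - B'.graph (T (β n)) ξ) (B'.fiberShift (ε n))
      rw [← sub_sub]; linarith)
  have hkey2 := hkey.trans (mul_le_mul_of_nonneg_left hdist hC.le)
  have hlip := norm_graph_sub_le hR le_rfl (hTA (β n)) ξ (by
    rw [mem_ball_zero_iff]
    have := norm_le_norm_add_norm_sub' ξ ζ₀'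
    rw [dist_eq_norm] at hξd
    linarith) (ζ' - B'.baseShift (ε n)) (by
    rw [mem_ball_zero_iff]
    have := norm_le_norm_add_norm_sub' ζ' ζ₀'
    rw [dist_eq_norm] at hζ'κ
    have := norm_sub_le ζ' (B'.baseShift (ε n))
    linarith)
  rw [← hLip] at hlip
  have hswap : ‖ξ - (ζ' - B'.baseShift (ε n))‖ = ‖ζ' - (ξ + B'.baseShift (ε n))‖ := by
    rw [← norm_neg]; congr 1; ring
  rw [hswap] at hlip
  set a := ‖ζ' - (ξ + B'.baseShift (ε n))‖ with ha
  have htri : ‖B'.gap (T (α n)) (T (β n)) (ε n) ζ'‖ ≤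
      ‖B'.graph (T (α n)) ζ' - (B'.graph (T (β n)) ξ + B'.fiberShift (ε n))‖ +
      ‖B'.graph (T (β n)) ξ - B'.graph (T (β n)) (ζ' - B'.baseShift (ε n))‖ := by
    refine le_trans (le_of_eq ?_) (norm_add_le _ _)
    rw [gap]; congr 1; ring
  have ha0 : 0 ≤ a := norm_nonneg _
  set b := ‖B'.graph (T (α n)) ζ' - (B'.graph (T (β n)) ξ + B'.fiberShift (ε n))‖
  have hb0 : 0 ≤ b := norm_nonneg _
  calc ‖B'.gap (T (α n)) (T (β n)) (ε n) ζ'‖ ≤ b + Lip * a := htri.trans (by linarith)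
    _ ≤ (1 + Lip) * (a + b) := by nlinarith
    _ ≤ (1 + Lip) * (C * G k' ‖ε n‖) := by gcongr; exact hkey2.trans (by gcongr)
    _ = C * (1 + Lip) * G k' ‖ε n‖ := by ring
    _ ≤ G k ‖ε n‖ := hn2

end Lamination

/-! ### Propagation of closeness along plaques, and the obstruction at a tangency -/

namespace FlowBox

open Filter

variable {Λ : Submodule ℤ ℂ} {B : FlowBox Λ}

/-- The closeness of plaques spreads along the plaques. -/
def Propagates (B : FlowBox Λ) (G : ℕ → ℝ → ℝ) : Prop :=
  ∀ α β ε : ℕ → ℂ, (∀ n, α n ∈ B.A) → (∀ n, β n ∈ B.A) → (∀ n, ε n ≠ 0) →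
    Tendsto ε atTop (𝓝 0) → ∀ (ζ₀ : ℂ) (ρ R' R : ℝ), 0 < ρ → ρ < R' → R' < R → ‖ζ₀‖ + R < B.r →
    B.CloseOn G α β ε ζ₀ ρ → B.CloseOn G α β ε ζ₀ R'

theorem ball_subset_of_norm_add_le {ζ₀ : ℂ} {R r : ℝ} (h : ‖ζ₀‖ + R ≤ r) :
    ball ζ₀ R ⊆ ball (0 : ℂ) r := by
  refine ball_subset_ball' ?_
  rw [dist_zero_right]; linarith

theorem differentiableOn_gap {α β ε ζ₀ : ℂ} {R : ℝ} (hα : α ∈ B.A) (hβ : β ∈ B.A)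
    (h : ‖ζ₀‖ + R + ‖ε‖ ≤ B.r) : DifferentiableOn ℂ (B.gap α β ε) (ball ζ₀ R) := by
  intro ζ hζ
  have h1 : ζ ∈ ball (0 : ℂ) (‖ζ₀‖ + R) := ball_subset_of_norm_add_le le_rfl hζ
  exact (differentiableAt_gap hα hβ (ball_subset_ball (by linarith [norm_nonneg ε]) h1)
    (sub_baseShift_mem h1 (by linarith))).differentiableWithinAt

theorem norm_gap_le_of_mem {α β ε ζ₀ ζ : ℂ} {R : ℝ} (hα : α ∈ B.A) (hβ : β ∈ B.A)
    (h : ‖ζ₀‖ + R + ‖ε‖ ≤ B.r) (hζ : ζ ∈ ball ζ₀ R) : ‖B.gap α β ε ζ‖ ≤ 2 * B.s + ‖ε‖ := by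
  have h1 : ζ ∈ ball (0 : ℂ) (‖ζ₀‖ + R) := ball_subset_of_norm_add_le le_rfl hζ
  exact norm_gap_le hα hβ (ball_subset_ball (by linarith [norm_nonneg ε]) h1)
    (sub_baseShift_mem h1 (by linarith))

/-- The gauge of the flat functions. -/
def flatGauge (k : ℕ) (t : ℝ) : ℝ := t ^ k

theorem eventually_mul_le_one (C : ℝ) : ∀ᶠ t in 𝓝[>] (0 : ℝ), C * t ≤ 1 := by
  have h : Tendsto (fun t : ℝ => C * t) (𝓝 0) (𝓝 (C * 0)) := (continuous_const_mul C).tendsto 0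
  rw [mul_zero] at h
  exact nhdsWithin_le_nhds ((h.eventually_lt_const one_pos).mono fun _ h => h.le)

theorem isGauge_flatGauge : IsGauge flatGauge where
  mul_le C k := by
    refine ⟨k + 1, ?_⟩
    filter_upwards [eventually_mul_le_one C, self_mem_nhdsWithin] with t ht ht0
    have ht0 : 0 < t := ht0
    have := mul_le_mul_of_nonneg_right ht (pow_nonneg ht0.le k)
    rw [flatGauge, flatGauge, pow_succ]; linarith
  le_mul c hc := by
    refine ⟨2, ?_⟩
    filter_upwards [eventually_mul_le_one c⁻¹, self_mem_nhdsWithin] with t ht ht0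
    have ht0 : 0 < t := ht0
    rw [inv_mul_le_iff₀ hc, mul_one] at ht
    rw [flatGauge]; nlinarith

/-- Three circles with a fixed bound on the large disk turns `|ε|ᵏ'` into a constant times `|ε|` to
the power `k'θ`. A fixed loss in the exponent is harmless when all powers are available. -/
theorem propagates_flatGauge (B : FlowBox Λ) : B.Propagates flatGauge := by
  intro α β ε hα hβ hε hεt ζ₀ ρ R' R hρ hρR hR hRr hclose k
  obtain ⟨θ, ⟨hθ0, hθ1⟩, h3⟩ := exists_three_circles hρ hρR hR
  have hs := B.s_pos
  set M := 2 * B.s + 1 with hM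
  -- One power beyond `k` is kept to absorb the constant `M ^ (1 - θ)`.
  obtain ⟨k', hk'⟩ := exists_nat_gt ((k + 1) / θ)
  rw [div_lt_iff₀ hθ0] at hk'
  have hε0 := hεt.norm
  rw [norm_zero] at hε0
  filter_upwards [hclose k', hε0.eventually_lt_const (lt_min one_pos (sub_pos.2 hRr)),
    (tendsto_norm_nhdsGT hε hεt).eventually (eventually_mul_le_one (M ^ (1 - θ)))]
    with n hn1 hn2 hn3 ζ hζ
  have h1 : ‖ε n‖ < 1 := hn2.trans_le (min_le_left _ _)
  have h2 : ‖ζ₀‖ + R + ‖ε n‖ ≤ B.r := by linarith [hn2.trans_le (min_le_right _ _)]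
  have hpos : 0 < ‖ε n‖ := norm_pos_iff.2 (hε n)
  have key := h3 ζ₀ _ (‖ε n‖ ^ k') M (differentiableOn_gap (hα n) (hβ n) h2) (by positivity)
    ((pow_le_one₀ hpos.le h1.le).trans (by linarith))
    (fun z hz => (norm_gap_le_of_mem (hα n) (hβ n) h2 hz).trans (by linarith)) hn1 ζ hζ
  refine key.trans ?_
  rw [flatGauge, ← Real.rpow_natCast, ← Real.rpow_mul hpos.le]
  calc ‖ε n‖ ^ ((k' : ℝ) * θ) * M ^ (1 - θ) ≤ ‖ε n‖ ^ ((k : ℝ) + 1) * M ^ (1 - θ) := by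
        exact mul_le_mul_of_nonneg_right
          (Real.rpow_le_rpow_of_exponent_ge hpos h1.le hk'.le) (by positivity)
    _ = ‖ε n‖ ^ k * (M ^ (1 - θ) * ‖ε n‖) := by
        rw [Real.rpow_add hpos, Real.rpow_one, Real.rpow_natCast]; ring
    _ ≤ ‖ε n‖ ^ k * 1 := by gcongr
    _ = ‖ε n‖ ^ k := mul_one _

/-- The gauge of the functions that are negligible with respect to the identity. -/
noncomputable def linearGauge (k : ℕ) (t : ℝ) : ℝ := t / (k + 1)

theorem isGauge_linearGauge : IsGauge linearGauge where
  mul_le C k := by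
    obtain ⟨k', hk'⟩ := exists_nat_gt (|C| * (k + 1))
    refine ⟨k', ?_⟩
    filter_upwards [self_mem_nhdsWithin] with t ht
    have ht : 0 < t := ht
    rw [linearGauge, linearGauge, mul_div_assoc', div_le_div_iff₀ (by positivity) (by positivity)]
    have h1 := le_abs_self C
    have h2 : C * (k + 1) ≤ k' + 1 := by nlinarith [Nat.cast_nonneg (α := ℝ) k]
    nlinarith
  le_mul c hc := by
    obtain ⟨k, hk⟩ := exists_nat_gt c⁻¹
    refine ⟨k, ?_⟩
    filter_upwards [self_mem_nhdsWithin] with t ht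
    have ht : 0 < t := ht
    rw [linearGauge, div_le_iff₀ (by positivity)]
    have h1 : 1 ≤ c * (k + 1) := by
      have h2 := mul_le_mul_of_nonneg_left hk.le hc.le
      rw [mul_inv_cancel₀ hc.ne'] at h2
      linarith
    nlinarith

/-- In a bi-Lipschitz flow box, the gap is controlled on the whole box by its value at one point,
up to the size of the translation. -/
theorem IsBiLipschitz.exists_gap_le (hB : B.IsBiLipschitz) {R : ℝ} (hR : R < B.r) :
    ∃ C ≥ 1, ∃ t₀ > 0, ∀ α ∈ B.A, ∀ β ∈ B.A, ∀ ε : ℂ, ‖ε‖ < t₀ → ∀ ξ ∈ ball (0 : ℂ) R,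
      ‖B.gap α β ε ξ‖ ≤ ‖ε‖ → ∀ ζ ∈ ball (0 : ℂ) R, ‖B.gap α β ε ζ‖ ≤ C * ‖ε‖ := by
  obtain ⟨C, hC, h⟩ := hB
  obtain ⟨R', hR', hR'r⟩ := exists_between hR
  set l := B.s * (2 / (B.r - R')) with hl
  have hl0 : 0 ≤ l := by
    have := B.s_pos
    have : 0 < B.r - R' := by linarith
    positivity
  -- The translation changes `graph α - graph β` by `O(|ε|)` only, and the size of that difference
  -- is comparable to `‖α - β‖` at every base point. A bound at `ξ` therefore passes to `ζ` through
  -- `‖α - β‖`.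
  have hdiff : ∀ α ∈ B.A, ∀ β ∈ B.A, ∀ ε : ℂ, ‖ε‖ < R' - R → ∀ ζ ∈ ball (0 : ℂ) R,
      ‖B.gap α β ε ζ - (B.graph α ζ - B.graph β ζ)‖ ≤ (l + 1) * ‖ε‖ := by
    intro α hα β hβ ε hε ζ hζ
    have h1 := norm_graph_sub_le hR'r le_rfl hβ ζ (ball_subset_ball hR'.le hζ)
      (ζ - B.baseShift ε) (sub_baseShift_mem hζ hε.le)
    rw [sub_sub_cancel, ← hl] at h1
    have h2 := norm_baseShift_le (B := B) ε
    have h3 := norm_fiberShift_le (B := B) ε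
    have e : B.gap α β ε ζ - (B.graph α ζ - B.graph β ζ) =
      (B.graph β ζ - B.graph β (ζ - B.baseShift ε)) - B.fiberShift ε := by rw [gap]; ring
    rw [e]
    have h4 := mul_le_mul_of_nonneg_left h2 hl0
    exact (norm_sub_le _ _).trans (by linarith)
  refine ⟨C * C * (l + 2) + (l + 1), ?_, R' - R, sub_pos.2 hR', ?_⟩
  · have : 0 ≤ C * C * (l + 2) := by positivity
    linarith
  · intro α hα β hβ ε hε ξ hξ hξg ζ hζ
    have hsub : ball (0 : ℂ) R ⊆ ball 0 B.r := ball_subset_ball hR.le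
    have h1 := hdiff α hα β hβ ε hε ξ hξ
    have h2 := hdiff α hα β hβ ε hε ζ hζ
    have h3 := (h α hα β hβ ξ (hsub hξ)).1
    have h4 := (h α hα β hβ ζ (hsub hζ)).2
    change ‖α - β‖ / C ≤ ‖B.graph α ξ - B.graph β ξ‖ at h3
    change ‖B.graph α ζ - B.graph β ζ‖ ≤ _ at h4
    have h5 := norm_le_norm_add_norm_sub (B.gap α β ε ξ) (B.graph α ξ - B.graph β ξ)
    have h6 := norm_le_norm_add_norm_sub' (B.gap α β ε ζ) (B.graph α ζ - B.graph β ζ)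
    rw [div_le_iff₀ hC] at h3
    have h7 : ‖α - β‖ ≤ ((l + 2) * ‖ε‖) * C := h3.trans (by gcongr; linarith)
    have h8 := mul_le_mul_of_nonneg_left h7 hC.le
    linarith

/-- A fixed bound on the large disk would lose the order `|ε|` under interpolation. The bi-Lipschitz
property provides the bound `C|ε|` there, and interpolating it with `o(|ε|)` gives `o(|ε|)` again.
-/
theorem IsBiLipschitz.propagates_linearGauge (hB : B.IsBiLipschitz) :
    B.Propagates linearGauge := by
  intro α β ε hα hβ hε hεt ζ₀ ρ R' R hρ hρR hR hRr hclose k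
  obtain ⟨θ, ⟨hθ0, hθ1⟩, h3⟩ := exists_three_circles hρ hρR hR
  obtain ⟨C, hC, t₀, ht₀, hgap⟩ := hB.exists_gap_le hRr
  have hsub : ball ζ₀ R ⊆ ball (0 : ℂ) (‖ζ₀‖ + R) := ball_subset_of_norm_add_le le_rfl
  have hlim : Tendsto (fun k' : ℕ => (1 / ((k' : ℝ) + 1)) ^ θ * C ^ (1 - θ)) atTop (𝓝 0) := by
    have h1 := (tendsto_one_div_add_atTop_nhds_zero_nat (𝕜 := ℝ)).rpow_const (p := θ)
      (Or.inr hθ0.le)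
    rw [Real.zero_rpow hθ0.ne'] at h1
    simpa using h1.mul_const (C ^ (1 - θ))
  obtain ⟨k', hk'⟩ := (hlim.eventually_lt_const
    (show (0 : ℝ) < 1 / ((k : ℝ) + 1) by positivity)).exists
  have hε0 := hεt.norm
  rw [norm_zero] at hε0
  filter_upwards [hclose k', hclose 0,
    hε0.eventually_lt_const (lt_min ht₀ (sub_pos.2 hRr))] with n hn1 hn0 hn2 ζ hζ
  have h1 : ‖ε n‖ < t₀ := hn2.trans_le (min_le_left _ _)
  have h2 : ‖ζ₀‖ + R + ‖ε n‖ ≤ B.r := by linarith [hn2.trans_le (min_le_right _ _)]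
  have hpos : 0 < ‖ε n‖ := norm_pos_iff.2 (hε n)
  have h0 := hn0 ζ₀ (mem_ball_self hρ)
  simp only [linearGauge, Nat.cast_zero, zero_add, div_one] at h0
  have hb := hgap _ (hα n) _ (hβ n) _ h1 ζ₀ (hsub (mem_ball_self (by linarith))) h0
  have hk1 : (1 : ℝ) / (k' + 1) ≤ 1 := by
    rw [div_le_one (by positivity)]; linarith [Nat.cast_nonneg (α := ℝ) k']
  have key := h3 ζ₀ _ (‖ε n‖ / (k' + 1)) (C * ‖ε n‖) (differentiableOn_gap (hα n) (hβ n) h2)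
    (by positivity) (by rw [div_eq_mul_one_div, mul_comm]; gcongr; linarith)
    (fun z hz => hb z (hsub hz)) hn1 ζ hζ
  refine key.trans ?_
  have hC0 : 0 < C := by linarith
  have e : (‖ε n‖ / (k' + 1)) ^ θ * (C * ‖ε n‖) ^ (1 - θ) =
      ‖ε n‖ * ((1 / ((k' : ℝ) + 1)) ^ θ * C ^ (1 - θ)) := by
    rw [div_eq_mul_one_div, Real.mul_rpow hpos.le (by positivity),
      Real.mul_rpow hC0.le hpos.le]
    have : ‖ε n‖ ^ θ * ‖ε n‖ ^ (1 - θ) = ‖ε n‖ := by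
      rw [← Real.rpow_add hpos]; simp
    linear_combination ((1 / ((k' : ℝ) + 1)) ^ θ * C ^ (1 - θ)) * this
  rw [e, linearGauge, div_eq_mul_one_div ‖ε n‖]
  exact mul_le_mul_of_nonneg_left hk'.le hpos.le

theorem Propagates.closePlaques {G : ℕ → ℝ → ℝ} (hB : B.Propagates G) {α₀ ζ₁ ζ₂ : ℂ} {d : ℝ}
    (hd : dist ζ₂ ζ₁ < d) (h : ‖ζ₁‖ + 3 * d < B.r) (hc : B.ClosePlaques G α₀ ζ₁) :
    B.ClosePlaques G α₀ ζ₂ := by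
  obtain ⟨α, β, ε, hα, hβ, hε, hαt, hβt, hεt, ρ, hρ, hclose⟩ := hc
  have hd0 : 0 < d := dist_nonneg.trans_lt hd
  have hclose' : B.CloseOn G α β ε ζ₁ (min ρ d) := fun k =>
    (hclose k).mono fun n hn ζ hζ => hn ζ (ball_subset_ball (min_le_left _ _) hζ)
  have := hB α β ε hα hβ hε hεt ζ₁ (min ρ d) (2 * d) (3 * d) (lt_min hρ hd0)
    ((min_le_right _ _).trans_lt (by linarith)) (by linarith) h hclose'
  refine ⟨α, β, ε, hα, hβ, hε, hαt, hβt, hεt, d, hd0, fun k => ?_⟩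
  exact (this k).mono fun n hn ζ hζ => hn ζ (ball_subset_ball' (by linarith) hζ)

/-- There are no close plaques near a tangency with the direction of the translations. -/
theorem Propagates.exists_not_closePlaques {G : ℕ → ℝ → ℝ} (hG : IsGauge G) (hB : B.Propagates G)
    (ho : B.orientation = .horizontal) {α₀ ζ₀ : ℂ} (hα₀ : α₀ ∈ B.A) (hζ₀ : ζ₀ ∈ ball (0 : ℂ) B.r)
    (hd0 : deriv (B.graph α₀) ζ₀ = 0) (hd1 : ∀ᶠ ξ in 𝓝[≠] ζ₀, deriv (B.graph α₀) ξ ≠ 0) :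
    ∃ δ > 0, ∀ α ∈ B.A, dist α α₀ < δ → ∀ ζ ∈ ball ζ₀ δ, ¬ B.ClosePlaques G α ζ := by
  have hbs : ∀ ε, B.baseShift ε = ε := fun ε => by simp [baseShift, ho]
  have hfs : ∀ ε, B.fiberShift ε = 0 := fun ε => by simp [fiberShift, ho]
  have hr0 := mem_ball_zero_iff.1 hζ₀
  -- a circle without critical points
  obtain ⟨d, hd, hdsub⟩ := Metric.mem_nhdsWithin_iff.1 hd1
  -- The bound by `d / 2` keeps other critical points off the closed disk; the second bound leaves
  -- room in the box for the larger disks used in the estimates.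
  set ρ := min (d / 2) ((B.r - ‖ζ₀‖) / 8) with hρdef
  have hρ : 0 < ρ := lt_min (by positivity) (by linarith)
  have hρd : ρ < d := (min_le_left _ _).trans_lt (by linarith)
  have hρr : ‖ζ₀‖ + 8 * ρ ≤ B.r := by
    have : ρ ≤ (B.r - ‖ζ₀‖) / 8 := min_le_right _ _
    linarith
  have hball : ball ζ₀ (8 * ρ) ⊆ ball (0 : ℂ) B.r := ball_subset_of_norm_add_le hρr
  have hcont : ContinuousOn (fun ζ => ‖deriv (B.graph α₀) ζ‖) (sphere ζ₀ ρ) := by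
    refine ((differentiableOn_deriv_graph hα₀).continuousOn.mono ?_).norm
    exact (sphere_subset_closedBall.trans (closedBall_subset_ball (by linarith))).trans hball
  obtain ⟨x₀, hx₀, hmin⟩ := (isCompact_sphere ζ₀ ρ).exists_isMinOn
    (NormedSpace.sphere_nonempty.2 hρ.le) hcont
  set c := ‖deriv (B.graph α₀) x₀‖ with hc
  have hc0 : 0 < c := by
    refine norm_pos_iff.2 (hdsub ⟨?_, ?_⟩)
    · rw [Metric.mem_ball]; rw [mem_sphere] at hx₀; linarith
    · intro h0
      rw [mem_sphere, mem_singleton_iff.1 h0, dist_self] at hx₀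
      linarith
  -- uniform closeness of the graphs
  obtain ⟨R₁, hR₁, hR₁r⟩ : ∃ R₁, R₁ = ‖ζ₀‖ + 4 * ρ ∧ R₁ < B.r := ⟨_, rfl, by linarith⟩
  -- The error budget has three shares of `c|ε|/20`: the variation of the derivative with the
  -- plaque, the Taylor remainder and the gap. In total the difference of the graphs is at least
  -- `17c|ε|/20` on the circle and at most `3c|ε|/20` at the centre.
  obtain ⟨δ₁, hδ₁, hunif⟩ := exists_forall_norm_graph_sub_lt hα₀ hR₁r
    (show 0 < c / 20 * ρ by positivity)
  have hderiv : ∀ α ∈ B.A, dist α α₀ < δ₁ → ∀ ζ ∈ ball ζ₀ (2 * ρ),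
      ‖deriv (B.graph α) ζ - deriv (B.graph α₀) ζ‖ ≤ c / 20 := by
    intro α hα hαδ ζ hζ
    have hζ' : ζ ∈ ball (0 : ℂ) B.r := hball (ball_subset_ball (by linarith) hζ)
    have := norm_deriv_le_of_ball (g := fun ζ => B.graph α ζ - B.graph α₀ ζ) (c := ζ₀)
      (R := 4 * ρ) (R' := 2 * ρ) (M := c / 20 * ρ) (by linarith)
      (((differentiableOn_graph hα).sub (differentiableOn_graph hα₀)).mono
        ((ball_subset_ball (by linarith)).trans hball))
      (fun z hz => (hunif α hα hαδ z (ball_subset_closedBall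
        (ball_subset_of_norm_add_le hR₁.ge hz))).le) ζ hζ
    rw [deriv_fun_sub (differentiableAt_graph hα hζ') (differentiableAt_graph hα₀ hζ')] at this
    refine this.trans (le_of_eq ?_)
    field_simp; norm_num
  set K := B.s * (4 / (4 * ρ - 2 * ρ)) ^ 2 with hK
  have htaylor : ∀ β ∈ B.A, ∀ ε : ℂ, ‖ε‖ < ρ → ∀ ζ ∈ closedBall ζ₀ ρ,
      ‖B.graph β ζ - B.graph β (ζ - ε) - deriv (B.graph β) ζ * ε‖ ≤ K * ‖ε‖ ^ 2 := by
    intro β hβ ε hε ζ hζ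
    rw [mem_closedBall, dist_eq_norm] at hζ
    have := norm_sub_sub_deriv_mul_le (c := ζ₀) (R := 4 * ρ) (R' := 2 * ρ) (by linarith)
      ((differentiableOn_graph hβ).mono ((ball_subset_ball (by linarith)).trans hball))
      (fun z hz => norm_graph_le hβ (hball (ball_subset_ball (by linarith) hz)))
      ζ (by rw [Metric.mem_ball, dist_eq_norm]; linarith) (ζ - ε) (by
        rw [Metric.mem_ball, dist_eq_norm, sub_right_comm]
        have := norm_sub_le (ζ - ζ₀) ε
        linarith)
    rwa [sub_sub_cancel] at this
  refine ⟨min δ₁ ρ, lt_min hδ₁ hρ, fun α' hα' hα'δ ζ' hζ' hclose => ?_⟩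
  have hζ'ρ : dist ζ' ζ₀ < ρ := ball_subset_ball (min_le_right _ _) hζ'
  have hζ'n : ‖ζ'‖ ≤ ‖ζ₀‖ + ρ := by
    have := norm_le_norm_add_norm_sub' ζ' ζ₀
    rw [dist_eq_norm] at hζ'ρ
    linarith
  obtain ⟨α, β, ε, hα, hβ, hε, hαt, hβt, hεt, ρ', hρ', hcl⟩ := hclose
  -- The given closeness holds on a disk of unknown size around `ζ'`; propagation extends it to a
  -- disk that covers the closed disk of radius `ρ` around `ζ₀`.
  have hcl' : B.CloseOn G α β ε ζ' (3 * ρ) := by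
    refine hB α β ε hα hβ hε hεt ζ' (min ρ' ρ) (3 * ρ) (4 * ρ) (lt_min hρ' hρ)
      ((min_le_right _ _).trans_lt (by linarith)) (by linarith) (by linarith) fun k =>
      (hcl k).mono fun n hn ζ hζ => hn ζ (ball_subset_ball (min_le_left _ _) hζ)
  obtain ⟨k, hk⟩ := hG.le_mul (c / 20) (by positivity)
  have hε0 := hεt.norm
  rw [norm_zero] at hε0
  have hKε : ∀ᶠ n in atTop, K * ‖ε n‖ ≤ c / 20 := by
    have h1 := hε0.const_mul K
    rw [mul_zero] at h1
    exact (h1.eventually_lt_const (show 0 < c / 20 by positivity)).mono fun _ h => h.le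
  have hβδ : ∀ᶠ n in atTop, dist (β n) α₀ < δ₁ := by
    have h1 : dist α' α₀ < δ₁ := hα'δ.trans_le (min_le_left _ _)
    exact (hβt.dist tendsto_const_nhds).eventually_lt_const h1
  obtain ⟨n, hn1, hn2, hn3, hn4, hn5⟩ := ((hcl' k).and (((tendsto_norm_nhdsGT hε hεt).eventually hk).and
    (hKε.and (hβδ.and (hε0.eventually_lt_const hρ))))).exists
  have hn2 : G k ‖ε n‖ ≤ c / 20 * ‖ε n‖ := hn2
  have hpos : 0 < ‖ε n‖ := norm_pos_iff.2 (hε n)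
  have hgap : ∀ ζ ∈ closedBall ζ₀ ρ, ‖B.gap (α n) (β n) (ε n) ζ‖ ≤ c / 20 * ‖ε n‖ := fun ζ hζ =>
    (hn1 ζ (closedBall_subset_ball' (by rw [dist_comm]; linarith) hζ)).trans hn2
  have hgapeq : ∀ ζ, B.graph (α n) ζ - B.graph (β n) ζ = B.gap (α n) (β n) (ε n) ζ -
      (B.graph (β n) ζ - B.graph (β n) (ζ - ε n)) := fun ζ => by
    rw [gap, hbs, hfs]; ring
  have htay : ∀ ζ ∈ closedBall ζ₀ ρ,
      ‖B.graph (β n) ζ - B.graph (β n) (ζ - ε n) - deriv (B.graph α₀) ζ * ε n‖ ≤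
        c / 10 * ‖ε n‖ := by
    intro ζ hζ
    have h1 := htaylor (β n) (hβ n) (ε n) hn5 ζ hζ
    have h2 := hderiv (β n) (hβ n) hn4 ζ (closedBall_subset_ball (by linarith) hζ)
    have e : B.graph (β n) ζ - B.graph (β n) (ζ - ε n) - deriv (B.graph α₀) ζ * ε n =
      (B.graph (β n) ζ - B.graph (β n) (ζ - ε n) - deriv (B.graph (β n)) ζ * ε n) +
        (deriv (B.graph (β n)) ζ - deriv (B.graph α₀) ζ) * ε n := by ring
    rw [e]
    refine (norm_add_le _ _).trans ?_
    rw [norm_mul]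
    have h3 := mul_le_mul_of_nonneg_right h2 hpos.le
    have h4 := mul_le_mul_of_nonneg_right hn3 hpos.le
    rw [mul_assoc, ← sq] at h4
    linarith
  -- lower bound on the circle, upper bound at the centre
  have hsphere : ∀ ζ ∈ sphere ζ₀ ρ, 17 / 20 * c * ‖ε n‖ ≤ ‖B.graph (α n) ζ - B.graph (β n) ζ‖ := by
    intro ζ hζ
    have hζc := sphere_subset_closedBall hζ
    have h1 : c * ‖ε n‖ ≤ ‖deriv (B.graph α₀) ζ * ε n‖ := by
      rw [norm_mul]; gcongr; exact hmin hζ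
    have h2 := htay ζ hζc
    have h3 := hgap ζ hζc
    rw [hgapeq, norm_sub_rev]
    have h4 := norm_sub_norm_le (B.graph (β n) ζ - B.graph (β n) (ζ - ε n))
      (B.gap (α n) (β n) (ε n) ζ)
    have h5 := norm_le_norm_add_norm_sub (B.graph (β n) ζ - B.graph (β n) (ζ - ε n))
      (deriv (B.graph α₀) ζ * ε n)
    linarith
  have hcenter : ‖B.graph (α n) ζ₀ - B.graph (β n) ζ₀‖ ≤ 3 / 20 * c * ‖ε n‖ := by
    have h2 := htay ζ₀ (mem_closedBall_self hρ.le)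
    have h3 := hgap ζ₀ (mem_closedBall_self hρ.le)
    rw [hd0, zero_mul, sub_zero] at h2
    rw [hgapeq]
    exact (norm_sub_le _ _).trans (by linarith)
  have hne : α n ≠ β n := by
    intro heq
    have := hsphere x₀ hx₀
    rw [heq, sub_self, norm_zero] at this
    have : 0 < 17 / 20 * c * ‖ε n‖ := by positivity
    linarith
  have hcb : closedBall ζ₀ ρ ⊆ ball (0 : ℂ) B.r :=
    (closedBall_subset_ball (by linarith)).trans hball
  -- Disjointness of the two distinct plaques enters here: their difference has no zeros, so its
  -- lower bound on the circle persists at the centre.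
  have hle := le_norm_center_of_forall_sphere (g := fun ζ => B.graph (α n) ζ - B.graph (β n) ζ) hρ
    (by positivity) (fun z hz => (differentiableAt_graph (hα n) (hcb hz)).sub
      (differentiableAt_graph (hβ n) (hcb hz)))
    (fun z hz h0 => hne (graph_inj (hα n) (hβ n) (hcb hz) (sub_eq_zero.1 h0))) hsphere
  have : 0 < c * ‖ε n‖ := by positivity
  linarith

end FlowBox

/-! ### Nonexistence of close plaques -/

namespace Lamination

open Filter FlowBox

variable {Λ : Submodule ℤ ℂ} {L : Lamination Λ}

/-- In a lamination without compact leaves and with a unique minimal set there are no close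
plaques. -/
theorem not_closePlaques [DiscreteTopology Λ] [IsZLattice ℝ Λ] (hleaf : L.NoCompactLeaf)
    (hmin : ∃! Y : Set (Surface Λ), L.IsMinimalSet Y) {G : ℕ → ℝ → ℝ} (hG : IsGauge G)
    (hcov : ∀ p ∈ L.carrier, ∃ B, L.IsFlowBox B ∧ B.Propagates G ∧ p ∈ B.support)
    {B : FlowBox Λ} (hB : L.IsFlowBox B) {α ζ : ℂ} (hα : α ∈ B.A) (hζ : ζ ∈ ball (0 : ℂ) B.r) :
    ¬ B.ClosePlaques G α ζ := by
  let Bad : Surface Λ → Prop := fun p => ∃ B, L.IsFlowBox B ∧ ∃ α ∈ B.A,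
    ∃ ζ ∈ ball (0 : ℂ) B.r, B.pt α ζ = p ∧ B.ClosePlaques G α ζ
  have hbad : ∀ B, L.IsFlowBox B → ∀ α ∈ B.A, ∀ ζ ∈ ball (0 : ℂ) B.r,
      Bad (B.pt α ζ) ↔ B.ClosePlaques G α ζ := by
    intro B hB α hα ζ hζ
    constructor
    · rintro ⟨B', hB', α', hα', ζ', hζ', heq, hc⟩
      exact hB'.closePlaques_transfer hG hB hα' hζ' hα hζ heq hc
    · exact fun hc => ⟨B, hB, α, hα, ζ, hζ, rfl, hc⟩
  -- Badness is intrinsic by `hbad`, so it can be tested in a box where closeness propagates;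
  -- propagation in both directions makes it locally constant along leaves.
  have hloc : ∀ x ∈ L.carrier, ∀ᶠ y in L.leafNhds x, (Bad y ↔ Bad x) := by
    intro x hx
    obtain ⟨B, hB, hBG, hxB⟩ := hcov x hx
    obtain ⟨α, hα, ζ, hζ, rfl⟩ := mem_support.1 hxB
    rw [hB.leafNhds_pt hα hζ, eventually_map]
    have hζr := mem_ball_zero_iff.1 hζ
    set d := (B.r - ‖ζ‖) / 8 with hd
    have hd0 : 0 < d := by linarith
    filter_upwards [ball_mem_nhds ζ hd0] with ξ hξ
    have hξd : dist ξ ζ < d := hξ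
    have hξn : ‖ξ‖ ≤ ‖ζ‖ + d := by
      have := norm_le_norm_add_norm_sub' ξ ζ
      rw [dist_eq_norm] at hξd
      linarith
    have hξr : ξ ∈ ball (0 : ℂ) B.r := mem_ball_zero_iff.2 (by linarith)
    rw [hbad B hB α hα ξ hξr, hbad B hB α hα ζ hζ]
    exact ⟨hBG.closePlaques (by rwa [dist_comm]) (by linarith),
      hBG.closePlaques hξd (by linarith)⟩
  intro hc
  obtain ⟨Y, hY⟩ := hmin.exists
  obtain ⟨q, hqY, hq⟩ : ∃ q ∈ Y, ∀ σ, ¬ L.IsSlope q σ := by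
    by_contra! hcon
    obtain ⟨p, hp, hpc⟩ := hY.1.exists_isCompact_leaf hcon
    exact hleaf p hp hpc
  obtain ⟨B₁, hB₁, hB₁G, hqB⟩ := hcov q (hY.1.2.2.1 hqY)
  obtain ⟨α₁, hα₁, ζ₁, hζ₁, rfl⟩ := mem_support.1 hqB
  obtain ⟨ho, hd0, hd1⟩ := hB₁.tangency hleaf hα₁ hζ₁ hq
  obtain ⟨δ, hδ, hno⟩ := hB₁G.exists_not_closePlaques hG ho hα₁ hζ₁ hd0 hd1
  have hp := hB.pt_mem hα hζ
  -- The leaf of the supposed bad point comes arbitrarily close to the tangency and is bad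
  -- everywhere.
  obtain ⟨y, hy, hyl⟩ := mem_closure_iff_nhds.1 (subset_closure_leaf hmin hY hp hqY) _
    (hB₁.1.eventually_eq_pt hα₁ hζ₁ hδ)
  obtain ⟨β, hβ, hβδ, ξ, hξ, hξδ, rfl⟩ := hy (leaf_subset hp hyl)
  have hbady := (iff_of_mem_leaf hloc hyl).1 ((hbad B hB α hα ζ hζ).2 hc)
  exact hno β hβ hβδ ξ hξδ ((hbad B₁ hB₁ β hβ ξ hξ).1 hbady)

end Lamination

/-! ### Shrinking a flow box -/

namespace Lamination

open Filter FlowBox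

variable {Λ : Submodule ℤ ℂ} {L : Lamination Λ}

/-- A small flow box around a given point of a flow box. -/
theorem IsFlowBox.exists_subBox {B : FlowBox Λ} (hB : L.IsFlowBox B) {α₀ ζ₀ : ℂ} {ρ σ δ : ℝ}
    (hα₀ : α₀ ∈ B.A) (hρ : 0 < ρ) (hσ : 0 < σ) (hδ : 0 < δ) (hρr : ball ζ₀ ρ ⊆ ball 0 B.r)
    (hσs : ball (B.graph α₀ ζ₀) σ ⊆ ball 0 B.s)
    (hgraph : ∀ α ∈ B.A, dist α α₀ < δ → ∀ ζ ∈ ball ζ₀ ρ, B.graph α ζ ∈ ball (B.graph α₀ ζ₀) σ) :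
    ∃ B' : FlowBox Λ, L.IsFlowBox B' ∧
      (∀ᶠ x in 𝓝 (B.pt α₀ ζ₀), x ∈ L.carrier → x ∈ B'.support) ∧
      ∀ α' ∈ B'.A, ∃ α ∈ B.A, dist α α₀ < δ ∧ B'.plaque α' = B.pt α '' ball ζ₀ ρ := by
  have hζ₀ : ζ₀ ∈ ball (0 : ℂ) B.r := hρr (mem_ball_self hρ)
  set η₀ := B.graph α₀ ζ₀ with hη₀
  -- Plaques are relabelled by their height over the new centre, as the normalization `f_α(0) = 0`
  -- requires; `sel` recovers the old label.
  let A' : Set ℂ := {α' | ∃ α ∈ B.A, dist α α₀ < δ ∧ B.graph α ζ₀ - η₀ = α'}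
  have hA' : ∀ α' ∈ A', ∃ α ∈ B.A, dist α α₀ < δ ∧ B.graph α ζ₀ - η₀ = α' := fun _ h => h
  choose! sel hsel hselδ hseleq using hA'
  have hadd : ∀ ζ : ℂ, ζ ∈ ball (0 : ℂ) ρ → ζ₀ + ζ ∈ ball ζ₀ ρ := fun ζ hζ => by simpa using hζ
  have hpar : ∀ ζ η, boxParam Λ B.orientation B.chart (torusCoord B.orientation B.z₀ ζ₀ η₀)
      (projCoord B.orientation B.w₀ ζ₀ η₀) ζ η = B.param (ζ₀ + ζ) (η₀ + η) := by
    intro ζ η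
    unfold param torusCoord projCoord
    cases B.orientation <;> simp [boxParam, add_assoc]
  have hpt : ∀ α' ζ, boxParam Λ B.orientation B.chart (torusCoord B.orientation B.z₀ ζ₀ η₀)
      (projCoord B.orientation B.w₀ ζ₀ η₀) ζ (α' + (B.graph (sel α') (ζ₀ + ζ) - η₀ - α')) =
      B.pt (sel α') (ζ₀ + ζ) := by
    intro α' ζ
    rw [hpar, pt]; congr 1; ring
  -- The relabelling is a homeomorphism onto its image because evaluation of the graphs over `ζ₀`
  -- embeds the transversal.
  have hselemb : IsEmbedding fun α' : A' => (⟨sel α', hsel α' α'.2⟩ : B.A) := by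
    have h1 : IsEmbedding fun α : B.A => B.graph α ζ₀ - η₀ :=
      (Homeomorph.subRight η₀).isEmbedding.comp (isEmbedding_graph_at hζ₀)
    have h2 : (fun α : B.A => B.graph α ζ₀ - η₀) ∘
        (fun α' : A' => (⟨sel α', hsel α' α'.2⟩ : B.A)) = Subtype.val := by
      funext α'
      exact hseleq α' α'.2
    have h3 : Continuous fun α' : A' => (⟨sel α', hsel α' α'.2⟩ : B.A) := by
      rw [h1.continuous_iff, h2]
      exact continuous_subtype_val
    refine IsEmbedding.of_comp h3 h1.continuous ?_
    rw [h2]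
    exact IsEmbedding.subtypeVal
  have hshift : IsEmbedding fun ζ : ball (0 : ℂ) ρ =>
      (⟨ζ₀ + ζ, hρr (hadd ζ ζ.2)⟩ : ball (0 : ℂ) B.r) := by
    refine IsEmbedding.of_comp (by fun_prop) continuous_subtype_val ?_
    exact (Homeomorph.addLeft ζ₀).isEmbedding.comp IsEmbedding.subtypeVal
  let B' : FlowBox Λ :=
    { orientation := B.orientation
      chart := B.chart
      z₀ := torusCoord B.orientation B.z₀ ζ₀ η₀
      w₀ := projCoord B.orientation B.w₀ ζ₀ η₀
      r := ρ
      s := σ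
      r_pos := hρ
      s_pos := hσ
      injOn := by
        refine B.injOn.mono ?_
        intro z hz
        have h1 : ∀ (a : ℂ) (R : ℝ), ball (B.z₀ + a) R = (fun x => x - B.z₀) ⁻¹' ball a R := by
          intro a R; ext x
          simp only [Metric.mem_ball, mem_preimage, dist_eq_norm]
          rw [sub_sub]
        have h2 := h1 0
        rw [add_zero] at h2
        rw [h2]
        unfold torusCoord torusRadius at *
        cases h : B.orientation <;> simp only [h, h1] at hz ⊢
        · exact hρr hz
        · exact hσs hz
      A := A'
      zero_mem := ⟨α₀, hα₀, by simpa using hδ, sub_self _⟩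
      f := fun α' ζ => B.graph (sel α') (ζ₀ + ζ) - η₀ - α'
      f_zero := fun α' hα' => by
        rw [add_zero, hseleq α' hα', sub_self]
      holo := fun α' hα' => by
        have h1 : DifferentiableOn ℂ (fun ζ => B.graph (sel α') (ζ₀ + ζ)) (ball 0 ρ) :=
          (differentiableOn_graph (hsel α' hα')).comp (by fun_prop) fun ζ hζ => hρr (hadd ζ hζ)
        exact (h1.sub_const _).sub_const _
      mem_ball := fun α' hα' ζ hζ => by
        have h1 := hgraph _ (hsel α' hα') (hselδ α' hα') _ (hadd ζ hζ)
        rw [Metric.mem_ball, dist_eq_norm] at h1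
        rw [mem_ball_zero_iff]
        refine lt_of_eq_of_lt ?_ h1
        congr 1; ring
      isEmbedding := by
        have h1 := B.isEmbedding.comp (hshift.prodMap hselemb)
        have h2 : (fun q : ball (0 : ℂ) ρ × A' => boxParam Λ B.orientation B.chart
            (torusCoord B.orientation B.z₀ ζ₀ η₀) (projCoord B.orientation B.w₀ ζ₀ η₀) q.1
            ((q.2 : ℂ) + (B.graph (sel q.2) (ζ₀ + q.1) - η₀ - q.2))) = _ :=
          funext fun q => hpt _ _
        rw [h2]
        exact h1 }
  have hpl : ∀ α', B'.plaque α' = B.pt (sel α') '' ball ζ₀ ρ := by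
    intro α'
    have h1 : ball ζ₀ ρ = (fun ζ => ζ₀ + ζ) '' ball (0 : ℂ) ρ := by simp
    rw [h1, image_image]
    exact image_congr fun ζ _ => hpt α' ζ
  have hptB' : ∀ α' ζ, B'.pt α' ζ = B.pt (sel α') (ζ₀ + ζ) := hpt
  have hsupp : B'.support = (fun q : ball (0 : ℂ) B.r × B.A => B.pt q.2 q.1) ''
      ((Subtype.val ⁻¹' ball ζ₀ ρ) ×ˢ (Subtype.val ⁻¹' ball α₀ δ)) := by
    ext x
    constructor
    · intro hx
      obtain ⟨α', hα', ζ, hζ, rfl⟩ := mem_support.1 hx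
      exact ⟨(⟨ζ₀ + ζ, hρr (hadd ζ hζ)⟩, ⟨sel α', hsel α' hα'⟩), ⟨hadd ζ hζ, hselδ α' hα'⟩,
        (hptB' α' ζ).symm⟩
    · rintro ⟨⟨⟨ζ, hζ⟩, ⟨α, hα⟩⟩, ⟨h1, h2⟩, rfl⟩
      have hmem : B.graph α ζ₀ - η₀ ∈ A' := ⟨α, hα, h2, rfl⟩
      have hs : sel (B.graph α ζ₀ - η₀) = α :=
        graph_inj (hsel _ hmem) hα hζ₀ (sub_left_inj.1 (hseleq _ hmem))
      refine mem_support.2 ⟨_, hmem, ζ - ζ₀, ?_, ?_⟩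
      · rw [mem_ball_zero_iff, ← dist_eq_norm]; exact h1
      · rw [hptB', hs]; simp
  obtain ⟨U, hU, hXU⟩ := hB.1.exists_inter_eq_image
    (O := (Subtype.val ⁻¹' ball ζ₀ ρ) ×ˢ (Subtype.val ⁻¹' ball α₀ δ))
    ((isOpen_ball.preimage continuous_subtype_val).prod
      (isOpen_ball.preimage continuous_subtype_val))
  rw [← hsupp] at hXU
  refine ⟨B', ⟨⟨U, hU, hXU⟩, fun B'' hB'' => ?_⟩, ?_, fun α' hα' =>
    ⟨sel α', hsel α' hα', hselδ α' hα', hpl α'⟩⟩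
  · rw [compatible_iff]
    rintro α' hα' β hβ p ⟨⟨ζ, hζ, rfl⟩, hpβ⟩
    change B'.pt α' ζ ∈ _ at hpβ
    change 𝓝[_] (B'.pt α' ζ) = 𝓝[_] (B'.pt α' ζ)
    rw [nhdsWithin_plaque hα' hζ]
    rw [hptB'] at hpβ ⊢
    have hin := hρr (hadd ζ hζ)
    rw [← compatible_iff.1 (hB.2 B'' hB'') _ (hsel α' hα') β hβ _ ⟨pt_mem_plaque hin, hpβ⟩,
      nhdsWithin_plaque (hsel α' hα') hin, ← map_add_left_nhds, map_map]
    exact map_congr (Eventually.of_forall fun ζ => hptB' α' ζ)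
  · have hmem : B.pt α₀ ζ₀ ∈ L.carrier ∩ U := by
      rw [hXU, hsupp]
      exact ⟨(⟨ζ₀, hζ₀⟩, ⟨α₀, hα₀⟩), ⟨mem_ball_self hρ, mem_ball_self hδ⟩, rfl⟩
    filter_upwards [hU.mem_nhds hmem.2] with x hx hxX
    rw [← hXU]
    exact ⟨hxX, hx⟩

end Lamination

/-! ### From the absence of close plaques to bounds on intersections -/

namespace FlowBox

open Filter

variable {Λ : Submodule ℤ ℂ} {B : FlowBox Λ}

variable (B) in
/-- The zeros of the gap in a disk. -/
def gapZeros (ζ₀ : ℂ) (ρ : ℝ) (α β ε : ℂ) : Set ℂ := {ζ ∈ ball ζ₀ ρ | B.gap α β ε ζ = 0}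

/-- The intersection points of a plaque with a translate correspond to the zeros of the gap. -/
theorem inter_subset_image_gapZeros {α β ε ζ₀ : ℂ} {ρ : ℝ} (hα : α ∈ B.A)
    (hρ : ‖ζ₀‖ + ρ + ‖ε‖ ≤ B.r) (hs : ∀ ζ ∈ ball ζ₀ ρ, ‖B.graph β ζ‖ + ‖ε‖ < B.s) :
    B.pt α '' ball ζ₀ ρ ∩ torusTranslation Λ ε '' (B.pt β '' ball ζ₀ ρ) ⊆
      B.pt α '' B.gapZeros ζ₀ ρ α β ε := by
  rintro _ ⟨⟨ζ, hζ, rfl⟩, ⟨_, ⟨ξ, hξ, rfl⟩, heq⟩⟩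
  rw [pt, pt, torusTranslation_param] at heq
  have hbs := norm_baseShift_le (B := B) ε
  have hfs := norm_fiberShift_le (B := B) ε
  have hζr : ζ ∈ ball (0 : ℂ) B.r :=
    ball_subset_of_norm_add_le (by linarith [norm_nonneg ε]) hζ
  have hξn : ‖ξ‖ < ‖ζ₀‖ + ρ := mem_ball_zero_iff.1 (ball_subset_of_norm_add_le le_rfl hξ)
  -- The margins of size `‖ε‖` keep the translated point in the coordinate bidisk of `B`, where
  -- equality of points gives equality of coordinates.
  obtain ⟨h1, h2⟩ := param_inj
    (by rw [mem_ball_zero_iff]; linarith [norm_add_le ξ (B.baseShift ε)])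
    (by rw [mem_ball_zero_iff]; linarith [norm_add_le (B.graph β ξ) (B.fiberShift ε), hs ξ hξ])
    hζr (graph_mem hα hζr) heq
  refine ⟨ζ, ⟨hζ, ?_⟩, rfl⟩
  rw [gap, ← h2, ← h1]; simp

/-- Finiteness and the cardinality bound are negated together: an infinite set contains finite
subsets of every size, so one argument proves both. -/
theorem exists_finset_of_not {S : Set ℂ} {N : ℕ} (h : ¬ (S.Finite ∧ S.ncard < N)) :
    ∃ Z : Finset ℂ, ↑Z ⊆ S ∧ Z.card = N := by
  by_cases hS : S.Finite
  · have h1 : N ≤ S.ncard := not_lt.1 fun h2 => h ⟨hS, h2⟩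
    rw [ncard_eq_toFinset_card S hS] at h1
    obtain ⟨Z, hZ, hc⟩ := Finset.exists_subset_card_eq h1
    exact ⟨Z, fun x hx => (hS.mem_toFinset).1 (hZ hx), hc⟩
  · exact Set.Infinite.exists_subset_card_eq hS N

theorem norm_gap_le_of_not {α β ε ζ₀ : ℂ} {ρ M : ℝ} {N : ℕ} (hα : α ∈ B.A) (hβ : β ∈ B.A)
    (hρ : 0 < ρ) (h : ‖ζ₀‖ + 8 * ρ + ‖ε‖ ≤ B.r) (hM : ∀ ζ ∈ ball ζ₀ (8 * ρ), ‖B.gap α β ε ζ‖ ≤ M)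
    (hN : ¬ ((B.gapZeros ζ₀ ρ α β ε).Finite ∧ (B.gapZeros ζ₀ ρ α β ε).ncard < N)) :
    ∀ ζ ∈ ball ζ₀ ρ, ‖B.gap α β ε ζ‖ ≤ M * (1 / 3) ^ N := by
  obtain ⟨Z, hZ, rfl⟩ := exists_finset_of_not hN
  exact norm_le_of_card_zeros hρ (differentiableOn_gap hα hβ h) hM Z fun a ha => hZ ha

theorem tendsto_of_norm_sub_lt {α : ℕ → ℂ} {α₀ : ℂ}
    (h : ∀ n : ℕ, dist (α n) α₀ < 1 / ((n : ℝ) + 1)) : Tendsto α atTop (𝓝 α₀) := by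
  rw [tendsto_iff_dist_tendsto_zero]
  exact squeeze_zero (fun _ => dist_nonneg) (fun n => (h n).le)
    tendsto_one_div_add_atTop_nhds_zero_nat

/-- Without flat close plaques, the number of intersections grows at most logarithmically. -/
theorem exists_ncard_lt_log {α₀ ζ₀ : ℂ} {ρ : ℝ} (hρ : 0 < ρ) (h : ‖ζ₀‖ + 8 * ρ < B.r)
    (hno : ¬ B.ClosePlaques flatGauge α₀ ζ₀) :
    ∃ n : ℕ, ∀ α ∈ B.A, ∀ β ∈ B.A, ∀ ε : ℂ, dist α α₀ < 1 / ((n : ℝ) + 1) →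
      dist β α₀ < 1 / ((n : ℝ) + 1) → 0 < ‖ε‖ → ‖ε‖ < 1 / ((n : ℝ) + 1) →
      (B.gapZeros ζ₀ ρ α β ε).Finite ∧
        ((B.gapZeros ζ₀ ρ α β ε).ncard : ℝ) < (n + 1) * Real.log (1 / ‖ε‖) := by
  by_contra! hcon
  -- The same `n` controls the distance to `α₀`, the size of `ε` and the constant before the
  -- logarithm, so a failure for every `n` yields convergent sequences at once.
  choose α hα β hβ ε hαd hβd hε0 hεd hbig using hcon
  have hεt : Tendsto ε atTop (𝓝 0) := tendsto_of_norm_sub_lt fun n => by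
    rw [dist_zero_right]; exact hεd n
  have hε : ∀ n, ε n ≠ 0 := fun n => norm_pos_iff.1 (hε0 n)
  refine hno ⟨α, β, ε, hα, hβ, hε, tendsto_of_norm_sub_lt hαd, tendsto_of_norm_sub_lt hβd, hεt,
    ρ, hρ, fun k => ?_⟩
  have hs := B.s_pos
  have hεn := hεt.norm
  rw [norm_zero] at hεn
  filter_upwards [hεn.eventually_lt_const (lt_min one_pos (sub_pos.2 h)), eventually_ge_atTop k,
    (tendsto_norm_nhdsGT hε hεt).eventually (eventually_mul_le_one (2 * B.s + 1))]
    with n hn1 hn2 hn3 ζ hζ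
  have h1 : ‖ε n‖ < 1 := hn1.trans_le (min_le_left _ _)
  have h2 : ‖ζ₀‖ + 8 * ρ + ‖ε n‖ ≤ B.r := by linarith [hn1.trans_le (min_le_right _ _)]
  have hpos := hε0 n
  set x := ((n : ℝ) + 1) * Real.log (1 / ‖ε n‖) with hx
  have hN := norm_gap_le_of_not (N := ⌈x⌉₊) (hα n) (hβ n) hρ h2
    (fun z hz => (norm_gap_le_of_mem (hα n) (hβ n) h2 hz).trans
      (show _ ≤ 2 * B.s + 1 by linarith))
    (fun hc => absurd (Nat.lt_ceil.1 hc.2) (not_lt.2 (hbig n hc.1))) ζ hζ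
  have h3 : ((1 : ℝ) / 3) ^ ⌈x⌉₊ ≤ ‖ε n‖ ^ (n + 1) := by
    -- Since `1/3 ≤ 1/e`, more than `(n + 1) log(1/|ε|)` zeros, up to rounding, give the factor `|ε|
    -- ^ (n + 1)`; one power absorbs the bound on the gap.
    have e1 : (1 : ℝ) / 3 ≤ Real.exp (-1) := by
      rw [Real.exp_neg, ← one_div]
      exact one_div_le_one_div_of_le (Real.exp_pos 1) (by linarith [Real.exp_one_lt_d9])
    calc ((1 : ℝ) / 3) ^ ⌈x⌉₊ ≤ Real.exp (-1) ^ ⌈x⌉₊ := by gcongr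
      _ = Real.exp (-⌈x⌉₊) := by rw [← Real.exp_nat_mul]; ring_nf
      _ ≤ Real.exp (-x) := Real.exp_le_exp.2 (neg_le_neg (Nat.le_ceil x))
      _ = Real.exp (Real.log ‖ε n‖) ^ (n + 1) := by
        rw [← Real.exp_nat_mul, hx, one_div, Real.log_inv]; push_cast; ring_nf
      _ = ‖ε n‖ ^ (n + 1) := by rw [Real.exp_log hpos]
  rw [flatGauge]
  calc ‖B.gap (α n) (β n) (ε n) ζ‖ ≤ (2 * B.s + 1) * (1 / 3) ^ ⌈x⌉₊ := hN
    _ ≤ (2 * B.s + 1) * ‖ε n‖ ^ (n + 1) := by gcongr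
    _ = ((2 * B.s + 1) * ‖ε n‖) * ‖ε n‖ ^ n := by ring
    _ ≤ 1 * ‖ε n‖ ^ n := by gcongr
    _ ≤ ‖ε n‖ ^ k := by rw [one_mul]; exact pow_le_pow_of_le_one hpos.le h1.le hn2

/-- Without close plaques in a bi-Lipschitz flow box, the number of intersections is bounded. -/
theorem IsBiLipschitz.exists_ncard_lt {α₀ ζ₀ : ℂ} {ρ : ℝ} (hB : B.IsBiLipschitz) (hρ : 0 < ρ)
    (h : ‖ζ₀‖ + 8 * ρ < B.r) (hno : ¬ B.ClosePlaques linearGauge α₀ ζ₀) :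
    ∃ n : ℕ, ∀ α ∈ B.A, ∀ β ∈ B.A, ∀ ε : ℂ, dist α α₀ < 1 / ((n : ℝ) + 1) →
      dist β α₀ < 1 / ((n : ℝ) + 1) → 0 < ‖ε‖ → ‖ε‖ < 1 / ((n : ℝ) + 1) →
      (B.gapZeros ζ₀ ρ α β ε).Finite ∧ (B.gapZeros ζ₀ ρ α β ε).ncard < n + 1 := by
  by_contra! hcon
  choose α hα β hβ ε hαd hβd hε0 hεd hbig using hcon
  have hεt : Tendsto ε atTop (𝓝 0) := tendsto_of_norm_sub_lt fun n => by
    rw [dist_zero_right]; exact hεd n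
  have hε : ∀ n, ε n ≠ 0 := fun n => norm_pos_iff.1 (hε0 n)
  refine hno ⟨α, β, ε, hα, hβ, hε, tendsto_of_norm_sub_lt hαd, tendsto_of_norm_sub_lt hβd, hεt,
    ρ, hρ, fun k => ?_⟩
  obtain ⟨C, hC, t₀, ht₀, hgap⟩ := hB.exists_gap_le h
  have hlim : Tendsto (fun n : ℕ => C * (1 / 3 : ℝ) ^ (n + 1)) atTop (𝓝 0) := by
    have := ((tendsto_pow_atTop_nhds_zero_of_lt_one (r := (1 / 3 : ℝ)) (by norm_num)
      (by norm_num)).comp (tendsto_add_atTop_nat 1)).const_mul C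
    simpa using this
  have hεn := hεt.norm
  rw [norm_zero] at hεn
  filter_upwards [hεn.eventually_lt_const (lt_min ht₀ (sub_pos.2 h)),
    hlim.eventually_lt_const (show (0 : ℝ) < 1 / ((k : ℝ) + 1) by positivity)]
    with n hn1 hn2 ζ hζ
  have h1 : ‖ε n‖ < t₀ := hn1.trans_le (min_le_left _ _)
  have h2 : ‖ζ₀‖ + 8 * ρ + ‖ε n‖ ≤ B.r := by linarith [hn1.trans_le (min_le_right _ _)]
  have hsub : ball ζ₀ (8 * ρ) ⊆ ball (0 : ℂ) (‖ζ₀‖ + 8 * ρ) := ball_subset_of_norm_add_le le_rfl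
  have hnot : ¬ ((B.gapZeros ζ₀ ρ (α n) (β n) (ε n)).Finite ∧
      (B.gapZeros ζ₀ ρ (α n) (β n) (ε n)).ncard < n + 1) :=
    fun hc => absurd hc.2 (not_lt.2 (hbig n hc.1))
  -- The threshold `n + 1` is positive, so a zero exists. It anchors the bound `C|ε|` on the larger
  -- disk, which the zeros then improve by `(1/3) ^ (n + 1)`.
  obtain ⟨ξ, hξ, hξ0⟩ : (B.gapZeros ζ₀ ρ (α n) (β n) (ε n)).Nonempty := by
    rw [nonempty_iff_ne_empty]
    intro he
    rw [he] at hnot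
    exact hnot ⟨finite_empty, by simp⟩
  have hb := hgap _ (hα n) _ (hβ n) _ h1 ξ (hsub (ball_subset_ball (by linarith) hξ))
    (by rw [hξ0, norm_zero]; exact norm_nonneg _)
  have hN := norm_gap_le_of_not (hα n) (hβ n) hρ h2 (fun z hz => hb z (hsub hz)) hnot ζ hζ
  rw [linearGauge, div_eq_mul_one_div]
  refine hN.trans ?_
  rw [mul_comm C, mul_assoc]
  exact mul_le_mul_of_nonneg_left hn2.le (norm_nonneg _)

end FlowBox

/-! ### Local bounds and compactness -/

namespace Lamination

open Filter FlowBox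

variable {Λ : Submodule ℤ ℂ} {L : Lamination Λ}

/-- The local form of the theorem. -/
theorem exists_flowBox_ncard_lt [DiscreteTopology Λ] [IsZLattice ℝ Λ] (hleaf : L.NoCompactLeaf)
    (hmin : ∃! Y : Set (Surface Λ), L.IsMinimalSet Y) {p : Surface Λ} (hp : p ∈ L.carrier) :
    ∃ B : FlowBox Λ, L.IsFlowBox B ∧ (∀ᶠ x in 𝓝 p, x ∈ L.carrier → x ∈ B.support) ∧
      ∃ (N : ℕ) (ε₀ A : ℝ), 0 < ε₀ ∧ ∀ α ∈ B.A, ∀ β ∈ B.A, ∀ ε : ℂ,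
        0 < ‖ε‖ → ‖ε‖ < ε₀ →
          (B.plaque α ∩ torusTranslation Λ ε '' B.plaque β).Finite ∧
          (L.IsLipschitz → (B.plaque α ∩ torusTranslation Λ ε '' B.plaque β).ncard < N) ∧
          ((B.plaque α ∩ torusTranslation Λ ε '' B.plaque β).ncard : ℝ)
            < A * Real.log (1 / ‖ε‖) := by
  obtain ⟨B, hB, hlip, hpB⟩ : ∃ B, L.IsFlowBox B ∧ (L.IsLipschitz → B.IsBiLipschitz) ∧
      p ∈ B.support := by
    -- One box has to serve both conclusions, so it is taken bi-Lipschitz whenever the lamination is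
    -- Lipschitz.
    by_cases hL : L.IsLipschitz
    · obtain ⟨B, hB, hpB, hlip⟩ := hL p hp
      exact ⟨B, hB, fun _ => hlip, hpB⟩
    · obtain ⟨B, hB, hpB⟩ := L.cover p hp
      exact ⟨B, isFlowBox_of_mem_atlas hB, fun h => absurd h hL, hpB⟩
  obtain ⟨α₀, hα₀, ζ₀, hζ₀, rfl⟩ := mem_support.1 hpB
  have hflat : ¬ B.ClosePlaques flatGauge α₀ ζ₀ :=
    not_closePlaques hleaf hmin isGauge_flatGauge (fun p hp => by
      obtain ⟨B, hB, hpB⟩ := L.cover p hp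
      exact ⟨B, isFlowBox_of_mem_atlas hB, propagates_flatGauge B, hpB⟩) hB hα₀ hζ₀
  have hlin : L.IsLipschitz → ¬ B.ClosePlaques linearGauge α₀ ζ₀ := fun hL =>
    not_closePlaques hleaf hmin isGauge_linearGauge (fun p hp => by
      obtain ⟨B, hB, hpB, hlip⟩ := hL p hp
      exact ⟨B, hB, hlip.propagates_linearGauge, hpB⟩) hB hα₀ hζ₀
  have hr0 := mem_ball_zero_iff.1 hζ₀
  have hs0 := mem_ball_zero_iff.1 (graph_mem hα₀ hζ₀)
  set σ := (B.s - ‖B.graph α₀ ζ₀‖) / 4 with hσdef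
  have hσ : 0 < σ := by linarith
  obtain ⟨δ₀, hδ₀, hnear⟩ := exists_forall_graph_near hα₀ hζ₀ hσ
  -- The zero count compares the disks of radii `ρ` and `8ρ`, and the translation needs a further
  -- margin.
  set ρ := min δ₀ ((B.r - ‖ζ₀‖) / 10) with hρdef
  have hρ : 0 < ρ := lt_min hδ₀ (by linarith)
  have hρr : ‖ζ₀‖ + 9 * ρ < B.r := by
    have : ρ ≤ (B.r - ‖ζ₀‖) / 10 := min_le_right _ _
    linarith
  obtain ⟨n₁, hn₁⟩ := exists_ncard_lt_log hρ (by linarith) hflat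
  obtain ⟨n₂, hn₂⟩ : ∃ n : ℕ, L.IsLipschitz → ∀ α ∈ B.A, ∀ β ∈ B.A, ∀ ε : ℂ,
      dist α α₀ < 1 / ((n : ℝ) + 1) →
      dist β α₀ < 1 / ((n : ℝ) + 1) → 0 < ‖ε‖ → ‖ε‖ < 1 / ((n : ℝ) + 1) →
      (B.gapZeros ζ₀ ρ α β ε).Finite ∧ (B.gapZeros ζ₀ ρ α β ε).ncard < n + 1 := by
    by_cases hL : L.IsLipschitz
    · obtain ⟨n, hn⟩ := (hlip hL).exists_ncard_lt hρ (by linarith) (hlin hL)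
      exact ⟨n, fun _ => hn⟩
    · exact ⟨0, fun h => absurd h hL⟩
  have hi₁ : (0 : ℝ) < 1 / ((n₁ : ℝ) + 1) := by positivity
  have hi₂ : (0 : ℝ) < 1 / ((n₂ : ℝ) + 1) := by positivity
  obtain ⟨δ, hδ, hδ₀', hδ₁, hδ₂⟩ : ∃ δ > 0, δ ≤ δ₀ ∧ δ ≤ 1 / ((n₁ : ℝ) + 1) ∧
      δ ≤ 1 / ((n₂ : ℝ) + 1) :=
    ⟨min δ₀ (min _ _), lt_min hδ₀ (lt_min hi₁ hi₂), min_le_left _ _,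
      (min_le_right _ _).trans (min_le_left _ _), (min_le_right _ _).trans (min_le_right _ _)⟩
  obtain ⟨B', hB', hsupp, hplaques⟩ := hB.exists_subBox hα₀ hρ hσ hδ
    (ball_subset_of_norm_add_le (by linarith)) (ball_subset_of_norm_add_le (by linarith))
    (fun α hα hαδ ζ hζ => (hnear α hα (hαδ.trans_le hδ₀') ζ
      (ball_subset_ball (min_le_left _ _) hζ)).1)
  refine ⟨B', hB', hsupp, n₂ + 1, min (min δ ρ) σ, n₁ + 1, lt_min (lt_min hδ hρ) hσ, ?_⟩
  intro α' hα' β' hβ' ε hε0 hε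
  have hεδ : ‖ε‖ < δ := hε.trans_le ((min_le_left _ _).trans (min_le_left _ _))
  have hερ : ‖ε‖ < ρ := hε.trans_le ((min_le_left _ _).trans (min_le_right _ _))
  have hεσ : ‖ε‖ < σ := hε.trans_le (min_le_right _ _)
  obtain ⟨α, hα, hαδ, hαp⟩ := hplaques α' hα'
  obtain ⟨β, hβ, hβδ, hβp⟩ := hplaques β' hβ'
  rw [hαp, hβp]
  have hsub := inter_subset_image_gapZeros (B := B) (α := α) (β := β) (ε := ε) (ζ₀ := ζ₀) (ρ := ρ)
    hα (by linarith) (fun ζ hζ => by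
      have h1 := (hnear β hβ (hβδ.trans_le hδ₀') ζ (ball_subset_ball (min_le_left _ _) hζ)).1
      have h2 := norm_le_norm_add_norm_sub' (B.graph β ζ) (B.graph α₀ ζ₀)
      rw [dist_eq_norm] at h1
      linarith)
  obtain ⟨hfin, hlog⟩ := hn₁ α hα β hβ ε (hαδ.trans_le hδ₁) (hβδ.trans_le hδ₁) hε0
    (hεδ.trans_le hδ₁)
  have hcard := (ncard_le_ncard hsub (hfin.image _)).trans (ncard_image_le hfin)
  refine ⟨(hfin.image _).subset hsub, fun hL => hcard.trans_lt ?_, ?_⟩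
  · exact (hn₂ hL α hα β hβ ε (hαδ.trans_le hδ₂) (hβδ.trans_le hδ₂) hε0 (hεδ.trans_le hδ₂)).2
  · exact lt_of_le_of_lt (by exact_mod_cast hcard) hlog

end Lamination

theorem mainTheorem8 (Λ : Submodule ℤ ℂ) [DiscreteTopology Λ] [IsZLattice ℝ Λ]
    (L : Lamination Λ) (hleaf : L.NoCompactLeaf)
    (hmin : ∃! Y : Set (Surface Λ), L.IsMinimalSet Y) :
    ∃ (n : ℕ) (B : Fin n → FlowBox Λ),
      (∀ i, L.IsFlowBox (B i)) ∧ (L.carrier ⊆ ⋃ i, (B i).support) ∧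
      ∃ (N : ℕ) (ε₀ A : ℝ), 0 < ε₀ ∧ 0 < A ∧
        ∀ i, ∀ α ∈ (B i).A, ∀ β ∈ (B i).A, ∀ ε : ℂ, 0 < ‖ε‖ → ‖ε‖ < ε₀ →
          ((B i).plaque α ∩ torusTranslation Λ ε '' (B i).plaque β).Finite ∧
          (L.IsLipschitz →
            ((B i).plaque α ∩ torusTranslation Λ ε '' (B i).plaque β).ncard < N) ∧
          (((B i).plaque α ∩ torusTranslation Λ ε '' (B i).plaque β).ncard : ℝ)
            < A * Real.log (1 / ‖ε‖) := by
  have hloc := fun p (hp : p ∈ L.carrier) => Lamination.exists_flowBox_ncard_lt hleaf hmin hp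
  have : Nonempty (FlowBox Λ) := by
    obtain ⟨Y, hY⟩ := hmin.exists
    obtain ⟨p, hp⟩ := hY.1.1
    exact ⟨(L.cover p (hY.1.2.2.1 hp)).choose⟩
  choose! B hB hcov N ε₀ A hε₀ hmain using hloc
  obtain ⟨t, htX, ht⟩ := L.isCompact_carrier.elim_nhds_subcover
    (fun p => {x | x ∈ L.carrier → x ∈ (B p).support}) hcov
  let e := t.equivFin.symm
  have heX : ∀ i, (e i : Surface Λ) ∈ L.carrier := fun i => htX _ (e i).2
  obtain ⟨N', hN'⟩ : ∃ N', ∀ i, N (e i) ≤ N' :=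
    (Filter.eventually_all.2 fun i => Filter.eventually_ge_atTop (N (e i))).exists
  obtain ⟨A', hA'0, hA'⟩ : ∃ A' : ℝ, 0 < A' ∧ ∀ i, A (e i) ≤ A' :=
    ((Filter.eventually_gt_atTop 0).and (Filter.eventually_all.2 fun i => Filter.eventually_ge_atTop (A (e i)))).exists
  -- Taking `ε' < 1` makes `log(1/|ε|)` nonnegative, so the constants of the individual boxes can be
  -- replaced by the larger `A'`.
  obtain ⟨ε', ⟨hε'0, hε'1⟩, hε'⟩ : ∃ ε' : ℝ, (0 < ε' ∧ ε' < 1) ∧ ∀ i, ε' < ε₀ (e i) := by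
    have h1 : ∀ᶠ x in 𝓝[>] (0 : ℝ), ∀ i, x < ε₀ (e i) := Filter.eventually_all.2 fun i =>
      nhdsWithin_le_nhds (eventually_lt_nhds (hε₀ _ (heX i)))
    have h2 : ∀ᶠ x in 𝓝[>] (0 : ℝ), 0 < x ∧ x < 1 := Ioo_mem_nhdsGT one_pos
    exact (h2.and h1).exists
  refine ⟨t.card, fun i => B (e i), fun i => hB _ (heX i), fun x hx => ?_, N', ε', A', hε'0,
    hA'0, fun i α hα β hβ ε h1 h2 => ?_⟩
  · obtain ⟨p, hp, hxp⟩ := mem_iUnion₂.1 (ht hx)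
    refine mem_iUnion.2 ⟨t.equivFin ⟨p, hp⟩, ?_⟩
    simpa [e] using hxp hx
  · obtain ⟨hf, hl, hg⟩ := hmain _ (heX i) α hα β hβ ε h1 (h2.trans (hε' i))
    refine ⟨hf, fun hL => (hl hL).trans_le (hN' i), hg.trans_le ?_⟩
    have : 0 ≤ Real.log (1 / ‖ε‖) := Real.log_nonneg (by
      rw [le_div_iff₀ h1]; linarith)
    gcongr
    exact hA' i
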